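/- Let $n\ge 2$ and let $d_1,\dots,d_n\ge 2$ be integers. For each $i$ let $Q_{d_i-1}(t)$ be a real polynomial of degree $d_i-1$ that has no $t^{d_i-2}$ term, i.e. $Q_{d_i-1}(t)=C_i t^{d_i-1}+\varphi_i(t)$ with $C_i \neq 0$ a constant and $\varphi_i$ a polynomial of degree at most $d_i-3$ if $d_i>2$, and $Q_{d_i-1}(t)=C_i t$ with $C_i\neq 0$ if $d_i=2$. Let $y_1,\dots,y_n\in\mathbb{R}$, $P_1,\dots,P_n>0$, $a>0$ and $b\in\mathbb{R}$ be fixed. For real $\lambda$ define $$N(\lambda)=\sum_{\substack{m=(m_1,\dots,m_n)\in\mathbb{R}^n\\ m_1-y_1,\dots,m_n-y_n\in\mathbb{Z}_{\ge 0}\\ P_1m_1^2+\dots+P_nm_n^2\le a\lambda^2+b}} Q_{d_1-1}(m_1)\cdots Q_{d_n-1}(m_n),$$ and put $d=d_1+\dots+d_n$. Then there is a real constant $C$, independent of $\lambda$, such that $$N(\lambda)=C\lambda^{d}+O\!\left(\lambda^{\,d-1-\frac{n-1}{n+1}}\right)\qquad\text{as }\lambda\to\infty.$$ -/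

import Mathlib

open Filter Asymptotics

/-- The points `m ∈ ℝⁿ` with every `m i - y i` a nonnegative integer which lie in the ellipsoid
`∑ P i * (m i)² ≤ R`. -/
def shiftedEllipsoidPoints {n : ℕ} (y P : Fin n → ℝ) (R : ℝ) : Set (Fin n → ℝ) :=
  {m | (∀ i, ∃ k : ℕ, m i - y i = k) ∧ ∑ i, P i * m i ^ 2 ≤ R}

/-- There are only finitely many such points, so that the sum below is an honest finite sum. -/
theorem shiftedEllipsoidPoints_finite {n : ℕ} (y P : Fin n → ℝ) (hP : ∀ i, 0 < P i) (R : ℝ) :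
    (shiftedEllipsoidPoints y P R).Finite := by
  have hfin : ∀ i, ((fun k : ℕ => y i + (k : ℝ)) ''
      (Set.Iic ⌈R / P i + 1 + |y i|⌉₊)).Finite := fun i => (Set.finite_Iic _).image _
  refine (Set.Finite.pi' hfin).subset ?_
  rintro m ⟨hm, hR⟩ i
  obtain ⟨k, hk⟩ := hm i
  refine ⟨k, ?_, by simp only; linarith⟩
  have h1 : P i * m i ^ 2 ≤ R :=
    (Finset.single_le_sum (f := fun i => P i * m i ^ 2)
      (fun j _ => mul_nonneg (hP j).le (sq_nonneg _)) (Finset.mem_univ i)).trans hR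
  have h2 : m i ^ 2 ≤ R / P i := by
    rw [le_div_iff₀ (hP i)]; linarith
  have h3 : (k : ℝ) ≤ R / P i + 1 + |y i| := by
    have := neg_abs_le (y i)
    nlinarith [sq_nonneg (m i - 1), sq_nonneg (m i)]
  exact_mod_cast h3.trans (Nat.le_ceil _)

/-- The sum of `∏ Q i (m i)` over these points `m`. -/
noncomputable def weightedLatticeSum {n : ℕ} (y P : Fin n → ℝ) (Q : Fin n → Polynomial ℝ)
    (R : ℝ) : ℝ :=
  ∑ᶠ m ∈ shiftedEllipsoidPoints y P R, ∏ i, (Q i).eval (m i)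

/-! Put `Λ = √(a λ² + b)` and scale the lattice by `1/Λ`. The sum becomes a power of `Λ` times a sum
of product weights `∏ V i (u i)` over a shifted lattice of mesh `1/Λ`, cut off by the indicator of
`∑ P i * u i² ≤ 1`. The aim is to compare it with `Λⁿ` times the corresponding integral.

Replace the indicator by a cutoff `F` that is smooth at scale `δ` and write `F s = 2 Re ∫_{T>0} ψ(T)
e(T(s-1)) dT`, where `e(x) = exp(2πix)`, with `ψ(T) = O(1/T)` damped beyond `T ~ 1/δ`
(`exists_isCutoff`). The form is diagonal, so for fixed `T` the sum over the lattice factors into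
one-variable sums with phase `P i * T * u²`. Poisson summation (`norm_lattice_sum_sub_le`) turns
each factor into a sum of oscillatory integrals `osc` over frequencies `ξ = kΛ`, of which only `|k|
≲ T/Λ` can be stationary. The zero frequencies give exactly the integral to be compared with
(`sum_mul_cutoff_eq`, `integral_mul_cutoff_eq`).

A stationary `osc` has size `T^(-1/2)` and phase `-ξ²/(4 P i T)`, so a frequency vector contributes
the phase `-(T + X/T)` with `X = ∑ ξ i²/(4 P i)`. Integrating over `[T₀, 2T₀]` as well saves a
further square root, uniformly in `X` (`norm_integral_cexp2pi_add_div_le`,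
`norm_integral_block_le`): each vector contributes `T₀^(-(n+1)/2)`. There are about `(T₀/Λ)ⁿ`
vectors, and the dyadic sum is dominated by `T₀ ~ 1/δ`, which gives `Λ⁻ⁿ δ^(-(n-1)/2)`. For `T ≲ Λ`
there are no nonzero stationary frequencies and the error is `Λ⁻²`. Together these give
`exists_abs_sum_sub_integral_le`.

Removing the smoothing costs the mass of a shell of width `δ`, which the same estimate controls for
lattice points and a volume computation controls for the integral
(`exists_abs_sum_sub_integral_leOne_le`). Equating `δ` with `Λ⁻ⁿ δ^(-(n-1)/2)` gives `δ =
Λ^(-2n/(n+1))` (`smoothing_balance`), and `2n/(n+1) = 1 + (n-1)/(n+1)` is the saving claimed.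

Two points concern the weights. The truncation `m i ≥ y i` becomes a smooth step placed between
lattice points; after scaling it looks like a kink at `0`, so when `d i = 2` second derivatives are
bounded only in `L¹`, and `IsAmplitude` asks for no more. The missing coefficient of `Q i` makes the
scaled weight `L¹`-close to its homogeneous limit to order `Λ⁻²` instead of `Λ⁻¹`
(`exists_integral_abs_sub_limitWeight_le`); this is what removes a secondary term of order
`Λ^(d-1)`. -/

namespace LatticeEllipsoid
open MeasureTheory Set intervalIntegral
open scoped Real Topology

/-! ### Oscillatory integrals in one variable -/

/-- The additive character `x ↦ exp (2πix)`. -/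
noncomputable def cexp2pi (x : ℝ) : ℂ := Complex.exp ((2 * π * x : ℝ) * Complex.I)

@[simp] theorem norm_cexp2pi (x : ℝ) : ‖cexp2pi x‖ = 1 := Complex.norm_exp_ofReal_mul_I _

theorem cexp2pi_add (x y : ℝ) : cexp2pi (x + y) = cexp2pi x * cexp2pi y := by
  rw [cexp2pi, cexp2pi, cexp2pi, ← Complex.exp_add]; congr 1; push_cast; ring

@[simp] theorem cexp2pi_zero : cexp2pi 0 = 1 := by simp [cexp2pi]

theorem conj_cexp2pi (x : ℝ) : (starRingEnd ℂ) (cexp2pi x) = cexp2pi (-x) := by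
  rw [cexp2pi, cexp2pi, ← Complex.exp_conj]; congr 1
  rw [map_mul, Complex.conj_ofReal, Complex.conj_I]; push_cast; ring

theorem cexp2pi_sum {ι : Type*} (s : Finset ι) (f : ι → ℝ) :
    cexp2pi (∑ i ∈ s, f i) = ∏ i ∈ s, cexp2pi (f i) := by
  classical
  induction s using Finset.induction_on with
  | empty => simp
  | insert a s ha ih => rw [Finset.sum_insert ha, Finset.prod_insert ha, cexp2pi_add, ih]

@[fun_prop] theorem continuous_cexp2pi : Continuous cexp2pi := by
  unfold cexp2pi; fun_prop

theorem hasDerivAt_cexp2pi_comp {f : ℝ → ℝ} {f' x : ℝ} (hf : HasDerivAt f f' x) :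
    HasDerivAt (fun t => cexp2pi (f t)) (2 * π * Complex.I * f' * cexp2pi (f x)) x := by
  unfold cexp2pi
  have h1 : HasDerivAt (fun t => ((2 * π * f t : ℝ) : ℂ) * Complex.I)
      (((2 * π * f' : ℝ) : ℂ) * Complex.I) x :=
    ((hf.const_mul (2 * π)).ofReal_comp).mul_const _
  convert! h1.cexp using 1
  push_cast; ring

/-- Partial integration: an oscillating factor with bounded primitives against an amplitude of
bounded variation. -/
theorem norm_integral_mul_le {a b M : ℝ} (hab : a ≤ b) {u u' h : ℝ → ℂ}
    (hu : ∀ x ∈ Icc a b, HasDerivAt u (u' x) x) (hu' : ContinuousOn u' (Icc a b))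
    (hh : ContinuousOn h (Icc a b)) (hM : ∀ t ∈ Icc a b, ‖∫ x in a..t, h x‖ ≤ M) :
    ‖∫ x in a..b, u x * h x‖ ≤ M * (‖u b‖ + ∫ x in a..b, ‖u' x‖) := by
  have huI : uIcc a b = Icc a b := uIcc_of_le hab
  have hhi : IntervalIntegrable h volume a b := (huI ▸ hh).intervalIntegrable
  have hui : IntervalIntegrable u' volume a b := (huI ▸ hu').intervalIntegrable
  have hHc : ContinuousOn (fun t => ∫ x in a..t, h x) (Icc a b) := by
    have := continuousOn_primitive_interval' hhi (left_mem_uIcc)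
    rwa [huI] at this
  have key := integral_mul_deriv_eq_deriv_mul_of_hasDerivAt (a := a) (b := b) (u := u) (u' := u')
    (v := fun t => ∫ x in a..t, h x) (v' := h)
    (by rw [huI]; exact fun x hx => (hu x hx).continuousAt.continuousWithinAt)
    (by rw [huI]; exact hHc)
    (fun x hx => hu x (by rw [min_eq_left hab, max_eq_right hab] at hx; exact Ioo_subset_Icc_self hx))
    (fun x hx => by
      rw [min_eq_left hab, max_eq_right hab] at hx
      refine integral_hasDerivAt_right (hhi.mono_set ?_) ?_ ?_
      · rw [huI, uIcc_of_le hx.1.le]; exact Icc_subset_Icc_right hx.2.le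
      · exact ContinuousOn.stronglyMeasurableAtFilter isOpen_Ioo
          (hh.mono Ioo_subset_Icc_self) x hx
      · exact hh.continuousAt (Icc_mem_nhds hx.1 hx.2))
    hui hhi
  have hM0 : 0 ≤ M := (norm_nonneg _).trans (hM a (left_mem_Icc.2 hab))
  rw [key]
  simp only [integral_same, mul_zero, sub_zero]
  have h2 : ‖∫ x in a..b, u' x * ∫ y in a..x, h y‖ ≤ M * ∫ x in a..b, ‖u' x‖ := by
    rw [← intervalIntegral.integral_const_mul]
    refine norm_integral_le_of_norm_le hab ?_ (hui.norm.const_mul M)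
    refine Eventually.of_forall fun x hx => ?_
    rw [norm_mul, mul_comm]
    exact mul_le_mul_of_nonneg_right (hM x (Ioc_subset_Icc_self hx)) (norm_nonneg _)
  calc _ ≤ ‖u b * ∫ x in a..b, h x‖ + ‖∫ x in a..b, u' x * ∫ y in a..x, h y‖ := norm_sub_le _ _
    _ ≤ ‖u b‖ * M + M * ∫ x in a..b, ‖u' x‖ := by
        rw [norm_mul]
        gcongr
        exact hM b (right_mem_Icc.2 hab)
    _ = _ := by ring

/-- On `x ≥ 1` the integrand is `1/(4πi x)` times the derivative of `e(x²)`: the decreasing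
amplitude `1/x` is integrated by parts against a function whose primitives are bounded by `2`. -/
theorem norm_integral_cexp2pi_sq_le_of_one_le {a b : ℝ} (ha : 1 ≤ a) (hab : a ≤ b) :
    ‖∫ x in a..b, cexp2pi (x ^ 2)‖ ≤ 1 := by
  have hd : ∀ x : ℝ, HasDerivAt (fun t : ℝ => cexp2pi (t ^ 2))
      (2 * π * Complex.I * (2 * x : ℝ) * cexp2pi (x ^ 2)) x := fun x => by
    have := hasDerivAt_cexp2pi_comp (hasDerivAt_pow 2 x)
    simpa using this
  have hpos : ∀ x ∈ Icc a b, 0 < x := fun x hx => by linarith [hx.1]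
  have hub : ∀ x ∈ Icc a b, HasDerivAt (fun t : ℝ => ((t⁻¹ : ℝ) : ℂ))
      ((-(x ^ 2)⁻¹ : ℝ) : ℂ) x := fun x hx => (hasDerivAt_inv (hpos x hx).ne').ofReal_comp
  have hcont : ContinuousOn (fun x : ℝ => (x ^ 2)⁻¹) (Icc a b) :=
    ContinuousOn.inv₀ (by fun_prop) fun x hx => (pow_pos (hpos x hx) 2).ne'
  have h := norm_integral_mul_le (M := 2) hab hub
    (u' := fun x => ((-(x ^ 2)⁻¹ : ℝ) : ℂ))
    (h := fun x => 2 * π * Complex.I * (2 * x : ℝ) * cexp2pi (x ^ 2))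
    (Complex.continuous_ofReal.comp_continuousOn hcont.neg)
    (by fun_prop) (fun t ht => by
      rw [integral_eq_sub_of_hasDerivAt (fun x _ => hd x)
        ((by fun_prop : Continuous _).intervalIntegrable _ _)]
      refine (norm_sub_le _ _).trans ?_
      simp; norm_num)
  have hint : ∫ x in a..b, ‖((-(x ^ 2)⁻¹ : ℝ) : ℂ)‖ = a⁻¹ - b⁻¹ := by
    have h1 : ∀ x ∈ uIcc a b, HasDerivAt (fun t : ℝ => -t⁻¹) ((x ^ 2)⁻¹) x := fun x hx => by
      rw [uIcc_of_le hab] at hx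
      simpa using! (hasDerivAt_inv (hpos x hx).ne').neg
    have h2 : ∀ x : ℝ, ‖((-(x ^ 2)⁻¹ : ℝ) : ℂ)‖ = (x ^ 2)⁻¹ := fun x => by
      rw [Complex.norm_real, norm_neg, Real.norm_of_nonneg (by positivity)]
    simp_rw [h2]
    rw [integral_eq_sub_of_hasDerivAt h1 ((uIcc_of_le hab ▸ hcont).intervalIntegrable)]
    ring
  rw [hint] at h
  have hb0 : 0 < b := by linarith
  have hnb : ‖((b⁻¹ : ℝ) : ℂ)‖ = b⁻¹ := by
    rw [Complex.norm_real, Real.norm_of_nonneg (by positivity)]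
  rw [hnb] at h
  have heq : ∫ x in a..b, ((x⁻¹ : ℝ) : ℂ) * (2 * π * Complex.I * (2 * x : ℝ) * cexp2pi (x ^ 2))
      = (4 * π * Complex.I) * ∫ x in a..b, cexp2pi (x ^ 2) := by
    rw [← intervalIntegral.integral_const_mul]
    refine integral_congr fun x hx => ?_
    rw [uIcc_of_le hab] at hx
    have : (x : ℂ) ≠ 0 := by exact_mod_cast (hpos x hx).ne'
    push_cast
    field_simp
    ring
  rw [heq, norm_mul] at h
  have h4 : ‖(4 * π * Complex.I : ℂ)‖ = 4 * π := by
    simp [abs_of_pos Real.pi_pos]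
  rw [h4] at h
  have ha1 : a⁻¹ ≤ 1 := inv_le_one_of_one_le₀ ha
  have : (2 : ℝ) * (b⁻¹ + (a⁻¹ - b⁻¹)) ≤ 2 := by linarith
  have hpi := Real.pi_gt_three
  have hn := norm_nonneg (∫ x in a..b, cexp2pi (x ^ 2))
  nlinarith

theorem norm_integral_cexp2pi_sq_zero_le {b : ℝ} (hb : 0 ≤ b) :
    ‖∫ x in (0 : ℝ)..b, cexp2pi (x ^ 2)‖ ≤ 2 := by
  have triv : ∀ c : ℝ, 0 ≤ c → c ≤ 1 → ‖∫ x in (0 : ℝ)..c, cexp2pi (x ^ 2)‖ ≤ 1 := fun c h0 h1 => by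
    have := norm_integral_le_of_norm_le_const (a := 0) (b := c) (C := 1)
      (f := fun x : ℝ => cexp2pi (x ^ 2)) (fun x _ => by simp)
    rw [sub_zero, abs_of_nonneg h0] at this
    linarith
  rcases le_total b 1 with h | h
  · linarith [triv b hb h]
  · rw [← integral_add_adjacent_intervals (b := 1)
      ((by fun_prop : Continuous _).intervalIntegrable _ _)
      ((by fun_prop : Continuous _).intervalIntegrable _ _)]
    refine (norm_add_le _ _).trans ?_
    linarith [triv 1 zero_le_one le_rfl, norm_integral_cexp2pi_sq_le_of_one_le le_rfl h]

/-- Fresnel integrals are bounded. -/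
theorem norm_integral_cexp2pi_sq_le (a b : ℝ) : ‖∫ x in a..b, cexp2pi (x ^ 2)‖ ≤ 4 := by
  have h0 : ∀ b : ℝ, ‖∫ x in (0 : ℝ)..b, cexp2pi (x ^ 2)‖ ≤ 2 := fun b => by
    rcases le_total 0 b with h | h
    · exact norm_integral_cexp2pi_sq_zero_le h
    · have := norm_integral_cexp2pi_sq_zero_le (neg_nonneg.2 h)
      have e := integral_comp_neg (a := 0) (b := b) (fun x : ℝ => cexp2pi (x ^ 2))
      simp only [neg_sq, neg_zero] at e
      rw [e, integral_symm, norm_neg]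
      exact this
  rw [← integral_interval_sub_left (a := 0)
    ((by fun_prop : Continuous _).intervalIntegrable _ _)
    ((by fun_prop : Continuous _).intervalIntegrable _ _)]
  refine (norm_sub_le _ _).trans ?_
  linarith [h0 a, h0 b]

theorem norm_integral_cexp2pi_mul_sq_le {S : ℝ} (hS : 0 < S) (c a b : ℝ) :
    ‖∫ x in a..b, cexp2pi (S * (x - c) ^ 2)‖ ≤ 4 / √S := by
  have hs : 0 < √S := Real.sqrt_pos.2 hS
  have e := integral_comp_mul_sub (a := a) (b := b) (fun x : ℝ => cexp2pi (x ^ 2)) hs.ne' (√S * c)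
  have h1 : ∀ x : ℝ, (√S * x - √S * c) ^ 2 = S * (x - c) ^ 2 := fun x => by
    rw [← mul_sub, mul_pow, Real.sq_sqrt hS.le]
  simp_rw [h1] at e
  rw [e, norm_smul, norm_inv, Real.norm_of_nonneg hs.le, inv_mul_eq_div]
  gcongr
  exact norm_integral_cexp2pi_sq_le _ _

/-- The substitution `s = r - q/r` has positive Jacobian `(r² + q)/r²` and turns the oscillation
into a Fresnel integral. The remaining amplitude `2r³/(r² + q)` is at most `2b` at the endpoint and
has variation at most `6b`, whatever `q ≥ 0` is; hence `32 = 4(2 + 6)`. -/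
theorem norm_integral_cexp2pi_sq_sub_inv_le {q a b : ℝ} (hq : 0 ≤ q) (ha : 0 < a) (hab : a ≤ b) :
    ‖∫ r in a..b, (2 * r : ℝ) * cexp2pi ((r - q / r) ^ 2)‖ ≤ 32 * b := by
  have hpos : ∀ x ∈ Icc a b, 0 < x := fun x hx => by linarith [hx.1]
  have hb : 0 < b := by linarith
  have hs : ∀ x ∈ Icc a b, HasDerivAt (fun r : ℝ => r - q / r) ((x ^ 2 + q) / x ^ 2) x :=
    fun x hx => by
    have hx0 := (hpos x hx).ne'
    have h := (hasDerivAt_id x).sub ((hasDerivAt_inv hx0).const_mul q)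
    convert! h using 1
    field_simp
    ring
  have hne : ∀ x ∈ Icc a b, x ^ 2 + q ≠ 0 := fun x hx => by have := hpos x hx; positivity
  have hu : ∀ x ∈ Icc a b, HasDerivAt (fun r : ℝ => ((2 * r ^ 3 / (r ^ 2 + q) : ℝ) : ℂ))
      (((2 * x ^ 4 + 6 * q * x ^ 2) / (x ^ 2 + q) ^ 2 : ℝ) : ℂ) x := fun x hx => by
    refine HasDerivAt.ofReal_comp ?_
    have h := ((hasDerivAt_pow 3 x).const_mul 2).div ((hasDerivAt_pow 2 x).add_const q) (hne x hx)
    convert! h using 1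
    congr 1
    push_cast
    ring
  have hsc : ContinuousOn (fun r : ℝ => r - q / r) (Icc a b) :=
    fun x hx => (hs x hx).continuousAt.continuousWithinAt
  have hs'c : ContinuousOn (fun x : ℝ => (x ^ 2 + q) / x ^ 2) (Icc a b) :=
    ContinuousOn.div (by fun_prop) (by fun_prop) fun x hx => (pow_pos (hpos x hx) 2).ne'
  have hu'c : ContinuousOn (fun x : ℝ => (2 * x ^ 4 + 6 * q * x ^ 2) / (x ^ 2 + q) ^ 2)
      (Icc a b) :=
    ContinuousOn.div (by fun_prop) (by fun_prop) fun x hx => pow_ne_zero 2 (hne x hx)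
  have key := norm_integral_mul_le (M := 4) hab hu (Complex.continuous_ofReal.comp_continuousOn hu'c)
    (h := fun r => (((r ^ 2 + q) / r ^ 2 : ℝ) : ℂ) * cexp2pi ((r - q / r) ^ 2))
    ((Complex.continuous_ofReal.comp_continuousOn hs'c).mul
      (continuous_cexp2pi.comp_continuousOn (hsc.pow 2))) (fun t ht => by
      have hsub : uIcc a t ⊆ Icc a b := by
        rw [uIcc_of_le ht.1]; exact Icc_subset_Icc_right ht.2
      have e := integral_deriv_smul_comp (a := a) (b := t) (f := fun r : ℝ => r - q / r)
        (f' := fun x => (x ^ 2 + q) / x ^ 2) (g := fun x => cexp2pi (x ^ 2))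
        (fun x hx => hs x (hsub hx)) (hs'c.mono hsub) (by fun_prop)
      simp only [Function.comp_apply, Complex.real_smul] at e
      rw [e]
      exact norm_integral_cexp2pi_sq_le _ _)
  have heq : ∫ r in a..b, (2 * r : ℝ) * cexp2pi ((r - q / r) ^ 2) =
      ∫ r in a..b, ((2 * r ^ 3 / (r ^ 2 + q) : ℝ) : ℂ) *
        ((((r ^ 2 + q) / r ^ 2 : ℝ) : ℂ) * cexp2pi ((r - q / r) ^ 2)) := by
    refine integral_congr fun x hx => ?_
    rw [uIcc_of_le hab] at hx
    have h0 := hpos x hx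
    have h1 : (2 * x : ℝ) = (2 * x ^ 3 / (x ^ 2 + q)) * ((x ^ 2 + q) / x ^ 2) := by
      have := hne x hx
      field_simp
    rw [← mul_assoc, ← Complex.ofReal_mul, ← h1]
  rw [heq]
  refine key.trans ?_
  have h1 : ‖((2 * b ^ 3 / (b ^ 2 + q) : ℝ) : ℂ)‖ ≤ 2 * b := by
    rw [Complex.norm_real, Real.norm_of_nonneg (by positivity), div_le_iff₀ (by positivity)]
    nlinarith [mul_nonneg hb.le hq]
  have h2 : ∫ x in a..b, ‖(((2 * x ^ 4 + 6 * q * x ^ 2) / (x ^ 2 + q) ^ 2 : ℝ) : ℂ)‖ ≤ 6 * b := by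
    have h3 : ∫ x in a..b, ‖(((2 * x ^ 4 + 6 * q * x ^ 2) / (x ^ 2 + q) ^ 2 : ℝ) : ℂ)‖
        ≤ ∫ x in a..b, (6 : ℝ) := by
      refine integral_mono_on hab ?_ (by simp) fun x hx => ?_
      · exact ContinuousOn.intervalIntegrable (by
          rw [uIcc_of_le hab]; exact (Complex.continuous_ofReal.comp_continuousOn hu'c).norm)
      · have h0 := hpos x hx
        rw [Complex.norm_real, Real.norm_of_nonneg (by positivity), div_le_iff₀ (by positivity)]
        nlinarith [mul_nonneg hq (sq_nonneg x), sq_nonneg q, sq_nonneg (x ^ 2)]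
    refine h3.trans ?_
    rw [intervalIntegral.integral_const, smul_eq_mul]
    nlinarith
  calc _ ≤ 4 * (2 * b + 6 * b) := by gcongr
    _ = _ := by ring

/-- Bound for the oscillatory integral with phase `T + X / T`, uniform in `X ≥ 0`. -/
theorem norm_integral_cexp2pi_add_div_le {X a b : ℝ} (hX : 0 ≤ X) (ha : 0 < a) (hab : a ≤ b) :
    ‖∫ T in a..b, cexp2pi (-(T + X / T))‖ ≤ 32 * √b := by
  have hb : 0 < b := by linarith
  have hsa : 0 < √a := Real.sqrt_pos.2 ha
  have hsab : √a ≤ √b := Real.sqrt_le_sqrt hab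
  have hpos : ∀ x ∈ uIcc (√a) (√b), 0 < x := fun x hx => by
    rw [uIcc_of_le hsab] at hx; linarith [hx.1]
  have hconj : ‖∫ T in a..b, cexp2pi (-(T + X / T))‖ = ‖∫ T in a..b, cexp2pi (T + X / T)‖ := by
    simp_rw [← conj_cexp2pi]
    rw [intervalIntegral.integral_of_le hab, integral_conj, ← intervalIntegral.integral_of_le hab]
    exact RCLike.norm_conj _
  have e := integral_deriv_smul_comp' (a := √a) (b := √b) (f := fun r : ℝ => r ^ 2)
        (f' := fun x => 2 * x) (g := fun T => cexp2pi (T + X / T))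
        (fun x _ => by simpa using hasDerivAt_pow 2 x) (by fun_prop) (by
          refine continuous_cexp2pi.comp_continuousOn ?_
          refine continuousOn_id.add (continuousOn_const.div continuousOn_id ?_)
          rintro _ ⟨x, hx, rfl⟩
          exact (pow_pos (hpos x hx) 2).ne')
  simp only [Function.comp_apply, Complex.real_smul, Real.sq_sqrt ha.le, Real.sq_sqrt hb.le] at e
  rw [hconj, ← e]
  -- After `T = x²` the phase is a perfect square up to the constant `2√X`; this makes the bound
  -- uniform in `X`.
  have heq : ∫ x in √a..√b, ((2 * x : ℝ) : ℂ) * cexp2pi (x ^ 2 + X / x ^ 2) =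
      cexp2pi (2 * √X) * ∫ x in √a..√b, ((2 * x : ℝ) : ℂ) * cexp2pi ((x - √X / x) ^ 2) := by
    rw [← intervalIntegral.integral_const_mul]
    refine integral_congr fun x hx => ?_
    have h0 := (hpos x hx).ne'
    have : x ^ 2 + X / x ^ 2 = 2 * √X + (x - √X / x) ^ 2 := by
      conv_lhs => rw [← Real.sq_sqrt hX]
      field_simp
      ring
    rw [this, cexp2pi_add]
    ring
  rw [heq, norm_mul, norm_cexp2pi, one_mul]
  exact norm_integral_cexp2pi_sq_sub_inv_le (Real.sqrt_nonneg X) hsa hsab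

end LatticeEllipsoid

namespace LatticeEllipsoid
open MeasureTheory Set intervalIntegral
open scoped Real Topology

/-! ### Quadratic oscillatory integrals with a compactly supported amplitude -/

/-- `V` is a `C²` function with derivatives `V₁`, `V₂`, supported in `[-B, B]`, such that
`∫ |V₂| ≤ K`. -/
structure IsAmplitude (B K : ℝ) (V V₁ V₂ : ℝ → ℝ) : Prop where
  hasDerivAt : ∀ u, HasDerivAt V (V₁ u) u
  hasDerivAt' : ∀ u, HasDerivAt V₁ (V₂ u) u
  continuous₂ : Continuous V₂
  eq_zero : ∀ u, B ≤ |u| → V u = 0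
  eq_zero' : ∀ u, B ≤ |u| → V₁ u = 0
  integral_le : ∫ u in -B..B, |V₂ u| ≤ K

namespace IsAmplitude

variable {B K : ℝ} {V V₁ V₂ : ℝ → ℝ}

theorem continuous (h : IsAmplitude B K V V₁ V₂) : Continuous V :=
  continuous_iff_continuousAt.2 fun u => (h.hasDerivAt u).continuousAt

theorem continuous₁ (h : IsAmplitude B K V V₁ V₂) : Continuous V₁ :=
  continuous_iff_continuousAt.2 fun u => (h.hasDerivAt' u).continuousAt

theorem nonneg (h : IsAmplitude B K V V₁ V₂) (hB : 0 < B) : 0 ≤ K :=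
  (integral_nonneg (by linarith) fun _ _ => abs_nonneg _).trans h.integral_le

/-- Since `V₁` vanishes at `-B`, the `L¹` bound on `V₂` controls `V₁` uniformly; integrating once
more controls `V`. -/
theorem abs_deriv_le (h : IsAmplitude B K V V₁ V₂) (hB : 0 < B) (u : ℝ) : |V₁ u| ≤ K := by
  rcases le_total B |u| with hu | hu
  · rw [h.eq_zero' u hu, abs_zero]; exact h.nonneg hB
  · have hu' := abs_le.1 hu
    have e := integral_eq_sub_of_hasDerivAt (a := -B) (b := u) (fun x _ => h.hasDerivAt' x)
      (h.continuous₂.intervalIntegrable _ _)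
    rw [h.eq_zero' (-B) (by rw [abs_neg, abs_of_pos hB]), sub_zero] at e
    rw [← e]
    refine (abs_integral_le_integral_abs hu'.1).trans (le_trans ?_ h.integral_le)
    exact integral_mono_interval le_rfl hu'.1 hu'.2
      (Eventually.of_forall fun _ => abs_nonneg _) (h.continuous₂.abs.intervalIntegrable _ _)

theorem abs_le (h : IsAmplitude B K V V₁ V₂) (hB : 0 < B) (u : ℝ) : |V u| ≤ 2 * B * K := by
  have hK := h.nonneg hB
  rcases le_total B |u| with hu | hu
  · rw [h.eq_zero u hu, abs_zero]; positivity
  · have hu' := _root_.abs_le.1 hu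
    have e := integral_eq_sub_of_hasDerivAt (a := -B) (b := u) (fun x _ => h.hasDerivAt x)
      (h.continuous₁.intervalIntegrable _ _)
    rw [h.eq_zero (-B) (by rw [abs_neg, abs_of_pos hB]), sub_zero] at e
    rw [← e]
    have := norm_integral_le_of_norm_le_const (a := -B) (b := u) (C := K) (f := V₁)
      (fun x _ => h.abs_deriv_le hB x)
    rw [Real.norm_eq_abs, abs_of_nonneg (by linarith : 0 ≤ u - -B)] at this
    nlinarith

end IsAmplitude

/-- The oscillatory integral `∫ V(u) exp(2πi(Su² - ξu)) du` over `[-B, B]`. -/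
noncomputable def osc (B : ℝ) (V : ℝ → ℝ) (S ξ : ℝ) : ℂ :=
  ∫ u in -B..B, (V u : ℂ) * cexp2pi (S * u ^ 2 - ξ * u)

variable {B K : ℝ} {V V₁ V₂ : ℝ → ℝ}

theorem norm_osc_le (h : IsAmplitude B K V V₁ V₂) (hB : 0 < B) (S ξ : ℝ) :
    ‖osc B V S ξ‖ ≤ 4 * B ^ 2 * K := by
  have := norm_integral_le_of_norm_le_const (a := -B) (b := B) (C := 2 * B * K)
    (f := fun u => (V u : ℂ) * cexp2pi (S * u ^ 2 - ξ * u))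
    (fun x _ => by simpa using h.abs_le hB x)
  rw [abs_of_pos (by linarith : 0 < B - -B)] at this
  refine this.trans (le_of_eq ?_)
  ring

theorem complete_square {S : ℝ} (hS : S ≠ 0) (ξ u : ℝ) :
    S * u ^ 2 - ξ * u = S * (u - ξ / (2 * S)) ^ 2 + -(ξ ^ 2 / (4 * S)) := by
  field_simp
  ring

theorem norm_integral_abs_le (h : IsAmplitude B K V V₁ V₂) (hB : 0 < B) :
    ∫ u in -B..B, |V₁ u| ≤ 2 * B * K := by
  have := norm_integral_le_of_norm_le_const (a := -B) (b := B) (C := K) (f := fun u => |V₁ u|)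
    (fun x _ => by simpa using h.abs_deriv_le hB x)
  rw [abs_of_pos (by linarith : 0 < B - -B)] at this
  exact (le_abs_self _).trans (this.trans (le_of_eq (by ring)))

/-- Completing the square leaves a Fresnel integral centred at `ξ/(2S)`, bounded by `4/√S` wherever
the centre lies. The amplitude `V` vanishes at `B` and has total variation at most `2BK`. -/
theorem norm_osc_le_div_sqrt (h : IsAmplitude B K V V₁ V₂) (hB : 0 < B) {S : ℝ} (hS : 0 < S)
    (ξ : ℝ) : ‖osc B V S ξ‖ ≤ 8 * B * K / √S := by
  have e : osc B V S ξ = cexp2pi (-(ξ ^ 2 / (4 * S))) *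
      ∫ u in -B..B, (V u : ℂ) * cexp2pi (S * (u - ξ / (2 * S)) ^ 2) := by
    rw [osc, ← intervalIntegral.integral_const_mul]
    refine integral_congr fun u _ => ?_
    simp only [complete_square hS.ne' ξ u, cexp2pi_add]
    ring
  rw [e, norm_mul, norm_cexp2pi, one_mul]
  refine (norm_integral_mul_le (by linarith) (fun u _ => (h.hasDerivAt u).ofReal_comp)
    (Complex.continuous_ofReal.comp h.continuous₁).continuousOn (by fun_prop)
    (fun t _ => norm_integral_cexp2pi_mul_sq_le hS _ _ t)).trans ?_
  rw [h.eq_zero B (le_abs_self B)]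
  simp only [Complex.ofReal_zero, norm_zero, zero_add, Complex.norm_real, Real.norm_eq_abs]
  calc _ ≤ 4 / √S * (2 * B * K) := by
        gcongr
        exact norm_integral_abs_le h hB
    _ = _ := by ring

/-- Integration by parts without boundary terms. It is used both where the phase derivative can be
divided out and where the amplitude happens to contain it as a factor. -/
theorem integral_mul_deriv_cexp2pi {w w' θ θ' : ℝ → ℝ} {a b : ℝ} (hab : a ≤ b)
    (hw : ∀ u ∈ Icc a b, HasDerivAt w (w' u) u)
    (hw' : ContinuousOn w' (Icc a b)) (hθ : ∀ u, HasDerivAt θ (θ' u) u) (hθ' : Continuous θ')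
    (ha : w a = 0) (hb : w b = 0) :
    2 * π * Complex.I * ∫ u in a..b, ((w u * θ' u : ℝ) : ℂ) * cexp2pi (θ u) =
      -∫ u in a..b, (w' u : ℂ) * cexp2pi (θ u) := by
  have huI : uIcc a b = Icc a b := uIcc_of_le hab
  have hθc : Continuous θ := continuous_iff_continuousAt.2 fun u => (hθ u).continuousAt
  have key := integral_mul_deriv_eq_deriv_mul (a := a) (b := b) (u := fun u => (w u : ℂ))
    (u' := fun u => (w' u : ℂ)) (v := fun u => cexp2pi (θ u))
    (fun u hu => (hw u (huI ▸ hu)).ofReal_comp) (fun u _ => hasDerivAt_cexp2pi_comp (hθ u))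
    (ContinuousOn.intervalIntegrable (by
      rw [huI]; exact Complex.continuous_ofReal.comp_continuousOn hw'))
    ((by fun_prop : Continuous _).intervalIntegrable _ _)
  simp only [ha, hb, Complex.ofReal_zero, zero_mul, sub_self, zero_sub] at key
  rw [← key, ← intervalIntegral.integral_const_mul]
  refine integral_congr fun u _ => ?_
  push_cast
  ring

/-- Away from stationary points the oscillatory integral decays quadratically. -/
theorem norm_osc_le_div_sq (h : IsAmplitude B K V V₁ V₂) (hB : 0 < B) {S ξ : ℝ} (hS : 0 ≤ S)
    (hξ : ξ ≠ 0) (hSξ : 4 * S * B ≤ |ξ|) : ‖osc B V S ξ‖ ≤ 76 * K / ξ ^ 2 := by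
  have hK := h.nonneg hB
  have hξ0 : 0 < |ξ| := abs_pos.2 hξ
  set p : ℝ → ℝ := fun u => 2 * S * u - ξ with hp
  -- The phase derivative `p u = 2Su - ξ` stays at least `|ξ|/2` in size, because `2S|u| ≤ 2SB ≤
  -- |ξ|/2`.
  have hpl : ∀ u ∈ Icc (-B) B, |ξ| / 2 ≤ |p u| := fun u hu => by
    have h1 : |2 * S * u| ≤ |ξ| / 2 := by
      rw [abs_mul, abs_of_nonneg (by positivity : 0 ≤ 2 * S)]
      have := _root_.abs_le.2 hu
      nlinarith
    have h2 := abs_sub_abs_le_abs_sub ξ (2 * S * u)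
    rw [abs_sub_comm] at h2
    simp only [hp]
    linarith
  have hp0 : ∀ u ∈ Icc (-B) B, p u ≠ 0 := fun u hu => by
    have := hpl u hu
    exact abs_pos.1 (by linarith)
  have hpd : ∀ u, HasDerivAt p (2 * S) u := fun u => by
    convert! ((hasDerivAt_id u).const_mul (2 * S)).sub_const ξ using 1
    rw [mul_one]
  have hpc : Continuous p := by fun_prop
  have hθ : ∀ u, HasDerivAt (fun u => S * u ^ 2 - ξ * u) (p u) u := fun u => by
    have := ((hasDerivAt_pow 2 u).const_mul S).sub ((hasDerivAt_id u).const_mul ξ)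
    convert! this using 1
    simp only [hp]; push_cast; ring
  have hBB : -B ≤ B := by linarith
  have hVB : V B = 0 := h.eq_zero B (le_abs_self B)
  have hVB' : V (-B) = 0 := h.eq_zero _ (by rw [abs_neg]; exact le_abs_self B)
  have hV1B : V₁ B = 0 := h.eq_zero' B (le_abs_self B)
  have hV1B' : V₁ (-B) = 0 := h.eq_zero' _ (by rw [abs_neg]; exact le_abs_self B)
  -- Two integrations by parts: divide by `p` and differentiate, twice. The vanishing of `V` and
  -- `V₁` at `±B` removes all boundary terms.
  set w₁ : ℝ → ℝ := fun u => V u / p u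
  set w₁' : ℝ → ℝ := fun u => V₁ u / p u - V u * (2 * S) / p u ^ 2
  set w₂ : ℝ → ℝ := fun u => w₁' u / p u
  set w₂' : ℝ → ℝ := fun u => V₂ u / p u ^ 2 - 3 * (V₁ u * (2 * S)) / p u ^ 3 +
    3 * (V u * (2 * S) ^ 2) / p u ^ 4
  have hw1 : ∀ u ∈ Icc (-B) B, HasDerivAt w₁ (w₁' u) u := fun u hu => by
    have h0 := hp0 u hu
    have := (h.hasDerivAt u).div (hpd u) h0
    convert! this using 1
    simp only [w₁']
    field_simp
  have hw1d : ∀ u ∈ Icc (-B) B, HasDerivAt w₁' (V₂ u / p u - 2 * (V₁ u * (2 * S)) / p u ^ 2 +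
      2 * (V u * (2 * S) ^ 2) / p u ^ 3) u := fun u hu => by
    have h0 := hp0 u hu
    have := ((h.hasDerivAt' u).div (hpd u) h0).sub
      (((h.hasDerivAt u).mul_const (2 * S)).div ((hpd u).pow 2) (pow_ne_zero 2 h0))
    convert! this using 1
    simp only [Pi.pow_apply]
    field_simp
    push_cast
    ring
  have hw2 : ∀ u ∈ Icc (-B) B, HasDerivAt w₂ (w₂' u) u := fun u hu => by
    have h0 := hp0 u hu
    have := (hw1d u hu).div (hpd u) h0
    convert! this using 1
    simp only [w₁', w₂']
    field_simp
    ring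
  have cV := h.continuous
  have cV1 := h.continuous₁
  have cV2 := h.continuous₂
  have hw1'c : ContinuousOn w₁' (Icc (-B) B) :=
    (cV1.continuousOn.div hpc.continuousOn hp0).sub
      ((cV.mul continuous_const).continuousOn.div (hpc.pow 2).continuousOn
        fun u hu => pow_ne_zero 2 (hp0 u hu))
  have hw2'c : ContinuousOn w₂' (Icc (-B) B) := by
    refine ((cV2.continuousOn.div (hpc.pow 2).continuousOn ?_).sub
      (ContinuousOn.div (by fun_prop) (hpc.pow 3).continuousOn ?_)).add
      (ContinuousOn.div (by fun_prop) (hpc.pow 4).continuousOn ?_) <;>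
    exact fun u hu => pow_ne_zero _ (hp0 u hu)
  have e1 := integral_mul_deriv_cexp2pi hBB hw1 hw1'c hθ hpc (by simp [w₁, hVB'])
    (by simp [w₁, hVB])
  have e2 := integral_mul_deriv_cexp2pi hBB hw2 hw2'c hθ hpc
    (by simp [w₂, w₁', hVB', hV1B']) (by simp [w₂, w₁', hVB, hV1B])
  have c1 : ∫ u in -B..B, ((w₁ u * p u : ℝ) : ℂ) * cexp2pi (S * u ^ 2 - ξ * u) = osc B V S ξ := by
    refine integral_congr fun u hu => ?_
    rw [uIcc_of_le hBB] at hu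
    simp only [w₁, div_mul_cancel₀ _ (hp0 u hu)]
  have c2 : ∫ u in -B..B, ((w₂ u * p u : ℝ) : ℂ) * cexp2pi (S * u ^ 2 - ξ * u) =
      ∫ u in -B..B, (w₁' u : ℂ) * cexp2pi (S * u ^ 2 - ξ * u) := by
    refine integral_congr fun u hu => ?_
    rw [uIcc_of_le hBB] at hu
    simp only [w₂, div_mul_cancel₀ _ (hp0 u hu)]
  rw [c1] at e1
  rw [c2] at e2
  have hS2 : 2 * S ≤ |ξ| / (2 * B) := by
    rw [le_div_iff₀ (by positivity)]; linarith
  have hw2b : ∀ u ∈ Icc (-B) B, |w₂' u| ≤ 4 / ξ ^ 2 * |V₂ u| + (12 * K / B + 24 * K / B) / ξ ^ 2 :=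
    fun u hu => by
    have hpu := hpl u hu
    have hpp : 0 < |p u| := by linarith
    have i1 : |V₂ u / p u ^ 2| ≤ 4 / ξ ^ 2 * |V₂ u| := by
      rw [abs_div, abs_pow, ← sq_abs ξ, div_eq_mul_inv, mul_comm]
      refine mul_le_mul_of_nonneg_right ?_ (abs_nonneg _)
      calc (|p u| ^ 2)⁻¹ ≤ ((|ξ| / 2) ^ 2)⁻¹ := by gcongr
        _ = 4 / |ξ| ^ 2 := by field_simp; norm_num
    have i2 : |3 * (V₁ u * (2 * S)) / p u ^ 3| ≤ 12 * K / B / ξ ^ 2 := by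
      rw [abs_div, abs_pow, abs_mul, abs_mul, abs_of_pos (by norm_num : (0 : ℝ) < 3),
        abs_of_nonneg (by positivity : 0 ≤ 2 * S)]
      calc 3 * (|V₁ u| * (2 * S)) / |p u| ^ 3 ≤ 3 * (K * (|ξ| / (2 * B))) / (|ξ| / 2) ^ 3 := by
            gcongr; exact h.abs_deriv_le hB u
        _ = 12 * K / B / ξ ^ 2 := by rw [← sq_abs ξ]; field_simp; ring
    have i3 : |3 * (V u * (2 * S) ^ 2) / p u ^ 4| ≤ 24 * K / B / ξ ^ 2 := by
      rw [abs_div, abs_pow, abs_mul, abs_mul, abs_of_pos (by norm_num : (0 : ℝ) < 3),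
        abs_of_nonneg (by positivity : 0 ≤ (2 * S) ^ 2)]
      calc 3 * (|V u| * (2 * S) ^ 2) / |p u| ^ 4
          ≤ 3 * (2 * B * K * (|ξ| / (2 * B)) ^ 2) / (|ξ| / 2) ^ 4 := by
            gcongr; exact h.abs_le hB u
        _ = 24 * K / B / ξ ^ 2 := by rw [← sq_abs ξ]; field_simp; ring
    have := abs_add_le (V₂ u / p u ^ 2 - 3 * (V₁ u * (2 * S)) / p u ^ 3)
      (3 * (V u * (2 * S) ^ 2) / p u ^ 4)
    have h2 := abs_sub (V₂ u / p u ^ 2) (3 * (V₁ u * (2 * S)) / p u ^ 3)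
    rw [add_div]
    simp only [w₂']
    linarith
  -- The constant is `4 + 2 * (12 + 24)`, the length `2B` cancelling the `1/B`. The two factors
  -- `1/(2π)` gained by the integrations by parts are discarded below.
  have hb : ‖∫ u in -B..B, (w₂' u : ℂ) * cexp2pi (S * u ^ 2 - ξ * u)‖ ≤ 76 * K / ξ ^ 2 := by
    refine (norm_integral_le_of_norm_le (g := fun u => 4 / ξ ^ 2 * |V₂ u| +
      (12 * K / B + 24 * K / B) / ξ ^ 2) hBB (Eventually.of_forall fun u hu => ?_)
      ((by fun_prop : Continuous _).intervalIntegrable _ _)).trans ?_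
    · simpa using hw2b u (Ioc_subset_Icc_self hu)
    · rw [integral_add ((by fun_prop : Continuous _).intervalIntegrable _ _) (by simp),
        intervalIntegral.integral_const_mul, intervalIntegral.integral_const, smul_eq_mul]
      calc _ ≤ 4 / ξ ^ 2 * K + (B - -B) * ((12 * K / B + 24 * K / B) / ξ ^ 2) := by
            gcongr; exact h.integral_le
        _ = _ := by field_simp; ring
  have n1 := congrArg norm e1
  have n2 := congrArg norm e2
  have h2pi : ‖(2 * π * Complex.I : ℂ)‖ = 2 * π := by simp [abs_of_pos Real.pi_pos]
  rw [norm_mul, norm_neg, h2pi] at n1 n2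
  have hpi := Real.pi_gt_three
  have p1 := norm_nonneg (osc B V S ξ)
  have p2 := norm_nonneg (∫ u in -B..B, (w₁' u : ℂ) * cexp2pi (S * u ^ 2 - ξ * u))
  nlinarith

/-- The integral `∫ V(u) u² exp(2πi(Su² - ξu)) du`. -/
noncomputable def oscSq (B : ℝ) (V : ℝ → ℝ) (S ξ : ℝ) : ℂ :=
  ∫ u in -B..B, (V u * u ^ 2 : ℂ) * cexp2pi (S * u ^ 2 - ξ * u)

theorem hasDerivAt_osc (h : IsAmplitude B K V V₁ V₂) (S ξ : ℝ) :
    HasDerivAt (fun S => osc B V S ξ) (2 * π * Complex.I * oscSq B V S ξ) S := by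
  have cV := h.continuous
  have := (intervalIntegral.hasDerivAt_integral_of_dominated_loc_of_deriv_le (μ := volume)
    (F := fun S u => (V u : ℂ) * cexp2pi (S * u ^ 2 - ξ * u))
    (F' := fun S u => 2 * π * Complex.I * ((V u * u ^ 2 : ℂ) * cexp2pi (S * u ^ 2 - ξ * u)))
    (x₀ := S) (a := -B) (b := B) (s := univ) (bound := fun u => 2 * π * (|V u| * u ^ 2)) univ_mem
    (Eventually.of_forall fun S => (by fun_prop : Continuous _).aestronglyMeasurable)
    ((by fun_prop : Continuous _).intervalIntegrable _ _)
    (by fun_prop : Continuous _).aestronglyMeasurable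
    (Eventually.of_forall fun u _ S _ => by simp [abs_of_pos Real.pi_pos])
    ((by fun_prop : Continuous _).intervalIntegrable _ _)
    (Eventually.of_forall fun u _ S _ => by
      have hd : HasDerivAt (fun S : ℝ => S * u ^ 2 - ξ * u) (u ^ 2) S := by
        simpa using ((hasDerivAt_id S).mul_const (u ^ 2)).sub_const (ξ * u)
      convert! (hasDerivAt_cexp2pi_comp hd).const_mul (V u : ℂ) using 1
      push_cast
      ring)).2
  rwa [intervalIntegral.integral_const_mul] at this

theorem continuous_osc (h : IsAmplitude B K V V₁ V₂) (ξ : ℝ) :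
    Continuous fun S => osc B V S ξ :=
  continuous_iff_continuousAt.2 fun S => (hasDerivAt_osc h S ξ).continuousAt

theorem continuous_oscSq (h : IsAmplitude B K V V₁ V₂) (ξ : ℝ) :
    Continuous fun S => oscSq B V S ξ := by
  have cV := h.continuous
  exact continuous_parametric_intervalIntegral_of_continuous' (by fun_prop) _ _

/-- The amplitude left after the stationary phase `exp(-2πi ξ²/(4S))` is taken out. -/
noncomputable def oscAmp (B : ℝ) (V : ℝ → ℝ) (S ξ : ℝ) : ℂ :=
  cexp2pi (ξ ^ 2 / (4 * S)) * osc B V S ξ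

/-- The derivative of `oscAmp` in `S`. -/
noncomputable def oscAmpDeriv (B : ℝ) (V : ℝ → ℝ) (S ξ : ℝ) : ℂ :=
  2 * π * Complex.I * (cexp2pi (ξ ^ 2 / (4 * S)) *
    (oscSq B V S ξ - ((ξ / (2 * S)) ^ 2 : ℝ) * osc B V S ξ))

theorem osc_eq_mul_oscAmp (S ξ : ℝ) :
    osc B V S ξ = cexp2pi (-(ξ ^ 2 / (4 * S))) * oscAmp B V S ξ := by
  rw [oscAmp, ← mul_assoc, ← cexp2pi_add]; simp

theorem norm_oscAmp (S ξ : ℝ) : ‖oscAmp B V S ξ‖ = ‖osc B V S ξ‖ := by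
  rw [oscAmp, norm_mul, norm_cexp2pi, one_mul]

theorem hasDerivAt_oscAmp (h : IsAmplitude B K V V₁ V₂) {S : ℝ} (hS : 0 < S)
    (ξ : ℝ) : HasDerivAt (fun S => oscAmp B V S ξ) (oscAmpDeriv B V S ξ) S := by
  have hd : HasDerivAt (fun S : ℝ => ξ ^ 2 / (4 * S)) (-(ξ / (2 * S)) ^ 2) S := by
    have := (hasDerivAt_const S (ξ ^ 2)).div ((hasDerivAt_id S).const_mul 4)
      (by simpa using hS.ne')
    convert! this using 1
    simp only [id]
    field_simp
    ring
  convert! (hasDerivAt_cexp2pi_comp hd).mul (hasDerivAt_osc h S ξ) using 1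
  rw [oscAmpDeriv]
  push_cast
  ring

theorem continuousOn_oscAmpDeriv (h : IsAmplitude B K V V₁ V₂) (ξ : ℝ) :
    ContinuousOn (fun S => oscAmpDeriv B V S ξ) (Ioi 0) := by
  have h1 : ContinuousOn (fun S : ℝ => ξ ^ 2 / (4 * S)) (Ioi 0) :=
    ContinuousOn.div (by fun_prop) (by fun_prop) fun S hS => by
      have : 0 < S := hS
      positivity
  have h2 : ContinuousOn (fun S : ℝ => (ξ / (2 * S)) ^ 2) (Ioi 0) :=
    (ContinuousOn.div (by fun_prop) (by fun_prop) fun S hS => by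
      have : 0 < S := hS
      positivity).pow 2
  exact continuousOn_const.mul ((continuous_cexp2pi.comp_continuousOn h1).mul
    ((continuous_oscSq h ξ).continuousOn.sub
      ((Complex.continuous_ofReal.comp_continuousOn h2).mul (continuous_osc h ξ).continuousOn)))

/-- Once the phase at the stationary point `c = ξ/(2S)` is removed, differentiating in `S` brings
down `u² - c² = (u + c)(u - c)`. The factor `u - c` is proportional to the phase derivative, so one
integration by parts gains `1/S`, and the remaining Fresnel integral gains `1/√S`. The derivative is
thus smaller than `oscAmp` by a factor `S`, as long as `c` stays bounded. -/
theorem norm_oscAmpDeriv_le (h : IsAmplitude B K V V₁ V₂) (hB : 0 < B) {S : ℝ} (hS : 0 < S)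
    (ξ : ℝ) : ‖oscAmpDeriv B V S ξ‖ ≤ 2 / (S * √S) * (K * (5 * B + |ξ / (2 * S)|)) := by
  set c := ξ / (2 * S) with hc
  have cV := h.continuous
  have cV1 := h.continuous₁
  have cV2 := h.continuous₂
  have hBB : -B ≤ B := by linarith
  have hVB : V B = 0 := h.eq_zero B (le_abs_self B)
  have hVB' : V (-B) = 0 := h.eq_zero _ (by rw [abs_neg]; exact le_abs_self B)
  have e1 : oscAmpDeriv B V S ξ = 2 * π * Complex.I *
      ∫ u in -B..B, ((V u * (u + c) * (u - c) : ℝ) : ℂ) * cexp2pi (S * (u - c) ^ 2) := by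
    rw [oscAmpDeriv]
    congr 1
    rw [oscSq, osc, ← intervalIntegral.integral_const_mul, ← intervalIntegral.integral_sub
      ((by fun_prop : Continuous _).intervalIntegrable _ _)
      ((by fun_prop : Continuous _).intervalIntegrable _ _), ← intervalIntegral.integral_const_mul]
    refine integral_congr fun u _ => ?_
    simp only [complete_square hS.ne' ξ u, cexp2pi_add (S * _)]
    have h1 : cexp2pi (ξ ^ 2 / (4 * S)) * cexp2pi (-(ξ ^ 2 / (4 * S))) = 1 := by
      rw [← cexp2pi_add]; simp
    linear_combination (norm := skip) (((V u * (u ^ 2 - c ^ 2) : ℝ) : ℂ) * cexp2pi (S * (u - c) ^ 2)) * h1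
    simp only [← hc]
    push_cast
    ring
  have hθ : ∀ u, HasDerivAt (fun u => S * (u - c) ^ 2) (2 * S * (u - c)) u := fun u => by
    have := (((hasDerivAt_id u).sub_const c).pow 2).const_mul S
    convert! this using 1
    simp only [id]; push_cast; ring
  have hw : ∀ u, HasDerivAt (fun u => V u * (u + c)) (V₁ u * (u + c) + V u) u := fun u => by
    have := (h.hasDerivAt u).mul ((hasDerivAt_id u).add_const c)
    simpa using! this
  have e2 := integral_mul_deriv_cexp2pi hBB (fun u _ => hw u) (by fun_prop) hθ (by fun_prop)
    (by simp [hVB']) (by simp [hVB])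
  have e3 : ∫ u in -B..B, ((V u * (u + c) * (2 * S * (u - c)) : ℝ) : ℂ) *
      cexp2pi (S * (u - c) ^ 2) = (2 * S : ℝ) * ∫ u in -B..B,
        ((V u * (u + c) * (u - c) : ℝ) : ℂ) * cexp2pi (S * (u - c) ^ 2) := by
    rw [← intervalIntegral.integral_const_mul]
    refine integral_congr fun u _ => ?_
    push_cast
    ring
  rw [e3, mul_left_comm, ← e1] at e2
  have hb := norm_integral_mul_le hBB (u := fun u => ((V₁ u * (u + c) + V u : ℝ) : ℂ))
    (u' := fun u => ((V₂ u * (u + c) + 2 * V₁ u : ℝ) : ℂ))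
    (fun u _ => by
      refine HasDerivAt.ofReal_comp ?_
      have := ((h.hasDerivAt' u).mul ((hasDerivAt_id u).add_const c)).add (h.hasDerivAt u)
      convert! this using 1
      simp only [id]
      ring)
    (Continuous.continuousOn (by fun_prop)) (by fun_prop : ContinuousOn _ _)
    (fun t _ => norm_integral_cexp2pi_mul_sq_le hS c (-B) t)
  have hi : ∫ u in -B..B, ‖((V₂ u * (u + c) + 2 * V₁ u : ℝ) : ℂ)‖ ≤ K * (5 * B + |c|) := by
    have h1 : ∫ u in -B..B, ‖((V₂ u * (u + c) + 2 * V₁ u : ℝ) : ℂ)‖ ≤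
        ∫ u in -B..B, ((B + |c|) * |V₂ u| + 2 * |V₁ u|) := by
      refine integral_mono_on hBB ((by fun_prop : Continuous _).intervalIntegrable _ _)
        ((by fun_prop : Continuous _).intervalIntegrable _ _) fun u hu => ?_
      rw [Complex.norm_real, Real.norm_eq_abs]
      refine (abs_add_le _ _).trans ?_
      rw [abs_mul, abs_mul, abs_two, mul_comm |V₂ u|]
      gcongr
      exact (abs_add_le _ _).trans (by gcongr; exact _root_.abs_le.2 hu)
    refine h1.trans ?_
    rw [intervalIntegral.integral_add ((by fun_prop : Continuous _).intervalIntegrable _ _)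
      ((by fun_prop : Continuous _).intervalIntegrable _ _), intervalIntegral.integral_const_mul,
      intervalIntegral.integral_const_mul]
    have h2 := norm_integral_abs_le h hB
    have h3 := mul_le_mul_of_nonneg_left h.integral_le (by positivity : 0 ≤ B + |c|)
    linarith
  rw [h.eq_zero' B (le_abs_self B), hVB] at hb
  simp only [zero_mul, add_zero, Complex.ofReal_zero, norm_zero, zero_add] at hb
  have n := congrArg norm e2
  rw [norm_mul, norm_neg, Complex.norm_real, Real.norm_of_nonneg (by positivity)] at n
  have hsq : 0 < √S := Real.sqrt_pos.2 hS
  have : 2 * S * ‖oscAmpDeriv B V S ξ‖ ≤ 4 / √S * (K * (5 * B + |c|)) := by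
    rw [n]
    exact hb.trans (by gcongr)
  calc ‖oscAmpDeriv B V S ξ‖ = (2 * S * ‖oscAmpDeriv B V S ξ‖) / (2 * S) := by field_simp
    _ ≤ (4 / √S * (K * (5 * B + |c|))) / (2 * S) := by gcongr
    _ = _ := by field_simp; ring

end LatticeEllipsoid

namespace LatticeEllipsoid
open MeasureTheory Set intervalIntegral
open scoped Real Topology FourierTransform

/-! ### Poisson summation for quadratic phases -/

variable {B K : ℝ} {V V₁ V₂ : ℝ → ℝ}

theorem fourier_quadratic (h : IsAmplitude B K V V₁ V₂) (hB : 0 < B) {Λ : ℝ} (hΛ : 0 < Λ)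
    (S w : ℝ) : 𝓕 (fun x : ℝ => (V (x / Λ) : ℂ) * cexp2pi (S * (x / Λ) ^ 2)) w =
      Λ * osc B V S (w * Λ) := by
  rw [Real.fourier_real_eq_integral_exp_smul]
  set g : ℝ → ℂ := fun v => Complex.exp (↑(-2 * π * v * w) * Complex.I) •
    ((V (v / Λ) : ℂ) * cexp2pi (S * (v / Λ) ^ 2)) with hg
  have e := Measure.integral_comp_mul_left g Λ
  have e1 : ∀ u, g (Λ * u) = (V u : ℂ) * cexp2pi (S * u ^ 2 - w * Λ * u) := fun u => by
    simp only [hg, smul_eq_mul, mul_div_cancel_left₀ u hΛ.ne']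
    have : cexp2pi (S * u ^ 2 - w * Λ * u) = cexp2pi (-(w * Λ * u)) * cexp2pi (S * u ^ 2) := by
      rw [← cexp2pi_add]; congr 1; ring
    rw [this]
    have : cexp2pi (-(w * Λ * u)) = Complex.exp (↑(-2 * π * (Λ * u) * w) * Complex.I) := by
      rw [cexp2pi]; congr 3; ring
    rw [this]; ring
  simp_rw [e1] at e
  have e2 : ∫ u, (V u : ℂ) * cexp2pi (S * u ^ 2 - w * Λ * u) = osc B V S (w * Λ) := by
    rw [osc, integral_of_le (by linarith), setIntegral_eq_integral_of_forall_compl_eq_zero]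
    intro u hu
    have : B ≤ |u| := by
      by_contra hc
      have := abs_lt.1 (not_le.1 hc)
      exact hu ⟨this.1, this.2.le⟩
    rw [h.eq_zero u this]
    simp
  rw [e2, abs_of_pos (inv_pos.2 hΛ)] at e
  rw [e, Complex.real_smul, ← mul_assoc, ← Complex.ofReal_mul, mul_inv_cancel₀ hΛ.ne']
  simp

theorem summable_of_norm_le_div_sq {g : ℤ → ℂ} {c : ℝ} {N : ℕ}
    (hg : ∀ k : ℤ, (N : ℤ) ≤ |k| → ‖g k‖ ≤ c / (k : ℝ) ^ 2) : Summable g := by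
  have hs : Summable fun k : ℤ => c * (1 / (k : ℝ) ^ 2) :=
    (Real.summable_one_div_int_pow.2 one_lt_two).mul_left c
  refine Summable.of_norm_bounded_eventually hs ?_
  rw [Int.cofinite_eq, eventually_sup]
  constructor
  · filter_upwards [eventually_le_atBot (-(N : ℤ))] with k hk
    rw [mul_one_div]
    exact hg k (by rw [le_abs]; right; linarith)
  · filter_upwards [eventually_ge_atTop (N : ℤ)] with k hk
    rw [mul_one_div]
    exact hg k (by rw [le_abs]; left; exact hk)

/-- Telescoping over symmetric intervals: the two terms `±M` contribute at most `2c/M² ≤ 4c(1/M -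
1/(M+1))`. The bound for finite differences then passes to the limit. -/
theorem norm_tsum_sub_sum_Ioo_le {g : ℤ → ℂ} {c : ℝ} {N : ℕ} (hN : 1 ≤ N)
    (hg : ∀ k : ℤ, (N : ℤ) ≤ |k| → ‖g k‖ ≤ c / (k : ℝ) ^ 2) :
    ‖∑' k, g k - ∑ k ∈ Finset.Ioo (-(N : ℤ)) N, g k‖ ≤ 4 * c / N := by
  have hc : 0 ≤ c := by
    have h1 := (norm_nonneg _).trans (hg N (by simp))
    have : (0 : ℝ) < ((N : ℤ) : ℝ) ^ 2 := by positivity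
    rwa [le_div_iff₀ this, zero_mul] at h1
  have hpart : ∀ M : ℕ, N ≤ M → ‖∑ k ∈ Finset.Ioo (-(M : ℤ)) M, g k -
      ∑ k ∈ Finset.Ioo (-(N : ℤ)) N, g k‖ ≤ 4 * c * (1 / N - 1 / M) := by
    intro M hM
    induction M, hM using Nat.le_induction with
    | base => simp
    | succ M hM ih =>
      have hM1 : 1 ≤ M := hN.trans hM
      have hset : Finset.Ioo (-((M + 1 : ℕ) : ℤ)) ((M + 1 : ℕ) : ℤ) =
          insert (-(M : ℤ)) (insert (M : ℤ) (Finset.Ioo (-(M : ℤ)) M)) := by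
        ext k
        simp only [Finset.mem_Ioo, Finset.mem_insert]
        push_cast
        omega
      rw [hset, Finset.sum_insert (by
        simp only [Finset.mem_insert, Finset.mem_Ioo]; omega), Finset.sum_insert (by simp)]
      have b1 := hg M (by simpa using hM)
      have b2 := hg (-M) (by simpa using hM)
      push_cast at b1 b2
      rw [neg_sq] at b2
      have hMr : (1 : ℝ) ≤ M := by exact_mod_cast hM1
      have hstep : c / (M : ℝ) ^ 2 ≤ 2 * c * (1 / M - 1 / (M + 1)) := by
        have h1 : (1 : ℝ) / M - 1 / (M + 1) = 1 / (M * (M + 1)) := by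
          field_simp; ring
        rw [h1, mul_one_div, div_le_div_iff₀ (by positivity) (by positivity)]
        nlinarith [mul_nonneg hc (by linarith : (0 : ℝ) ≤ M - 1), mul_nonneg (mul_nonneg hc
          (by linarith : (0 : ℝ) ≤ M - 1)) (by linarith : (0 : ℝ) ≤ M)]
      calc _ = ‖g (-M) + (g M + (∑ k ∈ Finset.Ioo (-(M : ℤ)) M, g k -
              ∑ k ∈ Finset.Ioo (-(N : ℤ)) N, g k))‖ := by congr 1; ring
        _ ≤ c / (M : ℝ) ^ 2 + (c / (M : ℝ) ^ 2 + 4 * c * (1 / N - 1 / M)) :=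
            (norm_add_le _ _).trans (add_le_add b2 ((norm_add_le _ _).trans (add_le_add b1 ih)))
        _ ≤ _ := by push_cast; linarith
  have hT : Tendsto (fun M : ℕ => Finset.Ioo (-(M : ℤ)) M) atTop atTop := by
    refine tendsto_atTop_finset_of_monotone (fun a b hab => ?_) fun k => ⟨k.natAbs + 1, ?_⟩
    · exact Finset.Ioo_subset_Ioo (by simpa using hab) (by simpa using hab)
    · rw [Finset.mem_Ioo]; omega
  have hlim := (((summable_of_norm_le_div_sq hg).hasSum.comp hT).sub_const
    (∑ k ∈ Finset.Ioo (-(N : ℤ)) N, g k)).norm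
  refine le_of_tendsto hlim ?_
  filter_upwards [eventually_ge_atTop N] with M hM
  refine (hpart M hM).trans ?_
  have : (0 : ℝ) ≤ 1 / M := by positivity
  rw [← mul_one_div (4 * c)]
  gcongr
  linarith

/-- Poisson summation, with the frequencies beyond the stationary range estimated trivially. -/
theorem norm_lattice_sum_sub_le (h : IsAmplitude B K V V₁ V₂) (hB : 0 < B) {Λ : ℝ} (hΛ : 0 < Λ)
    {S : ℝ} (hS : 0 ≤ S) (y : ℝ) {N : ℕ} (hN : 1 ≤ N) (hSN : 4 * S * B ≤ N * Λ)
    {I : Finset ℤ} (hI : ∀ k : ℤ, k ∉ I → B * Λ ≤ |y + k|) :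
    ‖(∑ k ∈ I, (V ((y + k) / Λ) : ℂ) * cexp2pi (S * ((y + k) / Λ) ^ 2)) / Λ -
      ∑ k ∈ Finset.Ioo (-(N : ℤ)) N, osc B V S (k * Λ) * cexp2pi (k * y)‖ ≤
        304 * K / (Λ ^ 2 * N) := by
  set f : ℝ → ℂ := fun x => (V (x / Λ) : ℂ) * cexp2pi (S * (x / Λ) ^ 2) with hf
  have cV := h.continuous
  have hfc : Continuous f := by fun_prop
  have hf0 : ∀ x, B * Λ ≤ |x| → f x = 0 := fun x hx => by
    have : B ≤ |x / Λ| := by rwa [abs_div, abs_of_pos hΛ, le_div_iff₀ hΛ]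
    simp [hf, h.eq_zero _ this]
  have hg : ∀ k : ℤ, (N : ℤ) ≤ |k| →
      ‖osc B V S (k * Λ) * cexp2pi (k * y)‖ ≤ 76 * K / Λ ^ 2 / (k : ℝ) ^ 2 := fun k hk => by
    have hk' : (N : ℝ) ≤ |(k : ℝ)| := by exact_mod_cast hk
    have hN' : (1 : ℝ) ≤ N := by exact_mod_cast hN
    have hk0 : (k : ℝ) ≠ 0 := abs_pos.1 (by linarith)
    rw [norm_mul, norm_cexp2pi, mul_one]
    -- The hypothesis `4SB ≤ NΛ` says precisely that every frequency `kΛ` with `|k| ≥ N` satisfies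
    -- the nonstationarity condition.
    refine (norm_osc_le_div_sq h hB hS (mul_ne_zero hk0 hΛ.ne') ?_).trans (le_of_eq ?_)
    · rw [abs_mul, abs_of_pos hΛ]
      exact hSN.trans (by gcongr)
    · rw [mul_pow, div_div, mul_comm (Λ ^ 2)]
  have hFf : Summable fun k : ℤ => 𝓕 f k := by
    refine summable_of_norm_le_div_sq (c := Λ * (76 * K / Λ ^ 2)) (N := N) fun k hk => ?_
    rw [hf, fourier_quadratic h hB hΛ, norm_mul, Complex.norm_real, Real.norm_of_nonneg hΛ.le,
      mul_div_assoc]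
    have := hg k hk
    rw [norm_mul, norm_cexp2pi, mul_one] at this
    gcongr
  have hO : f =O[cocompact ℝ] fun x => |x| ^ (-2 : ℝ) := by
    refine IsBigO.of_bound 1 ?_
    have : ∀ᶠ x : ℝ in cocompact ℝ, B * Λ ≤ ‖x‖ :=
      (tendsto_norm_cocompact_atTop (E := ℝ)).eventually_ge_atTop _
    filter_upwards [this] with x hx
    rw [hf0 x hx]
    simp only [norm_zero]
    positivity
  have key := Real.tsum_eq_tsum_fourier_of_rpow_decay_of_summable hfc one_lt_two hO hFf y
  have e1 : ∑' n : ℤ, f (y + n) =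
      ∑ k ∈ I, (V ((y + k) / Λ) : ℂ) * cexp2pi (S * ((y + k) / Λ) ^ 2) :=
    tsum_eq_sum fun k hk => hf0 _ (hI k hk)
  have e2 : ∑' n : ℤ, 𝓕 f n * fourier n (y : UnitAddCircle) =
      Λ * ∑' k : ℤ, osc B V S (k * Λ) * cexp2pi (k * y) := by
    rw [← tsum_mul_left]
    refine tsum_congr fun k => ?_
    rw [hf, fourier_quadratic h hB hΛ, fourier_coe_apply, cexp2pi, mul_assoc]
    congr 3
    push_cast
    simp
    ring
  have hΛ' : (Λ : ℂ) ≠ 0 := by exact_mod_cast hΛ.ne'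
  rw [← e1, key, e2, mul_div_cancel_left₀ _ hΛ']
  refine (norm_tsum_sub_sum_Ioo_le hN hg).trans (le_of_eq ?_)
  field_simp
  ring

end LatticeEllipsoid

namespace LatticeEllipsoid
open MeasureTheory Set
open scoped Real Topology FourierTransform ContDiff SchwartzMap

/-! ### Smooth cutoff functions and their Fourier transforms -/

/-- `F` is a cutoff function near `s = 1` at scale `δ`: its Fourier transform is
`exp(-2πiT) ψ(T)`, with `ψ` of symbol type up to frequency `1 / δ`. -/
structure IsCutoff (L : ℕ) (K δ : ℝ) (F : ℝ → ℝ) (ψ ψ' : ℝ → ℂ) : Prop where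
  continuous : Continuous F
  eq_integral : ∀ s, F s = 2 * (∫ T in Ioi 0, ψ T * cexp2pi (T * (s - 1))).re
  integrable : Integrable ψ
  continuous_amp : Continuous ψ
  hasDerivAt : ∀ T, 0 < T → HasDerivAt ψ (ψ' T) T
  continuousOn : ContinuousOn ψ' (Ioi 0)
  norm_le : ∀ T, ‖ψ T‖ ≤ K
  norm_mul_le : ∀ T, 0 < T → T * ‖ψ T‖ * (1 + δ * T) ^ L ≤ K
  norm_deriv_mul_le : ∀ T, 0 < T → T ^ 2 * ‖ψ' T‖ * (1 + δ * T) ^ L ≤ K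

/-- A smooth step from `0` (for `s ≤ a`) to `1` (for `s ≥ a + α`). -/
noncomputable def smoothStep (a α s : ℝ) : ℝ := Real.smoothTransition ((s - a) / α)

theorem contDiff_smoothStep (a α : ℝ) : ContDiff ℝ ∞ (smoothStep a α) :=
  Real.smoothTransition.contDiff.comp ((contDiff_id.sub contDiff_const).div_const α)

theorem smoothStep_nonneg (a α s : ℝ) : 0 ≤ smoothStep a α s := Real.smoothTransition.nonneg _

theorem smoothStep_le_one (a α s : ℝ) : smoothStep a α s ≤ 1 := Real.smoothTransition.le_one _

theorem smoothStep_eq_zero {a α s : ℝ} (hα : 0 < α) (h : s ≤ a) : smoothStep a α s = 0 :=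
  Real.smoothTransition.zero_of_nonpos (div_nonpos_of_nonpos_of_nonneg (by linarith) hα.le)

theorem smoothStep_eq_one {a α s : ℝ} (hα : 0 < α) (h : a + α ≤ s) : smoothStep a α s = 1 :=
  Real.smoothTransition.one_of_one_le (by rw [le_div_iff₀ hα]; linarith)

theorem contDiff_deriv_smoothTransition : ContDiff ℝ ∞ (deriv Real.smoothTransition) :=
  (contDiff_infty_iff_deriv.1 Real.smoothTransition.contDiff).2

theorem deriv_smoothTransition_eq_zero {x : ℝ} (hx : x ∉ Icc (0 : ℝ) 1) :
    deriv Real.smoothTransition x = 0 := by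
  rw [mem_Icc, not_and_or, not_le, not_le] at hx
  rcases hx with hx | hx
  · have : Real.smoothTransition =ᶠ[𝓝 x] fun _ => 0 := by
      filter_upwards [Iio_mem_nhds hx] with z hz
      exact Real.smoothTransition.zero_of_nonpos (le_of_lt hz)
    rw [this.deriv_eq, deriv_const]
  · have : Real.smoothTransition =ᶠ[𝓝 x] fun _ => 1 := by
      filter_upwards [Ioi_mem_nhds hx] with z hz
      exact Real.smoothTransition.one_of_one_le (le_of_lt hz)
    rw [this.deriv_eq, deriv_const]

/-- The bump function `deriv Real.smoothTransition` as a Schwartz function. -/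
noncomputable def transitionBump : 𝓢(ℝ, ℂ) :=
  HasCompactSupport.toSchwartzMap (f := fun x => ((deriv Real.smoothTransition x : ℝ) : ℂ))
    (HasCompactSupport.intro (isCompact_Icc (a := (0 : ℝ)) (b := 1)) fun x hx => by
      rw [deriv_smoothTransition_eq_zero hx, Complex.ofReal_zero])
    (Complex.ofRealCLM.contDiff.comp contDiff_deriv_smoothTransition)

theorem transitionBump_apply (x : ℝ) :
    transitionBump x = ((deriv Real.smoothTransition x : ℝ) : ℂ) := rfl

theorem hasDerivAt_smoothStep (a α s : ℝ) :
    HasDerivAt (smoothStep a α) (α⁻¹ * deriv Real.smoothTransition ((s - a) / α)) s := by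
  have h1 : HasDerivAt (fun s : ℝ => (s - a) / α) α⁻¹ s := by
    simpa using! ((hasDerivAt_id s).sub_const a).div_const α
  have h2 : HasDerivAt Real.smoothTransition (deriv Real.smoothTransition ((s - a) / α))
      ((s - a) / α) :=
    ((Real.smoothTransition.contDiff (n := 1)).differentiable (by norm_num) _).hasDerivAt
  rw [mul_comm]
  exact h2.comp s h1

theorem fourier_scaled_bump (a T : ℝ) {α : ℝ} (hα : 0 < α) :
    𝓕 (fun s : ℝ => ((α⁻¹ * deriv Real.smoothTransition ((s - a) / α) : ℝ) : ℂ)) T =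
      cexp2pi (-(a * T)) * 𝓕 (transitionBump : ℝ → ℂ) (α * T) := by
  rw [Real.fourier_real_eq_integral_exp_smul, Real.fourier_real_eq_integral_exp_smul]
  set g : ℝ → ℂ := fun u => Complex.exp (↑(-2 * π * (a + α * u) * T) * Complex.I) •
    ((α⁻¹ * deriv Real.smoothTransition u : ℝ) : ℂ) with hg
  have e1 : ∀ v, Complex.exp (↑(-2 * π * v * T) * Complex.I) •
      ((α⁻¹ * deriv Real.smoothTransition ((v - a) / α) : ℝ) : ℂ) = g ((v - a) / α) := fun v => by
    simp only [hg, mul_div_cancel₀ _ hα.ne', add_sub_cancel]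
  simp_rw [e1]
  rw [integral_sub_right_eq_self (fun v => g (v / α)) a, Measure.integral_comp_div g,
    abs_of_pos hα, ← integral_smul, ← integral_const_mul]
  refine integral_congr_ae (Eventually.of_forall fun u => ?_)
  simp only [hg, smul_eq_mul, Complex.real_smul, transitionBump_apply]
  have : cexp2pi (-(a * T)) * Complex.exp (↑(-2 * π * u * (α * T)) * Complex.I) =
      Complex.exp (↑(-2 * π * (a + α * u) * T) * Complex.I) := by
    rw [cexp2pi, ← Complex.exp_add]; congr 1; push_cast; ring
  rw [← this]
  have hα' : (α : ℂ) ≠ 0 := by exact_mod_cast hα.ne'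
  push_cast
  field_simp

theorem schwartz_norm_mul_le (f : 𝓢(ℝ, ℂ)) (m : ℕ) :
    ∃ C, ∀ x : ℝ, ‖f x‖ * (1 + |x|) ^ m ≤ C := by
  obtain ⟨C₀, -, h0⟩ := f.decay 0 0
  obtain ⟨C₁, -, h1⟩ := f.decay m 0
  refine ⟨2 ^ m * (C₀ + C₁), fun x => ?_⟩
  have a0 := h0 x
  have a1 := h1 x
  rw [norm_iteratedFDeriv_zero] at a0 a1
  rw [pow_zero, one_mul] at a0
  rw [Real.norm_eq_abs] at a1
  have hx : (1 + |x|) ^ m ≤ 2 ^ m * (1 + |x| ^ m) := by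
    rcases le_total |x| 1 with h | h
    · calc (1 + |x|) ^ m ≤ 2 ^ m := by gcongr; linarith
        _ ≤ _ := le_mul_of_one_le_right (by positivity) (by
          linarith [pow_nonneg (abs_nonneg x) m])
    · calc (1 + |x|) ^ m ≤ (2 * |x|) ^ m := by gcongr; linarith
        _ = 2 ^ m * |x| ^ m := mul_pow _ _ _
        _ ≤ _ := by gcongr; linarith
  calc ‖f x‖ * (1 + |x|) ^ m ≤ ‖f x‖ * (2 ^ m * (1 + |x| ^ m)) := by gcongr
    _ = 2 ^ m * (‖f x‖ + |x| ^ m * ‖f x‖) := by ring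
    _ ≤ _ := by gcongr

/-- The contribution of one smooth step to the symbol of a cutoff function. -/
noncomputable def stepSymbol (a α T : ℝ) : ℂ :=
  cexp2pi ((1 - a) * T) * 𝓕 (transitionBump : ℝ → ℂ) (α * T) / (2 * π * Complex.I * T)

/-- The derivative of `stepSymbol`. -/
noncomputable def stepSymbolDeriv (a α T : ℝ) : ℂ :=
  cexp2pi ((1 - a) * T) * ((2 * π * Complex.I * (1 - a : ℝ)) * 𝓕 (transitionBump : ℝ → ℂ) (α * T) +
    α * deriv (𝓕 (transitionBump : ℝ → ℂ)) (α * T)) / (2 * π * Complex.I * T) -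
  cexp2pi ((1 - a) * T) * 𝓕 (transitionBump : ℝ → ℂ) (α * T) / (2 * π * Complex.I * T ^ 2)

theorem differentiable_fourier_transitionBump :
    Differentiable ℝ (𝓕 (transitionBump : ℝ → ℂ)) := by
  rw [← SchwartzMap.fourier_coe]; exact SchwartzMap.differentiable _

theorem continuous_deriv_fourier_transitionBump :
    Continuous (deriv (𝓕 (transitionBump : ℝ → ℂ))) := by
  rw [← SchwartzMap.fourier_coe]
  have : deriv ⇑(𝓕 transitionBump : 𝓢(ℝ, ℂ)) = ⇑(SchwartzMap.derivCLM ℝ ℂ (𝓕 transitionBump : 𝓢(ℝ, ℂ))) := by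
    ext x; rw [SchwartzMap.derivCLM_apply]
  rw [this]
  exact SchwartzMap.continuous _

theorem hasDerivAt_stepSymbol (a α : ℝ) {T : ℝ} (hT : 0 < T) :
    HasDerivAt (stepSymbol a α) (stepSymbolDeriv a α T) T := by
  have h1 : HasDerivAt (fun T : ℝ => cexp2pi ((1 - a) * T))
      (2 * π * Complex.I * (1 - a : ℝ) * cexp2pi ((1 - a) * T)) T :=
    hasDerivAt_cexp2pi_comp (by simpa using (hasDerivAt_id T).const_mul (1 - a))
  have h2 : HasDerivAt (fun T : ℝ => 𝓕 (transitionBump : ℝ → ℂ) (α * T))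
      (α * deriv (𝓕 (transitionBump : ℝ → ℂ)) (α * T)) T := by
    have := (differentiable_fourier_transitionBump (α * T)).hasDerivAt.scomp T
      (by simpa using (hasDerivAt_id T).const_mul α : HasDerivAt (fun T : ℝ => α * T) α T)
    simpa using! this
  have h3 : HasDerivAt (fun T : ℝ => (2 * π * Complex.I * T : ℂ)) (2 * π * Complex.I) T := by
    simpa using (Complex.ofRealCLM.hasDerivAt (x := T)).const_mul (2 * π * Complex.I)
  have hT' : (T : ℂ) ≠ 0 := by exact_mod_cast hT.ne'
  have hpi : (π : ℂ) ≠ 0 := by exact_mod_cast Real.pi_ne_zero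
  have h4 := (h1.mul h2).div h3 (by simp [hT', hpi])
  convert! h4 using 1
  rw [stepSymbolDeriv]
  simp only [Pi.mul_apply]
  field_simp

theorem continuousOn_stepSymbolDeriv (a α : ℝ) :
    ContinuousOn (stepSymbolDeriv a α) (Ioi 0) := by
  have c1 := differentiable_fourier_transitionBump.continuous
  have c2 := continuous_deriv_fourier_transitionBump
  have hpi : (π : ℂ) ≠ 0 := by exact_mod_cast Real.pi_ne_zero
  refine ContinuousOn.sub (ContinuousOn.div (by fun_prop) (by fun_prop) fun T hT => ?_)
    (ContinuousOn.div (by fun_prop) (by fun_prop) fun T hT => ?_)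
  all_goals
    have hT' : (T : ℂ) ≠ 0 := by exact_mod_cast (ne_of_gt hT)
    simp [hT', hpi]

/-- The transform of the bump at `αT` decays faster than any power of `αT`, and `δ ≤ α` lets it
absorb `(1 + δT)^L`. Differentiation costs `|1 - a| ≤ 3α` from the phase or `α` from the dilation;
the resulting extra `αT` is why decay of order `L + 1` is requested. -/
theorem stepSymbol_bounds (L : ℕ) : ∃ C, ∀ a α δ T : ℝ, 0 ≤ δ → δ ≤ α → |1 - a| ≤ 3 * α →
    0 < T → T * ‖stepSymbol a α T‖ * (1 + δ * T) ^ L ≤ C ∧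
      T ^ 2 * ‖stepSymbolDeriv a α T‖ * (1 + δ * T) ^ L ≤ C := by
  obtain ⟨C₁, h1⟩ := schwartz_norm_mul_le (𝓕 transitionBump) (L + 1)
  obtain ⟨C₂, h2⟩ := schwartz_norm_mul_le (SchwartzMap.derivCLM ℝ ℂ (𝓕 transitionBump : 𝓢(ℝ, ℂ))) (L + 1)
  have hC1 : 0 ≤ C₁ := le_trans (by positivity) (h1 0)
  have hC2 : 0 ≤ C₂ := le_trans (by positivity) (h2 0)
  simp only [SchwartzMap.derivCLM_apply, SchwartzMap.fourier_coe] at h1 h2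
  refine ⟨4 * C₁ + C₂, fun a α δ T hδ hδα ha hT => ?_⟩
  have hα : 0 ≤ α := hδ.trans hδα
  have hαT : 0 ≤ α * T := by positivity
  have b1 := h1 (α * T)
  have b2 := h2 (α * T)
  rw [abs_of_nonneg hαT] at b1 b2
  set A := ‖𝓕 (transitionBump : ℝ → ℂ) (α * T)‖ with hA
  set D := ‖deriv (𝓕 (transitionBump : ℝ → ℂ)) (α * T)‖ with hD
  have hA0 : 0 ≤ A := norm_nonneg _
  have hD0 : 0 ≤ D := norm_nonneg _
  have hpi := Real.pi_gt_three
  set E := (1 + δ * T) ^ L with hE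
  have hE0 : 0 ≤ E := by positivity
  have hEle : E ≤ (1 + α * T) ^ L := by rw [hE]; gcongr
  rw [pow_succ] at b1 b2
  have hAE : A * E * (1 + α * T) ≤ C₁ := by
    refine le_trans ?_ b1
    rw [mul_assoc]
    gcongr
  have hDE : D * E * (1 + α * T) ≤ C₂ := by
    refine le_trans ?_ b2
    rw [mul_assoc]
    gcongr
  have hAE0 : 0 ≤ A * E := by positivity
  have hDE0 : 0 ≤ D * E := by positivity
  have nden : ‖(2 * π * Complex.I * T : ℂ)‖ = 2 * π * T := by
    simp [abs_of_pos Real.pi_pos, abs_of_pos hT]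
  have nden2 : ‖(2 * π * Complex.I * T ^ 2 : ℂ)‖ = 2 * π * T ^ 2 := by
    simp [abs_of_pos Real.pi_pos]
  have nS : ‖stepSymbol a α T‖ = A / (2 * π * T) := by
    rw [stepSymbol, norm_div, nden, norm_mul, norm_cexp2pi, one_mul]
  have nD : ‖stepSymbolDeriv a α T‖ ≤ (2 * π * (3 * α) * A + α * D) / (2 * π * T) +
      A / (2 * π * T ^ 2) := by
    rw [stepSymbolDeriv]
    refine (norm_sub_le _ _).trans (add_le_add ?_ (le_of_eq ?_))
    · rw [norm_div, nden, norm_mul, norm_cexp2pi, one_mul]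
      gcongr
      refine (norm_add_le _ _).trans (add_le_add ?_ (le_of_eq ?_))
      · rw [norm_mul, norm_mul, norm_mul, norm_mul, Complex.norm_real, Complex.norm_real,
          Complex.norm_I, Real.norm_of_nonneg Real.pi_pos.le, Complex.norm_two, mul_one,
          Real.norm_eq_abs]
        gcongr
      · rw [norm_mul, Complex.norm_real, Real.norm_of_nonneg hα]
    · rw [norm_div, nden2, norm_mul, norm_cexp2pi, one_mul]
  have hprod : 0 ≤ A * E * (α * T) := by positivity
  have hprod2 : 0 ≤ D * E * (α * T) := by positivity
  constructor
  · rw [nS]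
    have : T * (A / (2 * π * T)) * E = A * E / (2 * π) := by field_simp
    rw [this, div_le_iff₀ (by positivity)]
    nlinarith
  · calc T ^ 2 * ‖stepSymbolDeriv a α T‖ * E
        ≤ T ^ 2 * ((2 * π * (3 * α) * A + α * D) / (2 * π * T) + A / (2 * π * T ^ 2)) * E := by
          gcongr
      _ = 3 * (A * E * (α * T)) + (D * E * (α * T) + A * E) / (2 * π) := by field_simp; ring
      _ ≤ 3 * (A * E * (α * T)) + (D * E * (α * T) + A * E) := by
          gcongr
          exact div_le_self (by positivity) (by linarith)
      _ ≤ _ := by nlinarith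

theorem fourier_fun_sub {f g : ℝ → ℂ} (hf : Integrable f) (hg : Integrable g) (T : ℝ) :
    𝓕 (fun s => f s - g s) T = 𝓕 f T - 𝓕 g T := by
  have hi : ∀ {f : ℝ → ℂ}, Integrable f →
      Integrable fun v : ℝ => Complex.exp (↑(-2 * π * v * T) * Complex.I) • f v := fun hf =>
    hf.bdd_mul (c := 1) (by fun_prop : Continuous _).aestronglyMeasurable
      (Eventually.of_forall fun v => (Complex.norm_exp_ofReal_mul_I _).le)
  simp only [Real.fourier_real_eq_integral_exp_smul]
  rw [← integral_sub (hi hf) (hi hg)]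
  simp only [smul_sub]

theorem conj_fourier_ofReal (F : ℝ → ℝ) (T : ℝ) :
    𝓕 (fun s => (F s : ℂ)) (-T) = (starRingEnd ℂ) (𝓕 (fun s => (F s : ℂ)) T) := by
  rw [Real.fourier_real_eq_integral_exp_smul, Real.fourier_real_eq_integral_exp_smul,
    ← integral_conj]
  refine integral_congr_ae (Eventually.of_forall fun v => ?_)
  simp only [smul_eq_mul, map_mul, Complex.conj_ofReal, ← Complex.exp_conj, Complex.conj_I]
  congr 2
  push_cast
  ring

/-- Fourier inversion; since `F` is real, the negative frequencies contribute the conjugate of the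
positive ones. -/
theorem eq_two_mul_re_integral {f : 𝓢(ℝ, ℂ)} {F : ℝ → ℝ} (hf : ∀ s, f s = (F s : ℂ)) (s : ℝ) :
    F s = 2 * (∫ T in Ioi 0, 𝓕 (fun s => (F s : ℂ)) T * cexp2pi (T * s)).re := by
  have hcoe : (f : ℝ → ℂ) = fun s => (F s : ℂ) := funext hf
  have hint : Integrable (𝓕 (fun s => (F s : ℂ))) := by
    rw [← hcoe, ← SchwartzMap.fourier_coe]; exact SchwartzMap.integrable _
  have hinv := f.continuous.fourierInv_fourier_eq f.integrable
    (by rw [← SchwartzMap.fourier_coe]; exact SchwartzMap.integrable _)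
  rw [hcoe] at hinv
  have hs := congrFun hinv s
  rw [Real.fourierInv_eq'] at hs
  have e1 : (F s : ℂ) = ∫ T, 𝓕 (fun s => (F s : ℂ)) T * cexp2pi (T * s) := by
    rw [← hs]
    refine integral_congr_ae (Eventually.of_forall fun T => ?_)
    simp only [cexp2pi, smul_eq_mul]
    rw [mul_comm]
    congr 3
    simp
    ring
  set G : ℝ → ℂ := fun T => 𝓕 (fun s => (F s : ℂ)) T * cexp2pi (T * s) with hG
  have hGi : Integrable G := by
    refine hint.mul_bdd (c := 1) (by fun_prop : Continuous _).aestronglyMeasurable ?_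
    exact Eventually.of_forall fun T => by simp
  have hneg : ∀ T, G (-T) = (starRingEnd ℂ) (G T) := fun T => by
    simp only [hG, map_mul, conj_fourier_ofReal, conj_cexp2pi, neg_mul]
  have e2 : ∫ T in Iic 0, G T = (starRingEnd ℂ) (∫ T in Ioi 0, G T) := by
    rw [← integral_conj]
    simp_rw [← hneg]
    rw [integral_comp_neg_Ioi, neg_zero]
  rw [← integral_add_compl measurableSet_Ioi hGi (s := Ioi 0), compl_Ioi, e2] at e1
  have := congrArg Complex.re e1
  simp only [Complex.ofReal_re, Complex.add_re, Complex.conj_re] at this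
  linarith

/-- Differences of smooth steps near `1` are cutoff functions, uniformly. -/
theorem exists_isCutoff (L : ℕ) : ∃ K, ∀ a α b β δ : ℝ, 0 < δ → δ ≤ α → α ≤ 1 → δ ≤ β → β ≤ 1 →
    |1 - a| ≤ 3 * α → |1 - b| ≤ 3 * β →
    ∃ ψ ψ' : ℝ → ℂ, IsCutoff L K δ (fun s => smoothStep a α s - smoothStep b β s) ψ ψ' := by
  obtain ⟨C, hC⟩ := stepSymbol_bounds L
  -- `2C` serves the two steps. `7` is the length of `[-2, 5]`, which contains the support of `F`;
  -- as `|F| ≤ 1`, it bounds the transform also near `T = 0`, where the formula with `1/T` is of no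
  -- use.
  refine ⟨max (2 * C) 7, fun a α b β δ hδ hα hα1 hβ hβ1 ha hb => ?_⟩
  have hα0 : 0 < α := hδ.trans_le hα
  have hβ0 : 0 < β := hδ.trans_le hβ
  have ha' := abs_le.1 ha
  have hb' := abs_le.1 hb
  set F : ℝ → ℝ := fun s => smoothStep a α s - smoothStep b β s with hF
  have hFs : ContDiff ℝ ∞ F := (contDiff_smoothStep a α).sub (contDiff_smoothStep b β)
  have hF0 : ∀ x, x ∉ Icc (-2 : ℝ) 5 → F x = 0 := fun x hx => by
    rw [mem_Icc, not_and_or, not_le, not_le] at hx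
    rcases hx with hx | hx
    · simp only [hF]
      rw [smoothStep_eq_zero hα0 (by linarith), smoothStep_eq_zero hβ0 (by linarith), sub_zero]
    · simp only [hF]
      rw [smoothStep_eq_one hα0 (by linarith), smoothStep_eq_one hβ0 (by linarith), sub_self]
  set f : 𝓢(ℝ, ℂ) := HasCompactSupport.toSchwartzMap (f := fun x => (F x : ℂ))
    (HasCompactSupport.intro (isCompact_Icc (a := (-2 : ℝ)) (b := 5)) fun x hx => by
      rw [hF0 x hx, Complex.ofReal_zero]) (Complex.ofRealCLM.contDiff.comp hFs) with hf
  have hfF : ∀ s, f s = (F s : ℂ) := fun s => rfl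
  have hcoe : (f : ℝ → ℂ) = fun s => (F s : ℂ) := funext hfF
  set Φ := 𝓕 (fun s => (F s : ℂ)) with hΦ
  have hΦS : Φ = ⇑(𝓕 f : 𝓢(ℝ, ℂ)) := by rw [hΦ, ← hcoe, SchwartzMap.fourier_coe]
  have hΦc : Continuous Φ := by rw [hΦS]; exact SchwartzMap.continuous _
  have hΦi : Integrable Φ := by rw [hΦS]; exact SchwartzMap.integrable _
  have hdF : ∀ s, HasDerivAt (fun s => (F s : ℂ))
      (((α⁻¹ * deriv Real.smoothTransition ((s - a) / α) : ℝ) : ℂ) -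
        ((β⁻¹ * deriv Real.smoothTransition ((s - b) / β) : ℝ) : ℂ)) s := fun s => by
    rw [← Complex.ofReal_sub]
    exact ((hasDerivAt_smoothStep a α s).sub (hasDerivAt_smoothStep b β s)).ofReal_comp
  have hbump : ∀ a α : ℝ, 0 < α → Integrable fun s : ℝ =>
      ((α⁻¹ * deriv Real.smoothTransition ((s - a) / α) : ℝ) : ℂ) := fun a α hα => by
    have c := contDiff_deriv_smoothTransition.continuous
    refine Continuous.integrable_of_hasCompactSupport (by fun_prop) ?_
    refine HasCompactSupport.intro (isCompact_Icc (a := a) (b := a + α)) fun x hx => ?_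
    rw [deriv_smoothTransition_eq_zero, mul_zero, Complex.ofReal_zero]
    rintro ⟨h1, h2⟩
    rw [le_div_iff₀ hα] at h1
    rw [div_le_iff₀ hα] at h2
    exact hx ⟨by linarith, by linarith⟩
  have hderiv : deriv (fun s => (F s : ℂ)) = fun s : ℝ =>
      ((α⁻¹ * deriv Real.smoothTransition ((s - a) / α) : ℝ) : ℂ) -
        ((β⁻¹ * deriv Real.smoothTransition ((s - b) / β) : ℝ) : ℂ) :=
    funext fun s => (hdF s).deriv
  have hFd := Real.fourier_deriv (f := fun s => (F s : ℂ)) (hcoe ▸ f.integrable)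
    (fun s => (hdF s).differentiableAt) (by
      rw [hderiv]; exact (hbump a α hα0).sub (hbump b β hβ0))
  -- The derivative of `F` is a difference of two scaled bumps, and dividing its transform by `2πiT`
  -- recovers that of `F`. The factor `cexp2pi T` recentres the frequencies at `s = 1`.
  have hform : ∀ T, 0 < T → cexp2pi T * Φ T = stepSymbol a α T - stepSymbol b β T := fun T hT => by
    have h1 := congrFun hFd T
    rw [hderiv] at h1
    have h2 := fourier_fun_sub (hbump a α hα0) (hbump b β hβ0) T
    rw [h2, fourier_scaled_bump a T hα0, fourier_scaled_bump b T hβ0, smul_eq_mul] at h1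
    have hT' : (T : ℂ) ≠ 0 := by exact_mod_cast hT.ne'
    have hpi : (π : ℂ) ≠ 0 := by exact_mod_cast Real.pi_ne_zero
    have hden : (2 * π * Complex.I * T : ℂ) ≠ 0 := by simp [hT', hpi]
    have ex : ∀ a, cexp2pi ((1 - a) * T) = cexp2pi T * cexp2pi (-(a * T)) := fun a => by
      rw [← cexp2pi_add]; congr 1; ring
    rw [stepSymbol, stepSymbol, ← sub_div, eq_div_iff hden, ex a, ex b]
    linear_combination (-cexp2pi T) * h1
  refine ⟨fun T => cexp2pi T * Φ T, fun T => stepSymbolDeriv a α T - stepSymbolDeriv b β T,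
    hFs.continuous, fun s => ?_, ?_, by fun_prop, fun T hT => ?_, ?_, fun T => ?_,
    fun T hT => ?_, fun T hT => ?_⟩
  · rw [eq_two_mul_re_integral hfF s]
    congr 3
    ext T
    have : cexp2pi (T * s) = cexp2pi T * cexp2pi (T * (s - 1)) := by
      rw [← cexp2pi_add]; congr 1; ring
    rw [this]; ring
  · exact hΦi.bdd_mul (c := 1) continuous_cexp2pi.aestronglyMeasurable
      (Eventually.of_forall fun T => by simp)
  · refine HasDerivAt.congr_of_eventuallyEq
      ((hasDerivAt_stepSymbol a α hT).sub (hasDerivAt_stepSymbol b β hT)) ?_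
    filter_upwards [Ioi_mem_nhds hT] with z hz
    exact hform z hz
  · exact (continuousOn_stepSymbolDeriv a α).sub (continuousOn_stepSymbolDeriv b β)
  · rw [norm_mul, norm_cexp2pi, one_mul, hΦ, Real.fourier_real_eq_integral_exp_smul]
    refine le_trans ?_ (le_max_right _ _)
    rw [← setIntegral_eq_integral_of_forall_compl_eq_zero (s := Icc (-2 : ℝ) 5)
      (fun x hx => by rw [hF0 x hx]; simp)]
    refine (norm_setIntegral_le_of_norm_le_const (C := 1) (by simp) fun x _ => ?_).trans ?_
    · rw [norm_smul, Complex.norm_exp_ofReal_mul_I, one_mul, Complex.norm_real, Real.norm_eq_abs,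
        abs_le]
      have := smoothStep_nonneg a α x
      have := smoothStep_nonneg b β x
      have := smoothStep_le_one a α x
      have := smoothStep_le_one b β x
      constructor <;> simp only [hF] <;> linarith
    · simp [Measure.real]; norm_num
  · refine le_trans ?_ (le_max_left _ _)
    rw [hform T hT]
    have h1 := (hC a α δ T hδ.le hα ha hT).1
    have h2 := (hC b β δ T hδ.le hβ hb hT).1
    calc _ ≤ T * (‖stepSymbol a α T‖ + ‖stepSymbol b β T‖) * (1 + δ * T) ^ L := by
          gcongr; exact norm_sub_le _ _
      _ ≤ _ := by linarith
  · refine le_trans ?_ (le_max_left _ _)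
    have h1 := (hC a α δ T hδ.le hα ha hT).2
    have h2 := (hC b β δ T hδ.le hβ hb hT).2
    calc _ ≤ T ^ 2 * (‖stepSymbolDeriv a α T‖ + ‖stepSymbolDeriv b β T‖) * (1 + δ * T) ^ L := by
          gcongr; exact norm_sub_le _ _
      _ ≤ _ := by linarith

end LatticeEllipsoid

namespace LatticeEllipsoid
open MeasureTheory Set intervalIntegral
open scoped Real Topology

/-! ### The stationary block estimate -/

theorem norm_prod_sub_prod_le {ι : Type*} (s : Finset ι) {a b : ι → ℂ} {A ε : ℝ} (hA : 0 ≤ A)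
    (ha : ∀ i ∈ s, ‖a i‖ ≤ A) (hb : ∀ i ∈ s, ‖b i‖ ≤ A) (hab : ∀ i ∈ s, ‖a i - b i‖ ≤ ε) :
    ‖∏ i ∈ s, a i - ∏ i ∈ s, b i‖ ≤ s.card * ε * A ^ (s.card - 1) := by
  classical
  induction s using Finset.induction_on with
  | empty => simp
  | insert j s hj ih =>
    have ih' := ih (fun i hi => ha i (Finset.mem_insert_of_mem hi))
      (fun i hi => hb i (Finset.mem_insert_of_mem hi))
      (fun i hi => hab i (Finset.mem_insert_of_mem hi))
    have hε : 0 ≤ ε := (norm_nonneg _).trans (hab j (Finset.mem_insert_self _ _))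
    rw [Finset.prod_insert hj, Finset.prod_insert hj, Finset.card_insert_of_notMem hj,
      Nat.add_sub_cancel]
    have hbs : ‖∏ i ∈ s, b i‖ ≤ A ^ s.card := by
      rw [norm_prod]
      exact (Finset.prod_le_prod (fun _ _ => norm_nonneg _)
        fun i hi => hb i (Finset.mem_insert_of_mem hi)).trans (by simp)
    have hpow : A * (s.card * ε * A ^ (s.card - 1)) = s.card * ε * A ^ s.card := by
      rcases h : s.card with _ | m
      · simp
      · rw [Nat.add_sub_cancel, pow_succ]
        ring
    calc ‖a j * ∏ i ∈ s, a i - b j * ∏ i ∈ s, b i‖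
        = ‖a j * (∏ i ∈ s, a i - ∏ i ∈ s, b i) + (a j - b j) * ∏ i ∈ s, b i‖ := by
          congr 1; ring
      _ ≤ A * (s.card * ε * A ^ (s.card - 1)) + ε * A ^ s.card := by
          refine (norm_add_le _ _).trans ?_
          rw [norm_mul, norm_mul]
          exact add_le_add (mul_le_mul (ha j (Finset.mem_insert_self _ _)) ih' (norm_nonneg _) hA)
            (mul_le_mul (hab j (Finset.mem_insert_self _ _)) hbs (norm_nonneg _) hε)
      _ = _ := by rw [hpow]; push_cast; ring

/-- Telescoping against `z/(1 + z)`: multiplying `z` by `√2` increases this function by at least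
`min(z, 1/z)/20`, while its total increase is at most `1`. Hence the bound is uniform in both `x`
and `J`. -/
theorem sum_min_geometric_le {x : ℝ} (hx : 0 < x) (J : ℕ) :
    ∑ j ∈ Finset.range J, min (x * √2 ^ j) (1 / (x * √2 ^ j)) ≤ 20 := by
  have hs2 : √2 ^ 2 = 2 := Real.sq_sqrt (by norm_num)
  have hs : (1.4 : ℝ) ≤ √2 := Real.le_sqrt_of_sq_le (by norm_num)
  have hs' : √2 ≤ 1.5 := by rw [Real.sqrt_le_left (by norm_num)]; norm_num
  have step : ∀ z : ℝ, 0 < z → min z (1 / z) ≤ 20 * (√2 * z / (1 + √2 * z) - z / (1 + z)) := by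
    intro z hz
    have e : √2 * z / (1 + √2 * z) - z / (1 + z) = (√2 - 1) * z / ((1 + √2 * z) * (1 + z)) := by
      field_simp; ring
    rw [e, ← mul_div_assoc]
    rcases le_total z 1 with h | h
    · refine (min_le_left _ _).trans ?_
      rw [le_div_iff₀ (by positivity)]
      have : (1 + √2 * z) * (1 + z) ≤ (1 + 1.5 * 1) * (1 + 1) := by gcongr
      have : (1 + √2 * z) * (1 + z) ≤ 20 * (√2 - 1) := by linarith
      nlinarith
    · refine (min_le_right _ _).trans ?_
      rw [div_le_div_iff₀ hz (by positivity)]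
      have h1 : (1 + √2 * z) * (1 + z) ≤ ((1 + √2) * z) * (2 * z) := by gcongr <;> nlinarith
      have h2 : (1 + √2) * 2 ≤ 20 * (√2 - 1) := by nlinarith
      nlinarith [mul_pos hz hz]
  have tel : ∀ J : ℕ, ∑ j ∈ Finset.range J, min (x * √2 ^ j) (1 / (x * √2 ^ j)) ≤
      20 * (x * √2 ^ J / (1 + x * √2 ^ J) - x / (1 + x)) := by
    intro J
    induction J with
    | zero => simp
    | succ J ih =>
      rw [Finset.sum_range_succ]
      have := step (x * √2 ^ J) (by positivity)
      have e : √2 * (x * √2 ^ J) = x * √2 ^ (J + 1) := by ring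
      rw [e] at this
      linarith
  refine (tel J).trans ?_
  have h1 : x * √2 ^ J / (1 + x * √2 ^ J) ≤ 1 := by
    rw [div_le_one (by positivity)]; linarith
  have h2 : 0 ≤ x / (1 + x) := by positivity
  linarith

/-- With `z = x √2^j`, each term times `x^(n-1)` is `z^(n-1)/(1 + z²)ⁿ ≤ min(z, 1/z)`, so the sum is
concentrated at `z ~ 1`. The bound by `z` for small `z` uses `n ≥ 2`; the decay for large `z` shows
that damping of order `n` suffices. -/
theorem sum_dyadic_le {n : ℕ} (hn : 2 ≤ n) {x : ℝ} (hx : 0 < x) (J : ℕ) :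
    ∑ j ∈ Finset.range J, (√2 ^ j) ^ (n - 1) / (1 + x ^ 2 * 2 ^ j) ^ n ≤ 20 / x ^ (n - 1) := by
  have key : ∀ z : ℝ, 0 < z → z ^ (n - 1) / (1 + z ^ 2) ^ n ≤ min z (1 / z) := by
    intro z hz
    refine le_min ?_ ?_
    · rcases le_total z 1 with h | h
      · calc z ^ (n - 1) / (1 + z ^ 2) ^ n ≤ z ^ (n - 1) / 1 := by
              gcongr; exact one_le_pow₀ (by nlinarith)
          _ ≤ z := by rw [div_one]; exact pow_le_of_le_one hz.le h (by omega)
      · have : z ^ (n - 1) ≤ (1 + z ^ 2) ^ n :=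
          (pow_le_pow_left₀ hz.le (by nlinarith : z ≤ 1 + z ^ 2) _).trans
            (pow_le_pow_right₀ (by nlinarith) (by omega))
        exact (div_le_one_of_le₀ this (by positivity)).trans h
    · rw [div_le_div_iff₀ (by positivity) hz, one_mul, ← pow_succ, Nat.sub_add_cancel (by omega)]
      exact pow_le_pow_left₀ hz.le (by nlinarith [sq_nonneg (z - 1)]) n
  rw [le_div_iff₀ (by positivity), Finset.sum_mul]
  refine le_trans (Finset.sum_le_sum fun j _ => ?_) (sum_min_geometric_le hx J)
  refine le_trans (le_of_eq ?_) (key (x * √2 ^ j) (by positivity))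
  rw [mul_pow, mul_pow, ← pow_mul √2 j 2, mul_comm j 2, pow_mul √2 2 j,
    Real.sq_sqrt (by norm_num)]
  ring

variable {n : ℕ} {B K p : ℝ} {V V₁ V₂ : Fin n → ℝ → ℝ}

/-- The second derivative test in the radial frequency variable `T`. -/
theorem norm_integral_block_le (hB : 0 < B) (hp : 0 < p) {P : Fin n → ℝ} (hP : ∀ i, p ≤ P i)
    (hV : ∀ i, IsAmplitude B K (V i) (V₁ i) (V₂ i)) {L : ℕ} {K' δ : ℝ} {F : ℝ → ℝ} {ψ ψ' : ℝ → ℂ}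
    (hF : IsCutoff L K' δ F ψ ψ') (hδ : 0 ≤ δ) {T₀ κ : ℝ} (hT₀ : 0 < T₀) (hK : 0 ≤ K) (hκ : 0 ≤ κ)
    {ξ : Fin n → ℝ} (hξ : ∀ i, |ξ i| ≤ κ * T₀) :
    ‖∫ T in T₀..2 * T₀, ψ T * cexp2pi (-T) * ∏ i, osc B (V i) (P i * T) (ξ i)‖ ≤
      64 * (n + 2) * K' * (K / √p * (18 * B + κ / p)) ^ n * (1 / √T₀) ^ (n + 1) /
        (1 + δ * T₀) ^ L := by
  have hsT : 0 < √T₀ := Real.sqrt_pos.2 hT₀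
  have hsp : 0 < √p := Real.sqrt_pos.2 hp
  have hsq : √T₀ ^ 2 = T₀ := Real.sq_sqrt hT₀.le
  have hab : T₀ ≤ 2 * T₀ := by linarith
  set r := 1 / √T₀ with hr
  have hr0 : 0 < r := by positivity
  set C := K / √p * (18 * B + κ / p) with hC
  have hC00 : 0 ≤ C := by positivity
  -- Each factor has size `O(T₀^(-1/2))`, and its `T`-derivative is smaller by `1/T₀`. The condition
  -- `|ξ i| ≤ κT₀` enters only to keep the stationary point bounded by `κ/(2p)`; the `18B` in `C`
  -- covers the `8B` and `10B` of the two estimates.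
  have hCn : ∀ i : Fin n, 0 ≤ C ∧ ∀ T, T₀ ≤ T → ‖oscAmp B (V i) (P i * T) (ξ i)‖ ≤ C * r ∧
      ‖(P i : ℂ) * oscAmpDeriv B (V i) (P i * T) (ξ i)‖ ≤ C * r / T₀ := by
    intro i
    refine ⟨hC00, fun T hT => ?_⟩
    have hPi : 0 < P i := hp.trans_le (hP i)
    have hT0 : 0 < T := hT₀.trans_le hT
    have hPT : 0 < P i * T := by positivity
    have hs : √p * √T₀ ≤ √(P i * T) := by
      rw [← Real.sqrt_mul hp.le]
      exact Real.sqrt_le_sqrt (mul_le_mul (hP i) hT hT₀.le hPi.le)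
    have hCge : K / √p * (18 * B) ≤ C := by
      rw [hC]; gcongr; linarith [div_nonneg hκ hp.le]
    constructor
    · rw [norm_oscAmp]
      refine (norm_osc_le_div_sqrt (hV i) hB hPT _).trans ?_
      calc 8 * B * K / √(P i * T) ≤ 8 * B * K / (√p * √T₀) := by gcongr
        _ = (K / √p * (8 * B)) * r := by rw [hr]; field_simp
        _ ≤ (K / √p * (18 * B)) * r := by gcongr; norm_num
        _ ≤ C * r := by gcongr
    · rw [norm_mul, Complex.norm_real, Real.norm_of_nonneg hPi.le]
      have hc : |ξ i / (2 * (P i * T))| ≤ κ / (2 * p) := by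
        rw [abs_div, abs_of_pos (by positivity : 0 < 2 * (P i * T)),
          div_le_div_iff₀ (by positivity) (by positivity)]
        calc |ξ i| * (2 * p) ≤ κ * T₀ * (2 * p) := by gcongr; exact hξ i
          _ = κ * (2 * (p * T₀)) := by ring
          _ ≤ κ * (2 * (P i * T)) := by gcongr; exact hP i
      calc P i * ‖oscAmpDeriv B (V i) (P i * T) (ξ i)‖
          ≤ P i * (2 / (P i * T * √(P i * T)) * (K * (5 * B + κ / (2 * p)))) := by
            gcongr
            refine (norm_oscAmpDeriv_le (hV i) hB hPT _).trans ?_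
            gcongr
        _ = 2 / (T * √(P i * T)) * (K * (5 * B + κ / (2 * p))) := by field_simp
        _ ≤ 2 / (T₀ * (√p * √T₀)) * (K * (5 * B + κ / (2 * p))) := by gcongr
        _ = K / √p * (10 * B + κ / p) * r / T₀ := by rw [hr]; field_simp; ring
        _ ≤ C * r / T₀ := by rw [hC]; gcongr; linarith
  have hC0 : 0 ≤ C ^ n := pow_nonneg hC00 n
  have hE : 0 < (1 + δ * T₀) ^ L := by positivity
  set E := (1 + δ * T₀) ^ L with hEdef
  have hEle : ∀ T, T₀ ≤ T → E ≤ (1 + δ * T) ^ L := fun T hT => by rw [hEdef]; gcongr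
  have hψ : ∀ T, T₀ ≤ T → ‖ψ T‖ ≤ K' / (T₀ * E) := fun T hT => by
    have hT0 : 0 ≤ T := hT₀.le.trans hT
    rw [le_div_iff₀ (by positivity)]
    refine le_trans ?_ (hF.norm_mul_le T (by linarith))
    calc ‖ψ T‖ * (T₀ * E) = T₀ * ‖ψ T‖ * E := by ring
      _ ≤ T * ‖ψ T‖ * (1 + δ * T) ^ L := by gcongr; exact hEle T hT
  have hψ' : ∀ T, T₀ ≤ T → ‖ψ' T‖ ≤ K' / (T₀ ^ 2 * E) := fun T hT => by
    have hT0 : 0 ≤ T := hT₀.le.trans hT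
    rw [le_div_iff₀ (by positivity)]
    refine le_trans ?_ (hF.norm_deriv_mul_le T (by linarith))
    calc ‖ψ' T‖ * (T₀ ^ 2 * E) = T₀ ^ 2 * ‖ψ' T‖ * E := by ring
      _ ≤ T ^ 2 * ‖ψ' T‖ * (1 + δ * T) ^ L := by gcongr; exact hEle T hT
  have hK' : 0 ≤ K' := (norm_nonneg _).trans (hF.norm_le 0)
  set G : ℝ → ℂ := fun T => ∏ i, oscAmp B (V i) (P i * T) (ξ i)
  set G' : ℝ → ℂ := fun T => ∑ i, (∏ j ∈ Finset.univ.erase i, oscAmp B (V j) (P j * T) (ξ j)) *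
    ((P i : ℂ) * oscAmpDeriv B (V i) (P i * T) (ξ i))
  have hamp : ∀ i T, T₀ ≤ T → HasDerivAt (fun T => oscAmp B (V i) (P i * T) (ξ i))
      ((P i : ℂ) * oscAmpDeriv B (V i) (P i * T) (ξ i)) T := fun i T hT => by
    have hPi : 0 < P i := hp.trans_le (hP i)
    have hT0 : 0 < T := hT₀.trans_le hT
    have h1 : HasDerivAt (fun T : ℝ => P i * T) (P i) T := by
      simpa using (hasDerivAt_id T).const_mul (P i)
    have := (hasDerivAt_oscAmp (hV i) (by positivity : 0 < P i * T) (ξ i)).scomp T h1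
    rw [Complex.real_smul] at this
    exact this
  have hG : ∀ T, T₀ ≤ T → HasDerivAt G (G' T) T := fun T hT => by
    have := HasDerivAt.fun_finsetProd (u := Finset.univ) fun i _ => hamp i T hT
    simpa [G, G', smul_eq_mul] using this
  have hGn : ∀ T, T₀ ≤ T → ‖G T‖ ≤ (C * r) ^ n := fun T hT => by
    simp only [G, norm_prod]
    refine (Finset.prod_le_prod (fun _ _ => norm_nonneg _)
      fun i _ => ((hCn i).2 T hT).1).trans ?_
    simp
  have hG'n : ∀ T, T₀ ≤ T → ‖G' T‖ ≤ n * ((C * r) ^ n / T₀) := fun T hT => by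
    refine (norm_sum_le _ _).trans ?_
    refine (Finset.sum_le_card_nsmul _ _ ((C * r) ^ n / T₀) fun i _ => ?_).trans (by simp)
    rw [norm_mul, norm_prod]
    have hCr : 0 ≤ C * r := mul_nonneg (hCn i).1 hr0.le
    have h1 : ∏ j ∈ Finset.univ.erase i, ‖oscAmp B (V j) (P j * T) (ξ j)‖ ≤ (C * r) ^ (n - 1) := by
      refine (Finset.prod_le_prod (fun _ _ => norm_nonneg _)
        fun j _ => ((hCn j).2 T hT).1).trans ?_
      simp [Finset.card_erase_of_mem]
    refine (mul_le_mul h1 ((hCn i).2 T hT).2 (norm_nonneg _) (by positivity)).trans (le_of_eq ?_)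
    have hn1 : n - 1 + 1 = n := Nat.sub_add_cancel (Nat.one_le_iff_ne_zero.2 (by
      rintro rfl; exact i.elim0))
    conv_rhs => rw [← hn1, pow_succ]
    ring
  have hX : 0 ≤ ∑ i, ξ i ^ 2 / (4 * P i) := Finset.sum_nonneg fun i _ => by
    have hPi : 0 < P i := hp.trans_le (hP i)
    positivity
  -- The stationary phases of all coordinates combine into one term `X/T`, leaving the slowly
  -- varying amplitude `ψ * G`.
  have heq : ∫ T in T₀..2 * T₀, ψ T * cexp2pi (-T) * ∏ i, osc B (V i) (P i * T) (ξ i) =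
      ∫ T in T₀..2 * T₀, (ψ T * G T) * cexp2pi (-(T + (∑ i, ξ i ^ 2 / (4 * P i)) / T)) := by
    refine integral_congr fun T hT => ?_
    rw [uIcc_of_le hab] at hT
    have hT0 : 0 < T := hT₀.trans_le hT.1
    have h1 : ∏ i, osc B (V i) (P i * T) (ξ i) =
        cexp2pi (-((∑ i, ξ i ^ 2 / (4 * P i)) / T)) * G T := by
      simp only [G]
      rw [Finset.sum_div, ← Finset.sum_neg_distrib, cexp2pi_sum, ← Finset.prod_mul_distrib]
      refine Finset.prod_congr rfl fun i _ => ?_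
      rw [osc_eq_mul_oscAmp, div_div, mul_assoc 4]
    simp only [h1, neg_add, cexp2pi_add]
    ring
  have hcont : ContinuousOn (fun T => ψ' T * G T + ψ T * G' T) (Icc T₀ (2 * T₀)) := by
    have hsub : Icc T₀ (2 * T₀) ⊆ Ioi 0 := fun T hT => hT₀.trans_le hT.1
    refine ((hF.continuousOn.mono hsub).mul fun T hT =>
      (hG T hT.1).continuousAt.continuousWithinAt).add
      (hF.continuous_amp.continuousOn.mul ?_)
    refine continuousOn_finsetSum _ fun i _ => ?_
    refine (continuousOn_finsetProd _ fun j _ => fun T hT =>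
      (hamp j T hT.1).continuousAt.continuousWithinAt).mul (continuousOn_const.mul ?_)
    refine (continuousOn_oscAmpDeriv (hV i) (ξ i)).comp (by fun_prop) fun T hT => ?_
    have hPi : 0 < P i := hp.trans_le (hP i)
    exact mul_pos hPi (hsub hT)
  have key := norm_integral_mul_le (M := 32 * √(2 * T₀)) hab
    (u := fun T => ψ T * G T) (u' := fun T => ψ' T * G T + ψ T * G' T)
    (h := fun T => cexp2pi (-(T + (∑ i, ξ i ^ 2 / (4 * P i)) / T)))
    (fun T hT => (hF.hasDerivAt T (hT₀.trans_le hT.1)).mul (hG T hT.1)) hcont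
    (by
      refine continuous_cexp2pi.comp_continuousOn (continuousOn_id.add
        (continuousOn_const.div continuousOn_id fun T hT => ?_)).neg
      exact (hT₀.trans_le hT.1).ne')
    (fun T hT => (norm_integral_cexp2pi_add_div_le hX hT₀ hT.1).trans (by
      gcongr; exact hT.2))
  rw [heq]
  refine key.trans ?_
  have hCrn : (C * r) ^ n = C ^ n * r ^ n := mul_pow _ _ _
  have hCrn0 : 0 ≤ (C * r) ^ n := by rw [hCrn]; positivity
  have hu : ‖ψ (2 * T₀) * G (2 * T₀)‖ ≤ K' / (T₀ * E) * (C * r) ^ n := by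
    rw [norm_mul]
    gcongr
    · exact hψ _ hab
    · exact hGn _ hab
  have hu' : ∫ T in T₀..2 * T₀, ‖ψ' T * G T + ψ T * G' T‖ ≤
      (n + 1) * (K' / (T₀ * E) * (C * r) ^ n) := by
    have h1 : ∀ T ∈ Icc T₀ (2 * T₀), ‖ψ' T * G T + ψ T * G' T‖ ≤
        (n + 1) * (K' / (T₀ * E) * (C * r) ^ n) / T₀ := fun T hT => by
      refine (norm_add_le _ _).trans ?_
      rw [norm_mul, norm_mul]
      calc _ ≤ K' / (T₀ ^ 2 * E) * (C * r) ^ n + K' / (T₀ * E) * (n * ((C * r) ^ n / T₀)) := by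
            gcongr
            · exact hψ' T hT.1
            · exact hGn T hT.1
            · exact hψ T hT.1
            · exact hG'n T hT.1
        _ = _ := by field_simp; ring
    have h2 := integral_mono_on hab (ContinuousOn.intervalIntegrable (by
      rw [uIcc_of_le hab]; exact hcont.norm)) (_root_.intervalIntegrable_const (μ := volume)) h1
    refine h2.trans (le_of_eq ?_)
    rw [intervalIntegral.integral_const, smul_eq_mul]
    field_simp
    ring
  have hs2 : √(2 * T₀) ≤ 2 * √T₀ := by
    rw [Real.sqrt_le_left (by positivity), mul_pow, hsq]; linarith
  calc 32 * √(2 * T₀) * (‖ψ (2 * T₀) * G (2 * T₀)‖ +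
        ∫ T in T₀..2 * T₀, ‖ψ' T * G T + ψ T * G' T‖)
      ≤ 32 * (2 * √T₀) * (K' / (T₀ * E) * (C * r) ^ n +
        (n + 1) * (K' / (T₀ * E) * (C * r) ^ n)) := by
        refine mul_le_mul (by gcongr) (add_le_add hu hu') (add_nonneg (norm_nonneg _) ?_)
          (by positivity)
        exact intervalIntegral.integral_nonneg hab fun _ _ => norm_nonneg _
    _ = 64 * (n + 2) * K' * C ^ n * (r ^ n * (√T₀ / T₀)) / E := by
        rw [hCrn]; field_simp; ring
    _ = _ := by
        have : √T₀ / T₀ = r := by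
          rw [hr, div_eq_div_iff hT₀.ne' hsT.ne', ← pow_two, hsq, one_mul]
        rw [this, pow_succ]

end LatticeEllipsoid

namespace LatticeEllipsoid
open MeasureTheory Set intervalIntegral
open scoped Real Topology

/-! ### Smoothed lattice sums -/

/-- The normalised one-dimensional lattice sum with quadratic phase. -/
noncomputable def quadSum (I : Finset ℤ) (V : ℝ → ℝ) (y Λ S : ℝ) : ℂ :=
  (∑ k ∈ I, (V ((y + k) / Λ) : ℂ) * cexp2pi (S * ((y + k) / Λ) ^ 2)) / Λ

/-- The part of the dual sum with frequencies `|k| < N`. -/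
noncomputable def oscSum (B : ℝ) (V : ℝ → ℝ) (y Λ : ℝ) (N : ℕ) (S : ℝ) : ℂ :=
  ∑ k ∈ Finset.Ioo (-(N : ℤ)) N, osc B V S (k * Λ) * cexp2pi (k * y)

theorem continuous_quadSum {I : Finset ℤ} {V : ℝ → ℝ} {y Λ : ℝ} :
    Continuous (quadSum I V y Λ) := by
  unfold quadSum; fun_prop

theorem continuous_oscSum {B K : ℝ} {V V₁ V₂ : ℝ → ℝ} (h : IsAmplitude B K V V₁ V₂) (y Λ : ℝ)
    (N : ℕ) : Continuous (oscSum B V y Λ N) := by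
  unfold oscSum
  exact continuous_finsetSum _ fun k _ => (continuous_osc h _).mul continuous_const

theorem oscSum_one (B : ℝ) (V : ℝ → ℝ) (y Λ S : ℝ) : oscSum B V y Λ 1 S = osc B V S 0 := by
  have : Finset.Ioo (-((1 : ℕ) : ℤ)) ((1 : ℕ) : ℤ) = {0} := by decide
  rw [oscSum, this]; simp

theorem integral_one_add_rpow_le {X : ℝ} (hX : 0 ≤ X) :
    ∫ T in (0 : ℝ)..X, 1 / ((1 + T) * √(1 + T)) ≤ 2 := by
  have hpos : ∀ x ∈ uIcc 0 X, 0 < 1 + x := fun x hx => by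
    rw [uIcc_of_le hX] at hx; linarith [hx.1]
  have hd : ∀ x ∈ uIcc 0 X, HasDerivAt (fun T : ℝ => -2 / √(1 + T)) (1 / ((1 + x) * √(1 + x))) x :=
    fun x hx => by
    have h0 := hpos x hx
    have hs : 0 < √(1 + x) := Real.sqrt_pos.2 h0
    have h1 : HasDerivAt (fun T : ℝ => √(1 + T)) (1 / (2 * √(1 + x))) x := by
      simpa using ((hasDerivAt_id x).const_add 1).sqrt h0.ne'
    convert! (hasDerivAt_const x (-2 : ℝ)).div h1 hs.ne' using 1
    rw [Real.sq_sqrt h0.le]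
    field_simp
    ring
  rw [integral_eq_sub_of_hasDerivAt hd]
  · have : 0 ≤ 2 / √(1 + X) := by positivity
    simp only [add_zero, Real.sqrt_one, neg_div]
    linarith
  · refine ContinuousOn.intervalIntegrable (ContinuousOn.div (by fun_prop) (by fun_prop) ?_)
    intro x hx
    have h0 := hpos x hx
    positivity

variable {n : ℕ} {B K p : ℝ} {V V₁ V₂ : Fin n → ℝ → ℝ} {P y : Fin n → ℝ} {L : ℕ} {K' δ Λ : ℝ}
  {F : ℝ → ℝ} {ψ ψ' : ℝ → ℂ} {I : Finset ℤ}

/-- The trivial bound near `T = 0` and the Fresnel bound for large `T`, merged so that a single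
estimate is integrable from `0`. -/
theorem norm_osc_le_div_sqrt_one_add {V V₁ V₂ : ℝ → ℝ} (h : IsAmplitude B K V V₁ V₂) (hB : 0 < B)
    (hp : 0 < p) {q T : ℝ} (hq : p ≤ q) (hT : 0 ≤ T) (ξ : ℝ) :
    ‖osc B V (q * T) ξ‖ ≤ (4 * B ^ 2 * K + 8 * B * K / √p) / √(1 + T) := by
  have hK := h.nonneg hB
  rw [le_div_iff₀ (by positivity)]
  have hs : √(1 + T) ≤ 1 + √T := by
    rw [Real.sqrt_le_left (by positivity)]
    nlinarith [Real.sq_sqrt hT, Real.sqrt_nonneg T]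
  have h1 : ‖osc B V (q * T) ξ‖ * √T ≤ 8 * B * K / √p := by
    rcases hT.eq_or_lt with rfl | hT
    · simp; positivity
    · have hqT : 0 < q * T := mul_pos (hp.trans_le hq) hT
      have hsT : 0 < √T := Real.sqrt_pos.2 hT
      have hsp : 0 < √p := Real.sqrt_pos.2 hp
      have : √p * √T ≤ √(q * T) := by
        rw [← Real.sqrt_mul hp.le]
        exact Real.sqrt_le_sqrt (by gcongr)
      calc _ ≤ 8 * B * K / √(q * T) * √T := by
            gcongr; exact norm_osc_le_div_sqrt h hB hqT ξ
        _ ≤ 8 * B * K / (√p * √T) * √T := by gcongr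
        _ = _ := by field_simp
  calc _ ≤ ‖osc B V (q * T) ξ‖ * (1 + √T) := by gcongr
    _ = ‖osc B V (q * T) ξ‖ + ‖osc B V (q * T) ξ‖ * √T := by ring
    _ ≤ _ := add_le_add (norm_osc_le h hB _ _) h1

theorem IsCutoff.norm_le_div_one_add (hF : IsCutoff L K' δ F ψ ψ') (hδ : 0 ≤ δ) {T : ℝ}
    (hT : 0 ≤ T) : ‖ψ T‖ ≤ 2 * K' / (1 + T) := by
  rw [le_div_iff₀ (by positivity)]
  have h0 := hF.norm_le T
  have h1 : T * ‖ψ T‖ ≤ K' := by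
    rcases hT.eq_or_lt with rfl | hT
    · simpa using (norm_nonneg _).trans h0
    · refine le_trans ?_ (hF.norm_mul_le T hT)
      exact le_mul_of_one_le_right (by positivity) (one_le_pow₀ (by nlinarith))
  linarith

theorem norm_quadSum_sub_oscSum_le {V V₁ V₂ : ℝ → ℝ} (h : IsAmplitude B K V V₁ V₂) (hB : 0 < B)
    (hΛ : 0 < Λ) {S : ℝ} (hS : 0 ≤ S) (y : ℝ) {N : ℕ} (hN : 1 ≤ N) (hSN : 4 * S * B ≤ N * Λ)
    (hI : ∀ k : ℤ, k ∉ I → B * Λ ≤ |y + k|) :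
    ‖quadSum I V y Λ S - oscSum B V y Λ N S‖ ≤ 304 * K / (Λ ^ 2 * N) :=
  norm_lattice_sum_sub_le h hB hΛ hS y hN hSN hI

/-- The low frequencies. -/
theorem norm_integral_initial_le (hn : 2 ≤ n) (hB : 0 < B) (hp : 0 < p) (hP : ∀ i, p ≤ P i)
    (hV : ∀ i, IsAmplitude B K (V i) (V₁ i) (V₂ i)) (hF : IsCutoff L K' δ F ψ ψ') (hδ : 0 ≤ δ)
    (hΛ : 1 ≤ Λ) (hI : ∀ i, ∀ k : ℤ, k ∉ I → B * Λ ≤ |y i + k|) {c : ℝ} (hc : 0 < c) (hc1 : c ≤ 1)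
    (hcP : ∀ i, 4 * P i * B * c ≤ 1) :
    ‖∫ T in (0 : ℝ)..c * Λ, ψ T * cexp2pi (-T) * (∏ i, quadSum I (V i) (y i) Λ (P i * T) -
      ∏ i, osc B (V i) (P i * T) 0)‖ ≤
      4 * K' * (n * (304 * K) * (4 * B ^ 2 * K + 8 * B * K / √p + 608 * K) ^ (n - 1)) *
        (1 / Λ ^ 2) := by
  have hΛ0 : 0 < Λ := by linarith
  have hX : 0 ≤ c * Λ := by positivity
  have hK : 0 ≤ K := (hV ⟨0, by omega⟩).nonneg hB
  have hK' : 0 ≤ K' := (norm_nonneg _).trans (hF.norm_le 0)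
  set C₁ := 4 * B ^ 2 * K + 8 * B * K / √p with hC₁
  have hC1 : 0 ≤ C₁ := by positivity
  set D := C₁ + 608 * K with hD
  have hD0 : 0 ≤ D := by positivity
  set M := 2 * K' * (n * (304 * K) * D ^ (n - 1)) * (1 / Λ ^ 2) with hM
  have hM0 : 0 ≤ M := by positivity
  have hbound : ∀ T ∈ Ioc 0 (c * Λ), ‖ψ T * cexp2pi (-T) *
      (∏ i, quadSum I (V i) (y i) Λ (P i * T) - ∏ i, osc B (V i) (P i * T) 0)‖ ≤
      M * (1 / ((1 + T) * √(1 + T))) := by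
    intro T hT
    have hT0 : 0 ≤ T := hT.1.le
    have hs : 1 ≤ √(1 + T) := Real.one_le_sqrt.2 (by linarith)
    -- For `T ≤ cΛ` Poisson summation applies with `N = 1`, so only the zero frequency is kept and
    -- the whole difference is nonstationary error.
    have hdiff : ∀ i, ‖quadSum I (V i) (y i) Λ (P i * T) - osc B (V i) (P i * T) 0‖ ≤
        304 * K / Λ ^ 2 := fun i => by
      have hPi : 0 < P i := hp.trans_le (hP i)
      have h1 := norm_quadSum_sub_oscSum_le (hV i) hB hΛ0 (S := P i * T) (by positivity) (y i)
        le_rfl (by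
          push_cast
          calc 4 * (P i * T) * B ≤ 4 * (P i * (c * Λ)) * B := by gcongr; exact hT.2
            _ = 4 * P i * B * c * Λ := by ring
            _ ≤ 1 * Λ := by gcongr; exact hcP i) (hI i)
      rw [oscSum_one] at h1
      simpa using h1
    have hosc : ∀ i, ‖osc B (V i) (P i * T) 0‖ ≤ C₁ / √(1 + T) := fun i =>
      norm_osc_le_div_sqrt_one_add (hV i) hB hp (hP i) hT0 0
    have hsmall : 304 * K / Λ ^ 2 ≤ 608 * K / √(1 + T) := by
      rw [div_le_div_iff₀ (by positivity) (by positivity)]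
      have : √(1 + T) ≤ 2 * Λ ^ 2 := by
        rw [Real.sqrt_le_left (by positivity)]
        have : T ≤ Λ := hT.2.trans (by nlinarith)
        nlinarith [pow_le_pow_right₀ hΛ (by norm_num : 1 ≤ 4), one_le_pow₀ hΛ (n := 4)]
      nlinarith
    have hA : ∀ i, ‖osc B (V i) (P i * T) 0‖ ≤ D / √(1 + T) := fun i =>
      (hosc i).trans (by gcongr; rw [hD]; linarith)
    have hA' : ∀ i, ‖quadSum I (V i) (y i) Λ (P i * T)‖ ≤ D / √(1 + T) := fun i => by
      have h1 := norm_sub_norm_le (quadSum I (V i) (y i) Λ (P i * T)) (osc B (V i) (P i * T) 0)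
      rw [hD, add_div]
      linarith [hdiff i, hosc i]
    have hprod := norm_prod_sub_prod_le Finset.univ (A := D / √(1 + T)) (by positivity)
      (fun i _ => hA' i) (fun i _ => hA i) (fun i _ => hdiff i)
    rw [Finset.card_univ, Fintype.card_fin] at hprod
    -- One factor `1/√(1 + T)` out of `n - 1 ≥ 1` is enough: together with the `1/(1 + T)` from `ψ`
    -- it is integrable on the half-line.
    have hpow : (D / √(1 + T)) ^ (n - 1) ≤ D ^ (n - 1) * (1 / √(1 + T)) := by
      rw [div_pow, div_eq_mul_one_div]
      gcongr
      exact le_self_pow₀ hs (by omega)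
    rw [norm_mul, norm_mul, norm_cexp2pi, mul_one]
    calc _ ≤ 2 * K' / (1 + T) * (n * (304 * K / Λ ^ 2) * (D ^ (n - 1) * (1 / √(1 + T)))) := by
          gcongr
          · exact hF.norm_le_div_one_add hδ hT0
          · exact hprod.trans (by gcongr)
      _ = _ := by rw [hM]; field_simp
  have hint : IntervalIntegrable (fun T => M * (1 / ((1 + T) * √(1 + T)))) volume 0 (c * Λ) := by
    refine ContinuousOn.intervalIntegrable (continuousOn_const.mul
      (ContinuousOn.div (by fun_prop) (by fun_prop) ?_))
    intro x hx
    rw [uIcc_of_le hX] at hx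
    have : 0 < 1 + x := by linarith [hx.1]
    positivity
  refine (norm_integral_le_of_norm_le hX (Eventually.of_forall hbound) hint).trans ?_
  rw [intervalIntegral.integral_const_mul]
  calc _ ≤ M * 2 := by gcongr; exact integral_one_add_rpow_le hX
    _ = _ := by rw [hM]; ring

/-- One dyadic block of frequencies. -/
theorem norm_integral_dyadic_le (hn : 2 ≤ n) (hB : 0 < B) (hp : 0 < p) (hP : ∀ i, p ≤ P i)
    (hV : ∀ i, IsAmplitude B K (V i) (V₁ i) (V₂ i)) (hF : IsCutoff L K' δ F ψ ψ') (hδ : 0 ≤ δ)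
    (hΛ : 1 ≤ Λ) (hI : ∀ i, ∀ k : ℤ, k ∉ I → B * Λ ≤ |y i + k|) {T₀ κ : ℝ} (hT₀ : 0 < T₀)
    (hκ : 0 ≤ κ) {N : ℕ} (hN : 1 ≤ N) (hNP : ∀ i, 8 * P i * B * T₀ ≤ N * Λ) (hNκ : N * Λ ≤ κ * T₀)
    (hTN : T₀ ≤ (Λ * N) ^ 2) :
    ‖∫ T in T₀..2 * T₀, ψ T * cexp2pi (-T) * (∏ i, quadSum I (V i) (y i) Λ (P i * T) -
      ∏ i, osc B (V i) (P i * T) 0)‖ ≤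
      (K' * (n * (304 * K) * (8 * B * K / √p + 304 * K) ^ (n - 1)) +
        2 * (64 * (n + 2) * K' * (K / √p * (18 * B + κ / p)) ^ n)) *
      ((2 * N) ^ n * (1 / √T₀) ^ (n + 1) / (1 + δ * T₀) ^ L) := by
  have hΛ0 : 0 < Λ := by linarith
  have hab : T₀ ≤ 2 * T₀ := by linarith
  have hsT : 0 < √T₀ := Real.sqrt_pos.2 hT₀
  have hsp : 0 < √p := Real.sqrt_pos.2 hp
  have hK : 0 ≤ K := (hV ⟨0, by omega⟩).nonneg hB
  have hK' : 0 ≤ K' := (norm_nonneg _).trans (hF.norm_le 0)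
  have hN1 : (1 : ℝ) ≤ N := by exact_mod_cast hN
  set r := 1 / √T₀ with hr
  have hr0 : 0 < r := by positivity
  have hrN : 1 / (Λ * N) ≤ r := by
    rw [hr]
    apply one_div_le_one_div_of_le hsT
    rw [Real.sqrt_le_left (by positivity)]
    exact hTN
  set E := (1 + δ * T₀) ^ L with hE
  have hE0 : 0 < E := by positivity
  set C₁ := 8 * B * K / √p with hC₁
  have hC1 : 0 ≤ C₁ := by positivity
  set D := C₁ + 304 * K with hD
  have hD0 : 0 ≤ D := by positivity
  set M := 64 * (n + 2) * K' * (K / √p * (18 * B + κ / p)) ^ n with hM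
  have hM0 : 0 ≤ M := by positivity
  set Q : ℝ → ℂ := fun T => ∏ i, quadSum I (V i) (y i) Λ (P i * T)
  set R : ℝ → ℂ := fun T => ∏ i, oscSum B (V i) (y i) Λ N (P i * T)
  set O : ℝ → ℂ := fun T => ∏ i, osc B (V i) (P i * T) 0
  have cψ := hF.continuous_amp
  have cQ : Continuous Q := continuous_finsetProd _ fun i _ =>
    continuous_quadSum.comp (by fun_prop)
  have cR : Continuous R := continuous_finsetProd _ fun i _ =>
    (continuous_oscSum (hV i) _ _ _).comp (by fun_prop)
  have cosc : ∀ i ξ, Continuous fun T => osc B (V i) (P i * T) ξ := fun i ξ =>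
    (continuous_osc (hV i) ξ).comp (by fun_prop : Continuous fun T => P i * T)
  have cO : Continuous O := continuous_finsetProd _ fun i _ => cosc i 0
  have hcard : ((Finset.Ioo (-(N : ℤ)) N).card : ℝ) ≤ 2 * N := by
    rw [Int.card_Ioo]
    have : ((N : ℤ) - -(N : ℤ) - 1).toNat ≤ 2 * N := by omega
    exact_mod_cast this
  -- far frequencies
  have hfar : ‖∫ T in T₀..2 * T₀, ψ T * cexp2pi (-T) * (Q T - R T)‖ ≤
      K' * (n * (304 * K) * D ^ (n - 1)) * ((2 * N) ^ n * r ^ (n + 1) / E) := by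
    have hb : ∀ T ∈ uIoc T₀ (2 * T₀), ‖ψ T * cexp2pi (-T) * (Q T - R T)‖ ≤
        K' / (T₀ * E) * (n * (304 * K / (Λ ^ 2 * N)) * (D * (2 * N * r)) ^ (n - 1)) := by
      intro T hT
      rw [uIoc_of_le hab] at hT
      have hT0 : 0 < T := hT₀.trans hT.1
      have hψ : ‖ψ T‖ ≤ K' / (T₀ * E) := by
        rw [le_div_iff₀ (by positivity)]
        refine le_trans ?_ (hF.norm_mul_le T hT0)
        calc ‖ψ T‖ * (T₀ * E) = T₀ * ‖ψ T‖ * E := by ring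
          _ ≤ T * ‖ψ T‖ * (1 + δ * T) ^ L := by
            rw [hE]
            have := hT.1.le
            gcongr
      have hdiff : ∀ i, ‖quadSum I (V i) (y i) Λ (P i * T) - oscSum B (V i) (y i) Λ N (P i * T)‖ ≤
          304 * K / (Λ ^ 2 * N) := fun i => by
        have hPi : 0 < P i := hp.trans_le (hP i)
        refine norm_quadSum_sub_oscSum_le (hV i) hB hΛ0 (by positivity) (y i) hN ?_ (hI i)
        calc 4 * (P i * T) * B ≤ 4 * (P i * (2 * T₀)) * B := by gcongr; exact hT.2
          _ = 8 * P i * B * T₀ := by ring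
          _ ≤ _ := hNP i
      have hosc : ∀ i ξ, ‖osc B (V i) (P i * T) ξ‖ ≤ C₁ * r := fun i ξ => by
        have hPi : 0 < P i := hp.trans_le (hP i)
        refine (norm_osc_le_div_sqrt (hV i) hB (by positivity) ξ).trans ?_
        have : √p * √T₀ ≤ √(P i * T) := by
          rw [← Real.sqrt_mul hp.le]
          exact Real.sqrt_le_sqrt (mul_le_mul (hP i) hT.1.le hT₀.le hPi.le)
        calc 8 * B * K / √(P i * T) ≤ 8 * B * K / (√p * √T₀) := by gcongr
          _ = _ := by rw [hC₁, hr]; field_simp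
      have hsum : ∀ i, ‖oscSum B (V i) (y i) Λ N (P i * T)‖ ≤ C₁ * (2 * N * r) := fun i => by
        rw [oscSum]
        refine (norm_sum_le _ _).trans ?_
        refine (Finset.sum_le_card_nsmul _ _ (C₁ * r) fun k _ => ?_).trans ?_
        · rw [norm_mul, norm_cexp2pi, mul_one]; exact hosc i _
        · rw [nsmul_eq_mul]
          calc _ ≤ 2 * N * (C₁ * r) := by gcongr
            _ = _ := by ring
      have hsmall : 304 * K / (Λ ^ 2 * N) ≤ 304 * K * (2 * N * r) := by
        rw [div_eq_mul_one_div]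
        gcongr
        calc 1 / (Λ ^ 2 * N) ≤ 1 / (Λ * N) := by
              apply one_div_le_one_div_of_le (by positivity)
              gcongr
              nlinarith
          _ ≤ r := hrN
          _ ≤ 2 * N * r := by nlinarith
      have hA : ∀ i, ‖oscSum B (V i) (y i) Λ N (P i * T)‖ ≤ D * (2 * N * r) := fun i =>
        (hsum i).trans (by gcongr; rw [hD]; linarith)
      have hA' : ∀ i, ‖quadSum I (V i) (y i) Λ (P i * T)‖ ≤ D * (2 * N * r) := fun i => by
        have h1 := norm_sub_norm_le (quadSum I (V i) (y i) Λ (P i * T))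
          (oscSum B (V i) (y i) Λ N (P i * T))
        rw [hD, add_mul]
        linarith [hdiff i, hsum i]
      have hprod := norm_prod_sub_prod_le Finset.univ (A := D * (2 * N * r)) (by positivity)
        (fun i _ => hA' i) (fun i _ => hA i) (fun i _ => hdiff i)
      rw [Finset.card_univ, Fintype.card_fin] at hprod
      rw [norm_mul, norm_mul, norm_cexp2pi, mul_one]
      gcongr
    refine (norm_integral_le_of_norm_le_const hb).trans ?_
    rw [abs_of_pos (by linarith : 0 < 2 * T₀ - T₀)]
    -- Since `T₀ ≤ (ΛN)²`, the Poisson error is worth two powers of `r` and one of `N`. With `n - 1`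
    -- further factors `N r` this matches the size of the near frequencies.
    have h1 : 1 / (Λ ^ 2 * N) ≤ 2 * N * r ^ 2 := by
      have : (1 / (Λ * N)) ^ 2 ≤ r ^ 2 := by gcongr
      calc 1 / (Λ ^ 2 * N) = N * (1 / (Λ * N)) ^ 2 := by field_simp
        _ ≤ N * r ^ 2 := by gcongr
        _ ≤ _ := by nlinarith [sq_nonneg r]
    obtain ⟨m, rfl⟩ : ∃ m, n = m + 1 := ⟨n - 1, by omega⟩
    rw [Nat.add_sub_cancel]
    calc K' / (T₀ * E) * (↑(m + 1) * (304 * K / (Λ ^ 2 * N)) * (D * (2 * N * r)) ^ m) *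
          (2 * T₀ - T₀) = K' / E * (↑(m + 1) * (304 * K * (1 / (Λ ^ 2 * N))) *
            (D * (2 * N * r)) ^ m) := by field_simp; ring
      _ ≤ K' / E * (↑(m + 1) * (304 * K * (2 * N * r ^ 2)) * (D * (2 * N * r)) ^ m) := by gcongr
      _ = _ := by
        rw [mul_pow, mul_pow (2 * (N : ℝ)), pow_succ (2 * (N : ℝ)), pow_add r, pow_add r]
        field_simp
  -- near frequencies
  have hone : ∀ ξ : Fin n → ℝ, (∀ i, |ξ i| ≤ N * Λ) →
      ‖∫ T in T₀..2 * T₀, ψ T * cexp2pi (-T) * ∏ i, osc B (V i) (P i * T) (ξ i)‖ ≤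
        M * (r ^ (n + 1) / E) := fun ξ hξ => by
    rw [← mul_div_assoc]
    exact norm_integral_block_le hB hp hP hV hF hδ hT₀ hK hκ fun i => (hξ i).trans hNκ
  have hnear : ‖∫ T in T₀..2 * T₀, ψ T * cexp2pi (-T) * R T‖ ≤
      M * ((2 * N) ^ n * r ^ (n + 1) / E) := by
    -- Expanding the product gives at most `(2N)ⁿ` frequency vectors, each handled by the block
    -- estimate.
    have e : ∀ T, ψ T * cexp2pi (-T) * R T =
        ∑ k ∈ Fintype.piFinset (fun _ : Fin n => Finset.Ioo (-(N : ℤ)) N),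
          (∏ i, cexp2pi (k i * y i)) *
            (ψ T * cexp2pi (-T) * ∏ i, osc B (V i) (P i * T) (k i * Λ)) := fun T => by
      simp only [R, oscSum]
      rw [Finset.prod_univ_sum, Finset.mul_sum]
      refine Finset.sum_congr rfl fun k _ => ?_
      rw [Finset.prod_mul_distrib]
      ring
    simp_rw [e]
    rw [intervalIntegral.integral_finsetSum (fun k _ => Continuous.intervalIntegrable (by
      refine continuous_const.mul ((by fun_prop : Continuous fun T => ψ T * cexp2pi (-T)).mul
        (continuous_finsetProd _ fun i _ => cosc i _))) _ _)]
    refine (norm_sum_le _ _).trans ?_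
    refine (Finset.sum_le_card_nsmul _ _ (M * (r ^ (n + 1) / E)) fun k hk => ?_).trans ?_
    · rw [intervalIntegral.integral_const_mul, norm_mul, norm_prod]
      simp only [norm_cexp2pi, Finset.prod_const_one, one_mul]
      refine hone (fun i => k i * Λ) fun i => ?_
      have := Finset.mem_Ioo.1 (Fintype.mem_piFinset.1 hk i)
      have h2 : |(k i : ℝ)| ≤ N := by
        rw [abs_le]
        constructor
        · exact_mod_cast this.1.le
        · exact_mod_cast this.2.le
      rw [abs_mul, abs_of_pos hΛ0]
      gcongr
    · rw [nsmul_eq_mul, Fintype.card_piFinset]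
      simp only [Finset.prod_const, Finset.card_univ, Fintype.card_fin]
      push_cast
      calc _ ≤ (2 * (N : ℝ)) ^ n * (M * (r ^ (n + 1) / E)) := by gcongr
        _ = _ := by ring
  -- On such a block the main term is itself no larger than the bound for one frequency vector, so
  -- it need not be cancelled against the zero vector in `R`.
  have hzero : ‖∫ T in T₀..2 * T₀, ψ T * cexp2pi (-T) * O T‖ ≤
      M * ((2 * N) ^ n * r ^ (n + 1) / E) := by
    refine (hone (fun _ => 0) fun i => by simp; positivity).trans ?_
    rw [mul_div_assoc]
    gcongr
    exact le_mul_of_one_le_left (by positivity) (one_le_pow₀ (by linarith))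
  have esplit : ∫ T in T₀..2 * T₀, ψ T * cexp2pi (-T) * (Q T - O T) =
      (∫ T in T₀..2 * T₀, ψ T * cexp2pi (-T) * (Q T - R T)) +
      (∫ T in T₀..2 * T₀, ψ T * cexp2pi (-T) * R T) -
      ∫ T in T₀..2 * T₀, ψ T * cexp2pi (-T) * O T := by
    rw [← intervalIntegral.integral_add ((by fun_prop : Continuous _).intervalIntegrable _ _)
      ((by fun_prop : Continuous _).intervalIntegrable _ _), ← intervalIntegral.integral_sub
      ((by fun_prop : Continuous _).intervalIntegrable _ _)
      ((by fun_prop : Continuous _).intervalIntegrable _ _)]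
    congr 1
    ext T
    ring
  change ‖∫ T in T₀..2 * T₀, ψ T * cexp2pi (-T) * (Q T - O T)‖ ≤ _
  rw [esplit]
  refine (norm_sub_le _ _).trans ?_
  refine (add_le_add (norm_add_le _ _) le_rfl).trans ?_
  linarith

end LatticeEllipsoid

/-! ### Summation over dyadic blocks, and the frequency integrals as lattice sums and as integrals
-/

namespace LatticeEllipsoid
open MeasureTheory Set
open scoped Real Topology

variable {n : ℕ} {B K p : ℝ} {V V₁ V₂ : Fin n → ℝ → ℝ} {P y : Fin n → ℝ} {L : ℕ} {K' δ Λ : ℝ}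
  {F : ℝ → ℝ} {ψ ψ' : ℝ → ℂ} {I : Finset ℤ}

theorem integrable_mul_prod_osc (hB : 0 < B) (hV : ∀ i, IsAmplitude B K (V i) (V₁ i) (V₂ i))
    (hF : IsCutoff L K' δ F ψ ψ') :
    Integrable fun T => ψ T * cexp2pi (-T) * ∏ i, osc B (V i) (P i * T) 0 := by
  have hc : Continuous fun T => ∏ i, osc B (V i) (P i * T) 0 :=
    continuous_finsetProd _ fun i _ => (continuous_osc (hV i) 0).comp (by fun_prop)
  have h1 : Integrable fun T => ψ T * cexp2pi (-T) :=
    hF.integrable.mul_bdd (c := 1) (by fun_prop : Continuous _).aestronglyMeasurable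
      (Eventually.of_forall fun T => by simp)
  refine h1.mul_bdd (c := ∏ _i : Fin n, 4 * B ^ 2 * K) hc.aestronglyMeasurable
    (Eventually.of_forall fun T => ?_)
  rw [norm_prod]
  exact Finset.prod_le_prod (fun _ _ => norm_nonneg _) fun i _ => norm_osc_le (hV i) hB _ _

theorem integrable_mul_prod_quadSum (hF : IsCutoff L K' δ F ψ ψ') :
    Integrable fun T => ψ T * cexp2pi (-T) * ∏ i, quadSum I (V i) (y i) Λ (P i * T) := by
  have hc : Continuous fun T => ∏ i, quadSum I (V i) (y i) Λ (P i * T) :=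
    continuous_finsetProd _ fun i _ => continuous_quadSum.comp (by fun_prop)
  have h1 : Integrable fun T => ψ T * cexp2pi (-T) :=
    hF.integrable.mul_bdd (c := 1) (by fun_prop : Continuous _).aestronglyMeasurable
      (Eventually.of_forall fun T => by simp)
  refine h1.mul_bdd (c := ∏ i : Fin n, (∑ k ∈ I, |V i ((y i + k) / Λ)|) / |Λ|)
    hc.aestronglyMeasurable (Eventually.of_forall fun T => ?_)
  rw [norm_prod]
  refine Finset.prod_le_prod (fun _ _ => norm_nonneg _) fun i _ => ?_
  rw [quadSum, norm_div, Complex.norm_real, Real.norm_eq_abs]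
  gcongr
  refine (norm_sum_le _ _).trans (le_of_eq (Finset.sum_congr rfl fun k _ => ?_))
  simp

/-- The frequency side of the comparison between a smoothed lattice sum and the corresponding
integral. -/
theorem exists_norm_integral_error_le (hn : 2 ≤ n) (hB : 0 < B) (hK : 0 ≤ K)
    (hP : ∀ i, 0 < P i) (K' : ℝ) (hK' : 0 ≤ K') :
    ∃ C, 0 ≤ C ∧ ∀ (y : Fin n → ℝ) (V V₁ V₂ : Fin n → ℝ → ℝ) (δ : ℝ) (F : ℝ → ℝ) (ψ ψ' : ℝ → ℂ)
      (Λ : ℝ) (I : Finset ℤ), (∀ i, IsAmplitude B K (V i) (V₁ i) (V₂ i)) →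
      IsCutoff n K' δ F ψ ψ' → 0 < δ → 1 ≤ Λ → (∀ i, ∀ k : ℤ, k ∉ I → B * Λ ≤ |y i + k|) →
      ‖∫ T in Ioi (0 : ℝ), ψ T * cexp2pi (-T) * (∏ i, quadSum I (V i) (y i) Λ (P i * T) -
        ∏ i, osc B (V i) (P i * T) 0)‖ ≤
        C * (1 / Λ ^ 2 + (1 / √Λ) ^ (n + 1) / √(δ * Λ) ^ (n - 1)) := by
  have : Nonempty (Fin n) := ⟨⟨0, by omega⟩⟩
  obtain ⟨i₀, hi₀⟩ := Finite.exists_min P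
  obtain ⟨i₁, hi₁⟩ := Finite.exists_max P
  set p := P i₀
  have hp : 0 < p := hP i₀
  -- With this `c` no nonzero frequency is stationary for `T ≤ cΛ` in any coordinate; the range
  -- beyond is cut dyadically.
  set c := min 1 (1 / (4 * P i₁ * B)) with hc
  have hi1 := hP i₁
  have hc0 : 0 < c := lt_min one_pos (by positivity)
  have hc1 : c ≤ 1 := min_le_left _ _
  have hcP : ∀ i, 4 * P i * B * c ≤ 1 := fun i => by
    calc 4 * P i * B * c ≤ 4 * P i₁ * B * (1 / (4 * P i₁ * B)) := by
          gcongr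
          · exact hi₁ i
          · exact min_le_right _ _
      _ = 1 := by field_simp
  have hsc : 0 < √c := Real.sqrt_pos.2 hc0
  have hsp : 0 < √p := Real.sqrt_pos.2 hp
  set C₁ := 4 * K' * (n * (304 * K) * (4 * B ^ 2 * K + 8 * B * K / √p + 608 * K) ^ (n - 1))
  set C₂ := K' * (n * (304 * K) * (8 * B * K / √p + 304 * K) ^ (n - 1)) +
        2 * (64 * (n + 2) * K' * (K / √p * (18 * B + 2 / c / p)) ^ n)
  have hC1 : 0 ≤ C₁ := by positivity
  have hC2 : 0 ≤ C₂ := by positivity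
  set C₃ := C₂ * 4 ^ n * (1 / √c) ^ (n + 1) * 20 / √c ^ (n - 1) with hC₃
  have hC3 : 0 ≤ C₃ := by positivity
  refine ⟨max C₁ C₃, hC1.trans (le_max_left _ _),
    fun y V V₁ V₂ δ F ψ ψ' Λ I hV hF hδ hΛ hI => ?_⟩
  have hΛ0 : 0 < Λ := by linarith
  have hsΛ : 0 < √Λ := Real.sqrt_pos.2 hΛ0
  set G : ℝ → ℂ := fun T => ψ T * cexp2pi (-T) * (∏ i, quadSum I (V i) (y i) Λ (P i * T) -
        ∏ i, osc B (V i) (P i * T) 0) with hG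
  have hGi : Integrable G := by
    have := (integrable_mul_prod_quadSum (V := V) (P := P) (y := y) (Λ := Λ) (I := I) hF).sub
      (integrable_mul_prod_osc (P := P) hB hV hF)
    refine this.congr (Eventually.of_forall fun T => ?_)
    simp only [hG, Pi.sub_apply]
    ring
  set S := (1 / √Λ) ^ (n + 1) / √(δ * Λ) ^ (n - 1) with hS
  have hS0 : 0 ≤ S := by positivity
  set x := √(δ * (c * Λ)) with hx
  have hx0 : 0 < x := Real.sqrt_pos.2 (by positivity)
  have hx2 : x ^ 2 = δ * (c * Λ) := Real.sq_sqrt (by positivity)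
  have hblock : ∀ j : ℕ, ‖∫ T in c * Λ * 2 ^ j..c * Λ * 2 ^ (j + 1), G T‖ ≤
      C₂ * (4 ^ n * (1 / (√c * √Λ)) ^ (n + 1)) *
        ((√2 ^ j) ^ (n - 1) / (1 + x ^ 2 * 2 ^ j) ^ n) := fun j => by
    have hT : 0 < c * Λ * 2 ^ j := by positivity
    have h2 : (1 : ℝ) ≤ 2 ^ j := one_le_pow₀ (by norm_num)
    -- For `T₀ = cΛ 2^j` the choice `N = 2^(j+1)` covers the stationary range, and `NΛ = (2/c) T₀`
    -- gives `κ = 2/c`, independent of `j`.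
    have h := norm_integral_dyadic_le hn hB hp hi₀ hV hF hδ.le hΛ hI hT
      (by positivity : 0 ≤ 2 / c) (N := 2 ^ (j + 1)) Nat.one_le_two_pow (fun i => by
        push_cast
        calc 8 * P i * B * (c * Λ * 2 ^ j) = (4 * P i * B * c) * (2 ^ (j + 1) * Λ) := by ring
          _ ≤ 1 * (2 ^ (j + 1) * Λ) := by gcongr; exact hcP i
          _ = _ := one_mul _) (le_of_eq (by push_cast; field_simp; ring)) (by
        push_cast
        have h3 : (1 : ℝ) ≤ 2 ^ (j + 1) := one_le_pow₀ (by norm_num)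
        calc c * Λ * 2 ^ j ≤ 1 * Λ * 2 ^ (j + 1) := by
              gcongr
              · norm_num
              · omega
          _ = Λ * 2 ^ (j + 1) := by ring
          _ ≤ (Λ * 2 ^ (j + 1)) ^ 2 := le_self_pow₀ (by nlinarith) (by norm_num))
    have e1 : 2 * (c * Λ * 2 ^ j) = c * Λ * 2 ^ (j + 1) := by ring
    rw [e1] at h
    refine h.trans (le_of_eq ?_)
    have hs2 : (0 : ℝ) < √2 := Real.sqrt_pos.2 (by norm_num)
    have e22 : ((√2 : ℝ) ^ j) ^ 2 = 2 ^ j := by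
      rw [← pow_mul, mul_comm, pow_mul, Real.sq_sqrt (by norm_num)]
    have e2 : √(c * Λ * 2 ^ j) = √c * √Λ * √2 ^ j := by
      have : c * Λ * 2 ^ j = (√c * √Λ * √2 ^ j) ^ 2 := by
        rw [mul_pow, mul_pow, e22, Real.sq_sqrt hc0.le, Real.sq_sqrt hΛ0.le]
      rw [this, Real.sqrt_sq (by positivity)]
    have e3 : δ * (c * Λ * 2 ^ j) = x ^ 2 * 2 ^ j := by rw [hx2]; ring
    rw [mul_assoc C₂]
    congr 1
    rw [e2, e3]
    push_cast
    have e4 : (2 * 2 ^ (j + 1) : ℝ) = 4 * (√2 ^ j) ^ 2 := by rw [e22]; ring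
    obtain ⟨m, rfl⟩ : ∃ m, n = m + 1 := ⟨n - 1, by omega⟩
    rw [e4, Nat.add_sub_cancel]
    set z := √2 ^ j
    have hz : 0 < z := by positivity
    -- With `z = √2^j`, the count grows like `z^(2n)` and the decay is `z^(-(n+1))`; the net growth
    -- is `z^(n-1)`.
    have e5 : (4 * z ^ 2) ^ (m + 1) * (1 / (√c * √Λ * z)) ^ (m + 1 + 1) =
        4 ^ (m + 1) * (1 / (√c * √Λ)) ^ (m + 1 + 1) * z ^ m := by
      have e6 : (z ^ 2) ^ (m + 1) = z ^ m * z ^ (m + 1 + 1) := by ring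
      rw [mul_pow, e6, ← one_div_mul_one_div (√c * √Λ), mul_pow, one_div_pow z]
      field_simp
    rw [e5, mul_div_assoc]
  have hpart : ∀ J : ℕ, ‖∫ T in (0 : ℝ)..c * Λ * 2 ^ J, G T‖ ≤ C₁ * (1 / Λ ^ 2) +
      C₂ * (4 ^ n * (1 / (√c * √Λ)) ^ (n + 1)) *
        ∑ j ∈ Finset.range J, (√2 ^ j) ^ (n - 1) / (1 + x ^ 2 * 2 ^ j) ^ n := by
    intro J
    induction J with
    | zero =>
      simpa using norm_integral_initial_le hn hB hp hi₀ hV hF hδ.le hΛ hI hc0 hc1 hcP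
    | succ J ih =>
      rw [← intervalIntegral.integral_add_adjacent_intervals (b := c * Λ * 2 ^ J) hGi.intervalIntegrable
        hGi.intervalIntegrable, Finset.sum_range_succ, mul_add, ← add_assoc]
      exact (norm_add_le _ _).trans (add_le_add ih (hblock J))
  have htend : Tendsto (fun J : ℕ => c * Λ * (2 : ℝ) ^ J) atTop atTop :=
    (tendsto_pow_atTop_atTop_of_one_lt one_lt_two).const_mul_atTop (by positivity)
  have hlim := (intervalIntegral_tendsto_integral_Ioi 0 hGi.integrableOn htend).norm
  refine le_of_tendsto hlim (Eventually.of_forall fun J => ?_)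
  refine (hpart J).trans ?_
  have hsum := sum_dyadic_le hn hx0 J
  have hxs : x = √c * √(δ * Λ) := by
    rw [hx, ← Real.sqrt_mul hc0.le]; congr 1; ring
  have h3 : C₂ * (4 ^ n * (1 / (√c * √Λ)) ^ (n + 1)) *
        ∑ j ∈ Finset.range J, (√2 ^ j) ^ (n - 1) / (1 + x ^ 2 * 2 ^ j) ^ n ≤ C₃ * S := by
    refine (mul_le_mul_of_nonneg_left hsum (by positivity)).trans (le_of_eq ?_)
    rw [hC₃, hS, hxs, mul_pow, ← one_div_mul_one_div √c, mul_pow (1 / √c)]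
    field_simp
  calc _ ≤ C₁ * (1 / Λ ^ 2) + C₃ * S := by linarith
    _ ≤ max C₁ C₃ * (1 / Λ ^ 2) + max C₁ C₃ * S := by
        gcongr
        · exact le_max_left _ _
        · exact le_max_right _ _
    _ = _ := by ring

/-- A smoothed lattice sum as a frequency integral. -/
theorem sum_mul_cutoff_eq (hF : IsCutoff L K' δ F ψ ψ') (hΛ : Λ ≠ 0) :
    ∑ k ∈ Fintype.piFinset (fun _ : Fin n => I), (∏ i, V i ((y i + k i) / Λ)) *
      F (∑ i, P i * ((y i + k i) / Λ) ^ 2) =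
    Λ ^ n * (2 * (∫ T in Ioi (0 : ℝ), ψ T * cexp2pi (-T) *
      ∏ i, quadSum I (V i) (y i) Λ (P i * T)).re) := by
  have hΛ' : (Λ : ℂ) ≠ 0 := by exact_mod_cast hΛ
  have e : ∀ T, ψ T * cexp2pi (-T) * ∏ i, quadSum I (V i) (y i) Λ (P i * T) =
      ((Λ ^ n)⁻¹ : ℝ) * ∑ k ∈ Fintype.piFinset (fun _ : Fin n => I),
        ((∏ i, V i ((y i + k i) / Λ) : ℝ) : ℂ) *
          (ψ T * cexp2pi (T * (∑ i, P i * ((y i + k i) / Λ) ^ 2 - 1))) := fun T => by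
    simp only [quadSum]
    rw [Finset.prod_div_distrib, Finset.prod_univ_sum, Finset.prod_const, Finset.card_univ,
      Fintype.card_fin, div_eq_inv_mul, mul_left_comm, Finset.mul_sum]
    push_cast
    congr 1
    refine Finset.sum_congr rfl fun k _ => ?_
    have : cexp2pi (T * (∑ i, P i * ((y i + k i) / Λ) ^ 2 - 1)) =
        cexp2pi (-T) * ∏ i, cexp2pi (P i * T * ((y i + k i) / Λ) ^ 2) := by
      rw [← cexp2pi_sum, ← cexp2pi_add]
      congr 1
      rw [mul_sub, Finset.mul_sum]
      rw [Finset.sum_congr rfl fun i _ => (by ring : T * (P i * ((y i + k i) / Λ) ^ 2) =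
        P i * T * ((y i + k i) / Λ) ^ 2)]
      ring
    rw [this, Finset.prod_mul_distrib]
    ring
  simp_rw [e]
  have hi : ∀ s : ℝ, Integrable (fun T => ψ T * cexp2pi (T * s)) (volume.restrict (Ioi 0)) :=
    fun s => (hF.integrable.mul_bdd (c := 1) (by fun_prop : Continuous _).aestronglyMeasurable
      (Eventually.of_forall fun T => by simp)).integrableOn
  rw [integral_const_mul, integral_finsetSum _ fun k _ => (hi _).const_mul _,
    Complex.re_ofReal_mul, Complex.re_sum]
  rw [mul_left_comm 2, ← mul_assoc, mul_inv_cancel₀ (pow_ne_zero n hΛ), one_mul, Finset.mul_sum]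
  refine Finset.sum_congr rfl fun k _ => ?_
  rw [hF.eq_integral, integral_const_mul, Complex.re_ofReal_mul]
  ring

theorem osc_zero_eq_integral {V V₁ V₂ : ℝ → ℝ} (h : IsAmplitude B K V V₁ V₂) (hB : 0 < B) (S : ℝ) :
    osc B V S 0 = ∫ u, (V u : ℂ) * cexp2pi (S * u ^ 2) := by
  simp only [osc, zero_mul, sub_zero]
  rw [intervalIntegral.integral_of_le (by linarith), setIntegral_eq_integral_of_forall_compl_eq_zero]
  intro u hu
  have : B ≤ |u| := by
    by_contra hc
    have := abs_lt.1 (not_le.1 hc)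
    exact hu ⟨this.1, this.2.le⟩
  rw [h.eq_zero u this]
  simp

theorem IsAmplitude.integrable {V V₁ V₂ : ℝ → ℝ} (h : IsAmplitude B K V V₁ V₂) :
    Integrable V := by
  refine h.continuous.integrable_of_hasCompactSupport
    (HasCompactSupport.intro (isCompact_Icc (a := -B) (b := B)) fun x hx => h.eq_zero x ?_)
  by_contra hc
  have := abs_lt.1 (not_le.1 hc)
  exact hx ⟨this.1.le, this.2.le⟩

/-- The main term as a frequency integral. -/
theorem integral_mul_cutoff_eq (hB : 0 < B) (hV : ∀ i, IsAmplitude B K (V i) (V₁ i) (V₂ i))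
    (hF : IsCutoff L K' δ F ψ ψ') :
    ∫ u : Fin n → ℝ, (∏ i, V i (u i)) * F (∑ i, P i * u i ^ 2) =
      2 * (∫ T in Ioi (0 : ℝ), ψ T * cexp2pi (-T) * ∏ i, osc B (V i) (P i * T) 0).re := by
  have hVi : Integrable fun u : Fin n → ℝ => ((∏ i, V i (u i) : ℝ) : ℂ) :=
    (Integrable.fintype_prod fun i => (hV i).integrable).ofReal
  have cV : ∀ i, Continuous (V i) := fun i => (hV i).continuous
  set H : ℝ → (Fin n → ℝ) → ℂ := fun T u => ψ T * ((∏ i, V i (u i) : ℝ) : ℂ) *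
    cexp2pi (T * (∑ i, P i * u i ^ 2 - 1)) with hH
  -- Fubini is legitimate because `ψ` and the compactly supported weights are integrable and the
  -- remaining factor is unimodular.
  have hHi : Integrable (Function.uncurry H) ((volume.restrict (Ioi 0)).prod volume) := by
    have h1 : Integrable (fun z : ℝ × (Fin n → ℝ) => ψ z.1 * ((∏ i, V i (z.2 i) : ℝ) : ℂ))
        ((volume.restrict (Ioi 0)).prod volume) := (hF.integrable.integrableOn).mul_prod hVi
    refine h1.mul_bdd (c := 1) (by fun_prop : Continuous _).aestronglyMeasurable
      (Eventually.of_forall fun z => by simp)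
  have e : ∀ T, ψ T * cexp2pi (-T) * ∏ i, osc B (V i) (P i * T) 0 = ∫ u, H T u := fun T => by
    rw [Finset.prod_congr rfl fun i _ => osc_zero_eq_integral (hV i) hB (P i * T),
      ← integral_fintype_prod_volume_eq_prod, ← integral_const_mul]
    refine integral_congr_ae (Eventually.of_forall fun u => ?_)
    simp only [hH]
    have : cexp2pi (T * (∑ i, P i * u i ^ 2 - 1)) =
        cexp2pi (-T) * ∏ i, cexp2pi (P i * T * u i ^ 2) := by
      rw [← cexp2pi_sum, ← cexp2pi_add]
      congr 1
      rw [mul_sub, Finset.mul_sum]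
      rw [Finset.sum_congr rfl fun i _ => (by ring : T * (P i * u i ^ 2) = P i * T * u i ^ 2)]
      ring
    rw [this, Finset.prod_mul_distrib]
    push_cast
    ring
  simp_rw [e]
  rw [integral_integral_swap hHi]
  have hre : (∫ u, ∫ T in Ioi (0 : ℝ), H T u).re = ∫ u, (∫ T in Ioi (0 : ℝ), H T u).re := by
    have := integral_re (𝕜 := ℂ) hHi.integral_prod_right
    simpa using! this.symm
  rw [hre, ← integral_const_mul]
  refine integral_congr_ae (Eventually.of_forall fun u => ?_)
  have h2 : ∫ T in Ioi (0 : ℝ), H T u = ((∏ i, V i (u i) : ℝ) : ℂ) *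
      ∫ T in Ioi (0 : ℝ), ψ T * cexp2pi (T * (∑ i, P i * u i ^ 2 - 1)) := by
    rw [← integral_const_mul]
    congr 1
    ext T
    simp only [hH]
    ring
  simp only [h2, Complex.re_ofReal_mul, hF.eq_integral]
  ring

/-- Smoothed lattice sums over an ellipsoid agree with the corresponding integrals. -/
theorem exists_abs_sum_sub_integral_le (hn : 2 ≤ n) (hB : 0 < B) (hK : 0 ≤ K)
    (hP : ∀ i, 0 < P i) (K' : ℝ) (hK' : 0 ≤ K') :
    ∃ C, 0 ≤ C ∧ ∀ (y : Fin n → ℝ) (V V₁ V₂ : Fin n → ℝ → ℝ) (δ : ℝ) (F : ℝ → ℝ) (ψ ψ' : ℝ → ℂ)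
      (Λ : ℝ) (I : Finset ℤ), (∀ i, IsAmplitude B K (V i) (V₁ i) (V₂ i)) →
      IsCutoff n K' δ F ψ ψ' → 0 < δ → 1 ≤ Λ → (∀ i, ∀ k : ℤ, k ∉ I → B * Λ ≤ |y i + k|) →
      |∑ k ∈ Fintype.piFinset (fun _ : Fin n => I), (∏ i, V i ((y i + k i) / Λ)) *
          F (∑ i, P i * ((y i + k i) / Λ) ^ 2) -
        Λ ^ n * ∫ u : Fin n → ℝ, (∏ i, V i (u i)) * F (∑ i, P i * u i ^ 2)| ≤
        C * Λ ^ n * (1 / Λ ^ 2 + (1 / √Λ) ^ (n + 1) / √(δ * Λ) ^ (n - 1)) := by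
  obtain ⟨C, hC, h⟩ := exists_norm_integral_error_le hn hB hK hP K' hK'
  refine ⟨2 * C, by positivity, fun y V V₁ V₂ δ F ψ ψ' Λ I hV hF hδ hΛ hI => ?_⟩
  have hΛ0 : 0 < Λ := by linarith
  have key := h y V V₁ V₂ δ F ψ ψ' Λ I hV hF hδ hΛ hI
  rw [sum_mul_cutoff_eq hF hΛ0.ne', integral_mul_cutoff_eq hB hV hF, ← mul_sub, ← mul_sub,
    ← Complex.sub_re, ← integral_sub (integrable_mul_prod_quadSum hF).integrableOn
      (integrable_mul_prod_osc hB hV hF).integrableOn, abs_mul, abs_mul, abs_two,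
    abs_of_pos (by positivity)]
  simp_rw [← mul_sub]
  calc _ ≤ Λ ^ n * (2 * (C * (1 / Λ ^ 2 + (1 / √Λ) ^ (n + 1) / √(δ * Λ) ^ (n - 1)))) := by
        gcongr
        exact (Complex.abs_re_le_norm _).trans key
    _ = _ := by ring

end LatticeEllipsoid

namespace LatticeEllipsoid
open MeasureTheory Set
open scoped Real Topology ContDiff

/-! ### The weights -/

/-- A smooth function equal to `1` on `[-M, M]` and to `0` outside `[-2M, 2M]`. -/
noncomputable def plateau (M u : ℝ) : ℝ := smoothStep (-2 * M) M u - smoothStep M M u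

theorem contDiff_plateau (M : ℝ) : ContDiff ℝ ∞ (plateau M) :=
  (contDiff_smoothStep _ _).sub (contDiff_smoothStep _ _)

theorem plateau_eq_one {M u : ℝ} (hM : 0 < M) (hu : |u| ≤ M) : plateau M u = 1 := by
  have := abs_le.1 hu
  rw [plateau, smoothStep_eq_one hM (by linarith), smoothStep_eq_zero hM this.2, sub_zero]

theorem plateau_eq_zero {M u : ℝ} (hM : 0 < M) (hu : 2 * M ≤ |u|) : plateau M u = 0 := by
  rcases le_abs.1 hu with h | h
  · rw [plateau, smoothStep_eq_one hM (by linarith), smoothStep_eq_one hM (by linarith), sub_self]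
  · rw [plateau, smoothStep_eq_zero hM (by linarith), smoothStep_eq_zero hM (by linarith), sub_self]

theorem plateau_nonneg {M : ℝ} (hM : 0 < M) (u : ℝ) : 0 ≤ plateau M u := by
  rcases le_total u M with h | h
  · rw [plateau, smoothStep_eq_zero hM h, sub_zero]; exact smoothStep_nonneg _ _ _
  · rw [plateau, smoothStep_eq_one hM (by linarith)]
    linarith [smoothStep_le_one M M u]

theorem plateau_le_one {M : ℝ} (u : ℝ) : plateau M u ≤ 1 := by
  rw [plateau]; linarith [smoothStep_le_one (-2 * M) M u, smoothStep_nonneg M M u]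

theorem hasDerivAt_of_contDiff {f : ℝ → ℝ} (hf : ContDiff ℝ ∞ f) (x : ℝ) :
    HasDerivAt f (deriv f x) x :=
  ((contDiff_infty_iff_deriv.1 hf).1 x).hasDerivAt

theorem contDiff_deriv {f : ℝ → ℝ} (hf : ContDiff ℝ ∞ f) : ContDiff ℝ ∞ (deriv f) :=
  (contDiff_infty_iff_deriv.1 hf).2

theorem deriv_plateau_eq_zero {M u : ℝ} (hM : 0 < M) (hu : 2 * M < |u|) :
    deriv (plateau M) u = 0 := by
  have : plateau M =ᶠ[𝓝 u] fun _ => 0 := by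
    filter_upwards [(isOpen_lt continuous_const continuous_abs).mem_nhds hu] with z hz
    exact plateau_eq_zero hM (le_of_lt hz)
  rw [this.deriv_eq, deriv_const]

theorem exists_isAmplitude_plateau {M : ℝ} (hM : 0 < M) : ∃ K, IsAmplitude (2 * M + 1) K (plateau M)
    (deriv (plateau M)) (deriv (deriv (plateau M))) :=
  ⟨_, hasDerivAt_of_contDiff (contDiff_plateau M),
    hasDerivAt_of_contDiff (contDiff_deriv (contDiff_plateau M)),
    (contDiff_deriv (contDiff_deriv (contDiff_plateau M))).continuous,
    fun _ hu => plateau_eq_zero hM (by linarith),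
    fun _ hu => deriv_plateau_eq_zero hM (by linarith), le_rfl⟩

theorem IsAmplitude.mono {B K K' : ℝ} {V V₁ V₂ : ℝ → ℝ} (h : IsAmplitude B K V V₁ V₂)
    (hK : K ≤ K') : IsAmplitude B K' V V₁ V₂ :=
  { h with integral_le := h.integral_le.trans hK }

/-- Rescaling a function of polynomial growth and cutting it off gives amplitudes that are uniform
in the scale. -/
theorem exists_isAmplitude_scaled {w w₁ w₂ β β₁ β₂ : ℝ → ℝ} {m : ℕ} {A B b Kβ : ℝ}
    (hB : 0 < B) (hA : 0 ≤ A)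
    (hw : ∀ x, HasDerivAt w (w₁ x) x) (hw' : ∀ x, HasDerivAt w₁ (w₂ x) x) (hw₂ : Continuous w₂)
    (bw : ∀ x, |w x| ≤ A * (1 + |x|) ^ (m + 1)) (bw₁ : ∀ x, |w₁ x| ≤ A * (1 + |x|) ^ m)
    (bw₂ : ∀ X, 0 ≤ X → ∫ x in -X..X, |w₂ x| ≤ A * (1 + X) ^ m)
    (hβ : IsAmplitude B Kβ β β₁ β₂) (hb : ∀ u ∈ Icc (-B) B, |β u| ≤ b ∧ |β₁ u| ≤ b ∧ |β₂ u| ≤ b) :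
    ∃ K, ∀ Λ, 1 ≤ Λ → ∃ V₁ V₂, IsAmplitude B K (fun u => w (Λ * u) * β u / Λ ^ (m + 1)) V₁ V₂ := by
  have hBB : -B ≤ B := by linarith
  have hb0 : 0 ≤ b := (abs_nonneg _).trans (hb B ⟨hBB, le_rfl⟩).1
  refine ⟨b * A * (1 + B) ^ m + 2 * B * (2 * (A * (1 + B) ^ m * b) + A * (1 + B) ^ (m + 1) * b),
    fun Λ hΛ => ?_⟩
  have hΛ0 : 0 < Λ := by linarith
  have hΛu : ∀ u : ℝ, HasDerivAt (fun u : ℝ => Λ * u) Λ u := fun u => by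
    simpa using (hasDerivAt_id u).const_mul Λ
  have d0 : ∀ u, HasDerivAt (fun u => w (Λ * u)) (w₁ (Λ * u) * Λ) u := fun u =>
    (hw (Λ * u)).comp u (hΛu u)
  have d1 : ∀ u, HasDerivAt (fun u => w₁ (Λ * u)) (w₂ (Λ * u) * Λ) u := fun u =>
    (hw' (Λ * u)).comp u (hΛu u)
  have cw : Continuous w := continuous_iff_continuousAt.2 fun u => (hw u).continuousAt
  have cw₁ : Continuous w₁ := continuous_iff_continuousAt.2 fun u => (hw' u).continuousAt
  have cβ := hβ.continuous
  have cβ₁ := hβ.continuous₁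
  have cβ₂ := hβ.continuous₂
  refine ⟨fun u => (w₁ (Λ * u) * Λ * β u + w (Λ * u) * β₁ u) / Λ ^ (m + 1),
    fun u => (w₂ (Λ * u) * Λ ^ 2 * β u + 2 * (w₁ (Λ * u) * Λ * β₁ u) + w (Λ * u) * β₂ u) /
      Λ ^ (m + 1), fun u => ?_, fun u => ?_, ?_, fun u hu => ?_, fun u hu => ?_, ?_⟩
  · exact ((d0 u).mul (hβ.hasDerivAt u)).div_const _
  · have := ((((d1 u).mul_const Λ).mul (hβ.hasDerivAt u)).add
      ((d0 u).mul (hβ.hasDerivAt' u))).div_const (Λ ^ (m + 1))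
    convert! this using 2
    ring
  · fun_prop
  · simp [hβ.eq_zero u hu]
  · simp [hβ.eq_zero u hu, hβ.eq_zero' u hu]
  · set c := A * (1 + B) ^ m * b with hc
    set c' := A * (1 + B) ^ (m + 1) * b with hc'
    have hgrow : ∀ u ∈ Icc (-B) B, ∀ k : ℕ, A * (1 + |Λ * u|) ^ k ≤ A * (1 + B) ^ k * Λ ^ k := by
      intro u hu k
      have hu' := abs_le.2 hu
      rw [mul_assoc, ← mul_pow, abs_mul, abs_of_pos hΛ0]
      gcongr
      nlinarith
    have hpt : ∀ u ∈ Icc (-B) B, |(w₂ (Λ * u) * Λ ^ 2 * β u + 2 * (w₁ (Λ * u) * Λ * β₁ u) +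
        w (Λ * u) * β₂ u) / Λ ^ (m + 1)| ≤ b * Λ ^ 2 / Λ ^ (m + 1) * |w₂ (Λ * u)| +
          (2 * c + c') := by
      intro u hu
      obtain ⟨b0, b1, b2⟩ := hb u hu
      rw [abs_div, abs_of_pos (by positivity : 0 < Λ ^ (m + 1)), div_le_iff₀ (by positivity)]
      have i1 : |w₂ (Λ * u) * Λ ^ 2 * β u| ≤ b * Λ ^ 2 * |w₂ (Λ * u)| := by
        rw [abs_mul, abs_mul, abs_of_pos (by positivity : 0 < Λ ^ 2)]
        calc _ ≤ |w₂ (Λ * u)| * Λ ^ 2 * b := by gcongr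
          _ = _ := by ring
      have i2 : |2 * (w₁ (Λ * u) * Λ * β₁ u)| ≤ 2 * c * Λ ^ (m + 1) := by
        rw [abs_mul, abs_mul, abs_mul, abs_two, abs_of_pos hΛ0]
        calc _ ≤ 2 * (A * (1 + B) ^ m * Λ ^ m * Λ * b) := by
              gcongr
              exact (bw₁ _).trans (hgrow u hu m)
          _ = _ := by rw [hc]; ring
      have i3 : |w (Λ * u) * β₂ u| ≤ c' * Λ ^ (m + 1) := by
        rw [abs_mul]
        calc _ ≤ A * (1 + B) ^ (m + 1) * Λ ^ (m + 1) * b := by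
              gcongr
              exact (bw _).trans (hgrow u hu (m + 1))
          _ = _ := by rw [hc']; ring
      refine (abs_add_le _ _).trans ((add_le_add (abs_add_le _ _) le_rfl).trans ?_)
      have e : (b * Λ ^ 2 / Λ ^ (m + 1) * |w₂ (Λ * u)| + (2 * c + c')) * Λ ^ (m + 1) =
          b * Λ ^ 2 * |w₂ (Λ * u)| + 2 * c * Λ ^ (m + 1) + c' * Λ ^ (m + 1) := by
        field_simp
        ring
      rw [e]
      linarith
    have hint := intervalIntegral.integral_mono_on (μ := volume) hBB
      ((by fun_prop : Continuous _).intervalIntegrable _ _)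
      ((by fun_prop : Continuous _).intervalIntegrable _ _) hpt
    refine hint.trans ?_
    rw [intervalIntegral.integral_add ((by fun_prop : Continuous _).intervalIntegrable _ _)
      ((by fun_prop : Continuous _).intervalIntegrable _ _), intervalIntegral.integral_const_mul,
      intervalIntegral.integral_const, smul_eq_mul,
      intervalIntegral.integral_comp_mul_left (fun x => |w₂ x|) hΛ0.ne', smul_eq_mul, mul_neg]
    -- The change of variable gains `1/Λ` against the `Λ²` from differentiating twice. For `m = 0`
    -- the rescaled second derivative can have size `Λ` on an interval of length `1/Λ`, so a uniform
    -- pointwise bound is not available.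
    have h2 : ∫ x in -(Λ * B)..Λ * B, |w₂ x| ≤ A * ((1 + B) ^ m * Λ ^ m) := by
      refine (bw₂ _ (by positivity)).trans ?_
      rw [← mul_pow]
      gcongr
      nlinarith
    calc _ ≤ b * Λ ^ 2 / Λ ^ (m + 1) * (Λ⁻¹ * (A * ((1 + B) ^ m * Λ ^ m))) +
          (B - -B) * (2 * c + c') := by gcongr
      _ = _ := by
        field_simp
        ring

theorem exists_abs_eval_le (q : Polynomial ℝ) {m : ℕ} (hq : q.natDegree ≤ m) :
    ∃ A, 0 ≤ A ∧ ∀ x : ℝ, |q.eval x| ≤ A * (1 + |x|) ^ m := by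
  refine ⟨∑ i ∈ Finset.range (m + 1), |q.coeff i|, Finset.sum_nonneg fun _ _ => abs_nonneg _,
    fun x => ?_⟩
  rw [Polynomial.eval_eq_sum_range' (Nat.lt_succ_of_le hq), Finset.sum_mul]
  refine (Finset.abs_sum_le_sum_abs _ _).trans (Finset.sum_le_sum fun i hi => ?_)
  rw [abs_mul, abs_pow]
  gcongr
  calc |x| ^ i ≤ (1 + |x|) ^ i := by gcongr; linarith
    _ ≤ (1 + |x|) ^ m := pow_le_pow_right₀ (by linarith [abs_nonneg x])
        (Nat.lt_succ_iff.1 (Finset.mem_range.1 hi))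

/-- A smooth function on the line that agrees on `y + ℤ` with `q`, truncated to `[y, ∞)`. -/
noncomputable def smoothTrunc (q : Polynomial ℝ) (y x : ℝ) : ℝ := q.eval x * smoothStep (y - 1) 1 x

/-- The step rises on `[y - 1, y]`, whose only points of `y + ℤ` are its endpoints, so the smoothing
changes nothing on the lattice. -/
theorem smoothTrunc_add_int (q : Polynomial ℝ) (y : ℝ) (k : ℤ) :
    smoothTrunc q y (y + k) = if 0 ≤ k then q.eval (y + k) else 0 := by
  rw [smoothTrunc]
  split_ifs with h
  · have : (0 : ℝ) ≤ k := by exact_mod_cast h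
    rw [smoothStep_eq_one one_pos (by linarith), mul_one]
  · have : (k : ℝ) ≤ -1 := by exact_mod_cast (by omega : k ≤ -1)
    rw [smoothStep_eq_zero one_pos (by linarith), mul_zero]

theorem deriv_smoothStep_eq_zero {a x : ℝ} (hx : x ∉ Icc a (a + 1)) :
    deriv (smoothStep a 1) x = 0 := by
  rw [(hasDerivAt_smoothStep a 1 x).deriv, deriv_smoothTransition_eq_zero, mul_zero]
  rintro ⟨h1, h2⟩
  rw [div_one] at h1 h2
  exact hx ⟨by linarith, by linarith⟩

/-- Derivatives of the product are derivatives of `q` times a bounded step, plus terms supported in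
the transition interval. The latter are bounded and integrable, hence harmless even when `m = 0`. -/
theorem exists_smoothTrunc_bounds (q : Polynomial ℝ) (y : ℝ) {m : ℕ} (hq : q.natDegree ≤ m + 1) :
    ∃ A w₁ w₂, 0 ≤ A ∧ (∀ x, HasDerivAt (smoothTrunc q y) (w₁ x) x) ∧
      (∀ x, HasDerivAt w₁ (w₂ x) x) ∧ Continuous w₂ ∧
      (∀ x, |smoothTrunc q y x| ≤ A * (1 + |x|) ^ (m + 1)) ∧
      (∀ x, |w₁ x| ≤ A * (1 + |x|) ^ m) ∧
      (∀ X, 0 ≤ X → ∫ x in -X..X, |w₂ x| ≤ A * (1 + X) ^ m) := by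
  set s := smoothStep (y - 1) 1
  have hs : ContDiff ℝ ∞ s := contDiff_smoothStep _ _
  have cs := hs.continuous
  have cs₁ := (contDiff_deriv hs).continuous
  have cs₂ := (contDiff_deriv (contDiff_deriv hs)).continuous
  have s01 : ∀ x, |s x| ≤ 1 := fun x => by
    rw [abs_of_nonneg (smoothStep_nonneg _ _ _)]; exact smoothStep_le_one _ _ _
  set q₁ := Polynomial.derivative q
  set q₂ := Polynomial.derivative q₁
  have hq1 : q₁.natDegree ≤ m := (Polynomial.natDegree_derivative_le q).trans (by omega)
  obtain ⟨A₀, hA0, h0⟩ := exists_abs_eval_le q hq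
  obtain ⟨A₁, hA1, h1⟩ := exists_abs_eval_le q₁ hq1
  -- Growth of order `m - 1` for `q''`, stated so that it also covers `m = 0`, where `q''` is zero.
  obtain ⟨A₂, hA2, h2⟩ : ∃ A, 0 ≤ A ∧ ∀ X, 0 ≤ X → ∀ x, |x| ≤ X →
      (1 + X) * |q₂.eval x| ≤ A * (1 + X) ^ m := by
    rcases m with _ | m
    · refine ⟨0, le_rfl, fun X hX x hx => ?_⟩
      have : q₂ = 0 := by
        simp only [q₂]
        rw [Polynomial.eq_C_of_natDegree_eq_zero (Nat.le_zero.1 hq1), Polynomial.derivative_C]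
      simp [this]
    · obtain ⟨A, hA, h⟩ := exists_abs_eval_le q₂ (m := m)
        ((Polynomial.natDegree_derivative_le q₁).trans (by omega))
      refine ⟨A, hA, fun X hX x hx => ?_⟩
      calc _ ≤ (1 + X) * (A * (1 + |x|) ^ m) := by gcongr; exact h x
        _ ≤ (1 + X) * (A * (1 + X) ^ m) := by gcongr
        _ = _ := by ring
  have s1z : ∀ x, x ∉ Icc (y - 1) (y - 1 + 1) → deriv s x = 0 := fun x hx =>
    deriv_smoothStep_eq_zero hx
  have s2z : ∀ x, x ∉ Icc (y - 1) (y - 1 + 1) → deriv (deriv s) x = 0 := fun x hx => by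
    have : deriv s =ᶠ[𝓝 x] fun _ => 0 := by
      filter_upwards [isClosed_Icc.isOpen_compl.mem_nhds hx] with z hz
      exact s1z z hz
    rw [this.deriv_eq, deriv_const]
  set r : ℝ → ℝ := fun x => 2 * (q₁.eval x * deriv s x) + q.eval x * deriv (deriv s) x with hr
  have cq := q.continuous
  have cq₁ := q₁.continuous
  have cq₂ := q₂.continuous
  have cr : Continuous r := by fun_prop
  have hrs : HasCompactSupport r := HasCompactSupport.intro (isCompact_Icc (a := y - 1)
    (b := y - 1 + 1)) fun x hx => by simp [hr, s1z x hx, s2z x hx]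
  have hri : Integrable fun x => |r x| := (cr.integrable_of_hasCompactSupport hrs).abs
  have hts : HasCompactSupport fun x => q.eval x * deriv s x :=
    HasCompactSupport.intro (isCompact_Icc (a := y - 1) (b := y - 1 + 1)) fun x hx => by
      simp [s1z x hx]
  obtain ⟨A₃, h3⟩ := (by fun_prop : Continuous fun x => q.eval x * deriv s x)
    |>.bounded_above_of_compact_support hts
  have hA3 : 0 ≤ A₃ := (norm_nonneg _).trans (h3 0)
  have hA4 : 0 ≤ ∫ x, |r x| := integral_nonneg fun _ => abs_nonneg _
  refine ⟨A₀ + A₁ + 2 * A₂ + A₃ + ∫ x, |r x|, fun x => q₁.eval x * s x + q.eval x * deriv s x,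
    fun x => q₂.eval x * s x + r x, by positivity, fun x => ?_, fun x => ?_, by fun_prop,
    fun x => ?_, fun x => ?_, fun X hX => ?_⟩
  · exact (q.hasDerivAt x).mul (hasDerivAt_of_contDiff hs x)
  · have := ((q₁.hasDerivAt x).mul (hasDerivAt_of_contDiff hs x)).add
      ((q.hasDerivAt x).mul (hasDerivAt_of_contDiff (contDiff_deriv hs) x))
    convert! this using 1
    simp only [hr]
    ring
  · rw [smoothTrunc, abs_mul]
    calc _ ≤ A₀ * (1 + |x|) ^ (m + 1) * 1 := by
          gcongr
          · exact h0 x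
          · exact s01 x
      _ ≤ _ := by rw [mul_one]; gcongr; linarith
  · have hone : 1 ≤ (1 + |x|) ^ m := one_le_pow₀ (by linarith [abs_nonneg x])
    refine (abs_add_le _ _).trans ?_
    rw [abs_mul]
    calc _ ≤ A₁ * (1 + |x|) ^ m * 1 + A₃ := by
          gcongr
          · exact h1 x
          · exact s01 x
          · exact h3 x
      _ ≤ A₁ * (1 + |x|) ^ m + A₃ * (1 + |x|) ^ m := by
          rw [mul_one]; gcongr; exact le_mul_of_one_le_right hA3 hone
      _ = (A₁ + A₃) * (1 + |x|) ^ m := by ring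
      _ ≤ _ := mul_le_mul_of_nonneg_right (by linarith) (by positivity)
  · have hone : 1 ≤ (1 + X) ^ m := one_le_pow₀ (by linarith)
    have hXX : -X ≤ X := by linarith
    have i1 : ∫ x in -X..X, |q₂.eval x * s x + r x| ≤
        ∫ x in -X..X, (A₂ * (1 + X) ^ m / (1 + X) + |r x|) := by
      refine intervalIntegral.integral_mono_on (μ := volume) hXX
        ((by fun_prop : Continuous _).intervalIntegrable _ _)
        ((by fun_prop : Continuous _).intervalIntegrable _ _) fun x hx => ?_
      refine (abs_add_le _ _).trans (add_le_add ?_ le_rfl)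
      rw [abs_mul, le_div_iff₀ (by positivity)]
      calc _ ≤ |q₂.eval x| * 1 * (1 + X) := by gcongr; exact s01 x
        _ = (1 + X) * |q₂.eval x| := by ring
        _ ≤ _ := h2 X hX x (abs_le.2 hx)
    have i2 : ∫ x in -X..X, |r x| ≤ ∫ x, |r x| := by
      rw [intervalIntegral.integral_of_le hXX]
      exact setIntegral_le_integral hri (Eventually.of_forall fun _ => abs_nonneg _)
    refine i1.trans ?_
    rw [intervalIntegral.integral_add ((by fun_prop : Continuous _).intervalIntegrable _ _)
      ((by fun_prop : Continuous _).intervalIntegrable _ _), intervalIntegral.integral_const,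
      smul_eq_mul]
    calc (X - -X) * (A₂ * (1 + X) ^ m / (1 + X)) + ∫ x in -X..X, |r x|
        ≤ (2 * (1 + X)) * (A₂ * (1 + X) ^ m / (1 + X)) + (∫ x, |r x|) * (1 + X) ^ m := by
          gcongr
          · linarith
          · exact i2.trans (le_mul_of_one_le_right hA4 hone)
      _ = (2 * A₂ + ∫ x, |r x|) * (1 + X) ^ m := by field_simp
      _ ≤ _ := mul_le_mul_of_nonneg_right (by linarith) (by positivity)

/-- The rescaled weight attached to one coordinate. -/
noncomputable def scaledWeight (q : Polynomial ℝ) (y M : ℝ) (m : ℕ) (Λ u : ℝ) : ℝ :=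
  smoothTrunc q y (Λ * u) * plateau M u / Λ ^ (m + 1)

theorem exists_isAmplitude_scaledWeight (q : Polynomial ℝ) (y : ℝ) {M : ℝ} (hM : 0 < M) {m : ℕ}
    (hq : q.natDegree ≤ m + 1) : ∃ K, ∀ Λ, 1 ≤ Λ → ∃ V₁ V₂,
      IsAmplitude (2 * M + 1) K (scaledWeight q y M m Λ) V₁ V₂ := by
  obtain ⟨A, w₁, w₂, hA, d0, d1, c2, b0, b1, b2⟩ := exists_smoothTrunc_bounds q y hq
  obtain ⟨Kβ, hβ⟩ := exists_isAmplitude_plateau hM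
  obtain ⟨x₀, h0⟩ := isCompact_Icc.exists_bound_of_continuousOn (s := Icc (-(2 * M + 1)) (2 * M + 1))
    hβ.continuous.continuousOn
  obtain ⟨x₁, h1⟩ := isCompact_Icc.exists_bound_of_continuousOn (s := Icc (-(2 * M + 1)) (2 * M + 1))
    hβ.continuous₁.continuousOn
  obtain ⟨x₂, h2⟩ := isCompact_Icc.exists_bound_of_continuousOn (s := Icc (-(2 * M + 1)) (2 * M + 1))
    hβ.continuous₂.continuousOn
  exact exists_isAmplitude_scaled (b := max x₀ (max x₁ x₂)) (by positivity) hA d0 d1 c2 b0 b1 b2 hβ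
    fun u hu => ⟨(h0 u hu).trans (le_max_left _ _),
      (h1 u hu).trans ((le_max_left _ _).trans (le_max_right _ _)),
      (h2 u hu).trans ((le_max_right _ _).trans (le_max_right _ _))⟩

/-- The limit of `scaledWeight` for large `Λ`. -/
noncomputable def limitWeight (q : Polynomial ℝ) (M : ℝ) (m : ℕ) (u : ℝ) : ℝ :=
  q.coeff (m + 1) * max u 0 ^ (m + 1) * plateau M u

theorem continuous_limitWeight (q : Polynomial ℝ) (M : ℝ) (m : ℕ) :
    Continuous (limitWeight q M m) := by
  have := (contDiff_plateau M).continuous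
  unfold limitWeight
  fun_prop

/-- With the coefficient of order `m` absent, `q` minus its term of order `m + 1` has growth of
order `m - 1`, or vanishes if `m = 0`. Truncating at `y` instead of at `0` matters only for `|x| ≤
|y| + 1`, where the difference is bounded. -/
theorem exists_abs_smoothTrunc_sub_le (q : Polynomial ℝ) (y : ℝ) {m : ℕ}
    (hq : q.natDegree ≤ m + 1) (hq' : q.coeff m = 0) :
    ∃ A Y, 0 ≤ A ∧ 0 ≤ Y ∧ ∀ X, 0 ≤ X → ∀ x, |x| ≤ X →
      |smoothTrunc q y x - q.coeff (m + 1) * max x 0 ^ (m + 1)| ≤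
        A * (1 + X) ^ m / (1 + X) + (Icc (-Y) Y).indicator (fun _ => A) x := by
  obtain ⟨A₁, hA1, h1⟩ : ∃ A, 0 ≤ A ∧ ∀ X, 0 ≤ X → ∀ x, |x| ≤ X →
      |q.eval x - q.coeff (m + 1) * x ^ (m + 1)| ≤ A * (1 + X) ^ m / (1 + X) := by
    set r := q - Polynomial.monomial (m + 1) (q.coeff (m + 1)) with hr
    have hev : ∀ x, r.eval x = q.eval x - q.coeff (m + 1) * x ^ (m + 1) := fun x => by
      simp [hr]
    have hcoeff : ∀ k, m ≤ k → r.coeff k = 0 := fun k hk => by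
      rw [hr, Polynomial.coeff_sub, Polynomial.coeff_monomial]
      split_ifs with h
      · rw [h, sub_self]
      · rcases hk.eq_or_lt with rfl | hk
        · rw [hq', sub_zero]
        · rw [Polynomial.coeff_eq_zero_of_natDegree_lt (by omega), sub_zero]
    rcases m with _ | m
    · refine ⟨0, le_rfl, fun X hX x hx => ?_⟩
      have : r = 0 := Polynomial.ext fun k => by rw [hcoeff k (Nat.zero_le _), Polynomial.coeff_zero]
      rw [← hev, this]
      simp
    · obtain ⟨A, hA, h⟩ := exists_abs_eval_le r (m := m)
        (Polynomial.natDegree_le_iff_coeff_eq_zero.2 fun k hk => hcoeff k hk)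
      refine ⟨A, hA, fun X hX x hx => ?_⟩
      rw [← hev, le_div_iff₀ (by positivity)]
      calc _ ≤ A * (1 + |x|) ^ m * (1 + X) := by gcongr; exact h x
        _ ≤ A * (1 + X) ^ m * (1 + X) := by gcongr
        _ = _ := by ring
  set Y := |y| + 1 with hY
  have hY0 : 0 ≤ Y := by positivity
  have cont : Continuous fun x => smoothTrunc q y x - q.coeff (m + 1) * max x 0 ^ (m + 1) := by
    have := (contDiff_smoothStep (y - 1) 1).continuous
    have := q.continuous
    unfold smoothTrunc
    fun_prop
  obtain ⟨A₂, h2⟩ := isCompact_Icc.exists_bound_of_continuousOn (s := Icc (-Y) Y) cont.continuousOn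
  have hA2 : 0 ≤ A₂ := (norm_nonneg _).trans (h2 0 ⟨by linarith, hY0⟩)
  refine ⟨A₁ + A₂, Y, by positivity, hY0, fun X hX x hx => ?_⟩
  have hpos : 0 ≤ (A₁ + A₂) * (1 + X) ^ m / (1 + X) := by positivity
  by_cases hxY : x ∈ Icc (-Y) Y
  · rw [indicator_of_mem hxY]
    have := h2 x hxY
    rw [Real.norm_eq_abs] at this
    linarith
  · rw [indicator_of_notMem hxY, add_zero]
    rw [mem_Icc, not_and_or, not_le, not_le] at hxY
    have hy := abs_le.1 (le_refl |y|)
    rcases hxY with h | h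
    · rw [smoothTrunc, smoothStep_eq_zero one_pos (by linarith), max_eq_right (by linarith)]
      simpa using hpos
    · rw [smoothTrunc, smoothStep_eq_one one_pos (by linarith), max_eq_left (by linarith), mul_one]
      refine (h1 X hX x hx).trans ?_
      gcongr
      linarith

/-- After division by `Λ^(m+1)` the lower-order part of `q` is `O(Λ⁻²)` pointwise, and the
truncation error is `O(Λ^(-(m+1)))` on an interval of length `O(1/Λ)`. A nonzero coefficient of
order `m` would in general leave `O(1/Λ)`, more than the final error allows. -/
theorem exists_integral_abs_sub_limitWeight_le (q : Polynomial ℝ) (y : ℝ) {M : ℝ} (hM : 0 < M)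
    {m : ℕ} (hq : q.natDegree ≤ m + 1) (hq' : q.coeff m = 0) :
    ∃ C, 0 ≤ C ∧ ∀ Λ, 1 ≤ Λ →
      ∫ u, |scaledWeight q y M m Λ u - limitWeight q M m u| ≤ C * (1 / Λ ^ 2) := by
  obtain ⟨A, Y, hA, hY, h⟩ := exists_abs_smoothTrunc_sub_le q y hq hq'
  set B := 2 * M + 1 with hB
  have hB0 : 0 < B := by positivity
  refine ⟨2 * B * (A * (1 + B) ^ m) + 2 * Y * A, by positivity, fun Λ hΛ => ?_⟩
  have hΛ0 : 0 < Λ := by linarith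
  have hdiff : ∀ u, scaledWeight q y M m Λ u - limitWeight q M m u =
      (smoothTrunc q y (Λ * u) - q.coeff (m + 1) * max (Λ * u) 0 ^ (m + 1)) * plateau M u /
        Λ ^ (m + 1) := fun u => by
    have : max (Λ * u) 0 = Λ * max u 0 := by
      rw [mul_max_of_nonneg _ _ hΛ0.le, mul_zero]
    rw [scaledWeight, limitWeight, this, mul_pow]
    field_simp
  set g : ℝ → ℝ := fun u => (Icc (-B) B).indicator (fun _ => A * (1 + B) ^ m * (1 / Λ ^ 2)) u +
    (Icc (-(Y / Λ)) (Y / Λ)).indicator (fun _ => A / Λ ^ (m + 1)) u with hg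
  have hgi : Integrable g :=
    ((integrable_indicator_iff measurableSet_Icc).2 continuous_const.integrableOn_Icc).add
      ((integrable_indicator_iff measurableSet_Icc).2 continuous_const.integrableOn_Icc)
  have hle : ∀ u, |scaledWeight q y M m Λ u - limitWeight q M m u| ≤ g u := by
    intro u
    have hi2 : 0 ≤ (Icc (-(Y / Λ)) (Y / Λ)).indicator (fun _ => A / Λ ^ (m + 1)) u :=
      indicator_nonneg (fun _ _ => by positivity) _
    by_cases hu : u ∈ Icc (-B) B
    · have hu' := abs_le.2 hu
      have hx : |Λ * u| ≤ Λ * B := by rw [abs_mul, abs_of_pos hΛ0]; gcongr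
      have h1 := h (Λ * B) (by positivity) (Λ * u) hx
      have hp : |plateau M u| ≤ 1 := by
        rw [abs_of_nonneg (plateau_nonneg hM u)]; exact plateau_le_one u
      have hind : (Icc (-Y) Y).indicator (fun _ => A) (Λ * u) / Λ ^ (m + 1) =
          (Icc (-(Y / Λ)) (Y / Λ)).indicator (fun _ => A / Λ ^ (m + 1)) u := by
        have hiff : Λ * u ∈ Icc (-Y) Y ↔ u ∈ Icc (-(Y / Λ)) (Y / Λ) := by
          rw [mem_Icc, mem_Icc, ← neg_div, div_le_iff₀ hΛ0, le_div_iff₀ hΛ0, mul_comm Λ]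
        by_cases hm : Λ * u ∈ Icc (-Y) Y
        · rw [indicator_of_mem hm, indicator_of_mem (hiff.1 hm)]
        · rw [indicator_of_notMem hm, indicator_of_notMem (fun h => hm (hiff.2 h)), zero_div]
      have hmain : A * (1 + Λ * B) ^ m / (1 + Λ * B) / Λ ^ (m + 1) ≤
          A * (1 + B) ^ m * (1 / Λ ^ 2) := by
        calc A * (1 + Λ * B) ^ m / (1 + Λ * B) / Λ ^ (m + 1)
            ≤ A * ((1 + B) * Λ) ^ m / Λ / Λ ^ (m + 1) := by
              gcongr
              · nlinarith
              · have : M ≤ Λ * M := le_mul_of_one_le_left hM.le hΛ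
                rw [hB]; nlinarith
          _ = _ := by rw [mul_pow]; field_simp; ring
      rw [hdiff, abs_div, abs_mul, abs_of_pos (by positivity : 0 < Λ ^ (m + 1))]
      simp only [hg, indicator_of_mem hu]
      rw [← hind]
      have hi3 : 0 ≤ (Icc (-Y) Y).indicator (fun _ => A) (Λ * u) :=
        indicator_nonneg (fun _ _ => hA) _
      calc _ ≤ (A * (1 + Λ * B) ^ m / (1 + Λ * B) + (Icc (-Y) Y).indicator (fun _ => A) (Λ * u)) *
              1 / Λ ^ (m + 1) := by gcongr
        _ = A * (1 + Λ * B) ^ m / (1 + Λ * B) / Λ ^ (m + 1) +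
            (Icc (-Y) Y).indicator (fun _ => A) (Λ * u) / Λ ^ (m + 1) := by
            rw [mul_one, add_div]
        _ ≤ _ := by gcongr
    · have : plateau M u = 0 := plateau_eq_zero hM (by
        by_contra hc
        have := abs_lt.1 (not_le.1 hc)
        exact hu ⟨by linarith, by linarith⟩)
      rw [hdiff, this]
      simp only [mul_zero, zero_div, abs_zero, hg, indicator_of_notMem hu, zero_add]
      exact hi2
  refine (integral_mono_of_nonneg (Eventually.of_forall fun _ => abs_nonneg _) hgi
    (Eventually.of_forall hle)).trans ?_
  simp only [hg]
  rw [integral_add ((integrable_indicator_iff measurableSet_Icc).2 continuous_const.integrableOn_Icc)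
    ((integrable_indicator_iff measurableSet_Icc).2 continuous_const.integrableOn_Icc),
    integral_indicator_const _ measurableSet_Icc, integral_indicator_const _ measurableSet_Icc]
  have hv : ∀ t : ℝ, 0 ≤ t → volume.real (Icc (-t) t) = 2 * t := fun t ht => by
    rw [Measure.real, Real.volume_Icc, ENNReal.toReal_ofReal (by linarith)]; ring
  rw [hv B hB0.le, hv (Y / Λ) (by positivity), smul_eq_mul, smul_eq_mul, add_mul]
  have hlast : 2 * (Y / Λ) * (A / Λ ^ (m + 1)) ≤ 2 * Y * A * (1 / Λ ^ 2) := by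
    have : 1 / Λ ^ (m + 2) ≤ 1 / Λ ^ 2 := by
      apply one_div_le_one_div_of_le (by positivity)
      exact pow_le_pow_right₀ hΛ (by omega)
    calc 2 * (Y / Λ) * (A / Λ ^ (m + 1)) = 2 * Y * A * (1 / Λ ^ (m + 2)) := by
          field_simp
          ring
      _ ≤ _ := by gcongr
  linarith

end LatticeEllipsoid

namespace LatticeEllipsoid
open MeasureTheory Set
open scoped Real Topology Pointwise

/-! ### Comparing integrals -/

/-- One factor is exchanged at a time. The majorant is kept as a sum of products of one-variable
functions, so that it can be integrated coordinate by coordinate. -/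
theorem abs_prod_sub_prod_le {ι : Type*} [DecidableEq ι] (s : Finset ι) {a b m : ι → ℝ}
    (ha : ∀ i, |a i| ≤ m i) (hb : ∀ i, |b i| ≤ m i) :
    |∏ i ∈ s, a i - ∏ i ∈ s, b i| ≤
      ∑ i ∈ s, ∏ j ∈ s, if j = i then |a j - b j| else m j := by
  have hm : ∀ i, 0 ≤ m i := fun i => (abs_nonneg _).trans (ha i)
  induction s using Finset.induction_on with
  | empty => simp
  | insert x s hx ih =>
    rw [Finset.prod_insert hx, Finset.prod_insert hx, Finset.sum_insert hx,
      Finset.prod_insert hx, if_pos rfl]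
    have e1 : ∏ j ∈ s, (if j = x then |a j - b j| else m j) = ∏ j ∈ s, m j :=
      Finset.prod_congr rfl fun j hj => if_neg (ne_of_mem_of_not_mem hj hx)
    have e2 : ∑ i ∈ s, ∏ j ∈ insert x s, (if j = i then |a j - b j| else m j) =
        m x * ∑ i ∈ s, ∏ j ∈ s, (if j = i then |a j - b j| else m j) := by
      rw [Finset.mul_sum]
      refine Finset.sum_congr rfl fun i hi => ?_
      rw [Finset.prod_insert hx, if_neg (ne_of_mem_of_not_mem hi hx).symm]
    rw [e1, e2]
    have e3 : a x * ∏ i ∈ s, a i - b x * ∏ i ∈ s, b i =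
        (a x - b x) * ∏ i ∈ s, a i + b x * (∏ i ∈ s, a i - ∏ i ∈ s, b i) := by ring
    rw [e3]
    refine (abs_add_le _ _).trans (add_le_add ?_ ?_)
    · rw [abs_mul, Finset.abs_prod]
      gcongr with i
      exact ha i
    · rw [abs_mul]
      exact mul_le_mul (hb x) ih (abs_nonneg _) (hm x)

variable {n : ℕ}

theorem integrable_prod_mul {V : Fin n → ℝ → ℝ} {h : (Fin n → ℝ) → ℝ}
    (hV : ∀ i, Integrable (V i)) (hh : Measurable h) {c : ℝ} (hc : ∀ u, |h u| ≤ c) :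
    Integrable fun u : Fin n → ℝ => (∏ i, V i (u i)) * h u :=
  (Integrable.fintype_prod (μ := fun _ => volume) hV).mul_bdd hh.aestronglyMeasurable
    (Eventually.of_forall hc)

/-- Replacing the factors of a product by nearby ones changes the integral by a small amount. -/
theorem abs_integral_prod_sub_le {V W : Fin n → ℝ → ℝ} {B K c : ℝ} {h : (Fin n → ℝ) → ℝ}
    (hB : 0 ≤ B) (hK : 0 ≤ K) (hV : ∀ i, Integrable (V i)) (hW : ∀ i, Integrable (W i))
    (bV : ∀ i u, |V i u| ≤ K) (bW : ∀ i u, |W i u| ≤ K)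
    (zV : ∀ i u, B ≤ |u| → V i u = 0) (zW : ∀ i u, B ≤ |u| → W i u = 0)
    (hc : ∀ i, ∫ u, |V i u - W i u| ≤ c) (hh : Measurable h) (hh1 : ∀ u, |h u| ≤ 1) :
    |(∫ u : Fin n → ℝ, (∏ i, V i (u i)) * h u) - ∫ u : Fin n → ℝ, (∏ i, W i (u i)) * h u| ≤
      n * (c * (2 * B * K) ^ (n - 1)) := by
  set m : ℝ → ℝ := (Icc (-B) B).indicator fun _ => K with hm
  have hle : ∀ X : ℝ → ℝ, (∀ u, |X u| ≤ K) → (∀ u, B ≤ |u| → X u = 0) → ∀ u, |X u| ≤ m u := by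
    intro X b z u
    by_cases hu : u ∈ Icc (-B) B
    · rw [hm, indicator_of_mem hu]; exact b u
    · rw [hm, indicator_of_notMem hu, z u, abs_zero]
      by_contra hlt
      exact hu (abs_le.1 (not_le.1 hlt).le)
  have hmi : Integrable m :=
    (integrable_indicator_iff measurableSet_Icc).2 continuous_const.integrableOn_Icc
  have hmint : ∫ u, m u = 2 * B * K := by
    rw [hm, integral_indicator_const _ measurableSet_Icc, Measure.real, Real.volume_Icc,
      ENNReal.toReal_ofReal (by linarith), smul_eq_mul]
    ring
  set g : Fin n → Fin n → ℝ → ℝ := fun i j u => if j = i then |V j u - W j u| else m u with hg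
  have hgi : ∀ i j, Integrable (g i j) := by
    intro i j
    by_cases hij : j = i
    · simp only [hg, if_pos hij]; exact ((hV j).sub (hW j)).abs
    · simp only [hg, if_neg hij]; exact hmi
  rw [← integral_sub (integrable_prod_mul hV hh hh1) (integrable_prod_mul hW hh hh1),
    ← Real.norm_eq_abs]
  have hGi : ∀ i, Integrable fun u : Fin n → ℝ => ∏ j, g i j (u j) :=
    fun i => Integrable.fintype_prod (μ := fun _ => volume) (hgi i)
  refine (norm_integral_le_of_norm_le (g := fun u : Fin n → ℝ => ∑ i, ∏ j, g i j (u j))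
    (integrable_finsetSum _ fun i _ => hGi i) (Eventually.of_forall fun u => ?_)).trans ?_
  · rw [Real.norm_eq_abs, ← sub_mul, abs_mul]
    refine (mul_le_of_le_one_right (abs_nonneg _) (hh1 u)).trans ?_
    exact abs_prod_sub_prod_le (m := fun i => m (u i)) _ (fun i => hle _ (bV i) (zV i) _)
      (fun i => hle _ (bW i) (zW i) _)
  · rw [integral_finsetSum _ fun i _ => hGi i]
    have hi : ∀ i, ∫ u : Fin n → ℝ, ∏ j, g i j (u j) ≤ c * (2 * B * K) ^ (n - 1) := by
      intro i
      rw [integral_fintype_prod_volume_eq_prod, ← Finset.mul_prod_erase _ _ (Finset.mem_univ i)]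
      have e : ∏ j ∈ Finset.univ.erase i, ∫ u, g i j u = (2 * B * K) ^ (n - 1) := by
        rw [Finset.prod_congr rfl (g := fun _ => 2 * B * K), Finset.prod_const,
          Finset.card_erase_of_mem (Finset.mem_univ i), Finset.card_univ, Fintype.card_fin]
        intro j hj
        simp only [hg, if_neg (Finset.ne_of_mem_erase hj)]
        exact hmint
      rw [e]
      refine mul_le_mul_of_nonneg_right ?_ (by positivity)
      simpa only [hg, if_true] using hc i
    refine (Finset.sum_le_sum fun i _ => hi i).trans ?_
    simp

/-! ### Volumes of ellipsoidal shells -/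

/-- The region between two concentric similar ellipsoids. -/
def shell (P : Fin n → ℝ) (r R : ℝ) : Set (Fin n → ℝ) := {u | ∑ i, P i * u i ^ 2 ∈ Icc r R}

theorem measurable_quadratic (P : Fin n → ℝ) :
    Measurable fun u : Fin n → ℝ => ∑ i, P i * u i ^ 2 :=
  (by fun_prop : Continuous fun u : Fin n → ℝ => ∑ i, P i * u i ^ 2).measurable

theorem measurableSet_shell (P : Fin n → ℝ) (r R : ℝ) : MeasurableSet (shell P r R) :=
  measurable_quadratic P measurableSet_Icc

theorem isBounded_ellipsoid {P : Fin n → ℝ} (hP : ∀ i, 0 < P i) (R : ℝ) :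
    Bornology.IsBounded {u : Fin n → ℝ | ∑ i, P i * u i ^ 2 ≤ R} := by
  refine (Bornology.IsBounded.pi fun i => Metric.isBounded_Icc (-(R / P i + 1)) (R / P i + 1)).subset
    fun u hu i _ => ?_
  have h1 : P i * u i ^ 2 ≤ R :=
    (Finset.single_le_sum (f := fun i => P i * u i ^ 2)
      (fun j _ => mul_nonneg (hP j).le (sq_nonneg _)) (Finset.mem_univ i)).trans hu
  have h2 : u i ^ 2 ≤ R / P i := by rw [le_div_iff₀ (hP i)]; linarith
  exact ⟨by nlinarith [sq_nonneg (u i + 1)], by nlinarith [sq_nonneg (u i - 1)]⟩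

theorem volume_ellipsoid_lt_top {P : Fin n → ℝ} (hP : ∀ i, 0 < P i) (R : ℝ) :
    volume {u : Fin n → ℝ | ∑ i, P i * u i ^ 2 ≤ R} < ⊤ :=
  (isBounded_ellipsoid hP R).measure_lt_top

theorem volume_real_ellipsoid (P : Fin n → ℝ) {ρ : ℝ} (hρ : 0 < ρ) :
    volume.real {u : Fin n → ℝ | ∑ i, P i * u i ^ 2 ≤ ρ ^ 2} =
      ρ ^ n * volume.real {u : Fin n → ℝ | ∑ i, P i * u i ^ 2 ≤ 1} := by
  have : {u : Fin n → ℝ | ∑ i, P i * u i ^ 2 ≤ ρ ^ 2} =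
      ρ • {u : Fin n → ℝ | ∑ i, P i * u i ^ 2 ≤ 1} := by
    ext u
    rw [mem_smul_set_iff_inv_smul_mem₀ hρ.ne', mem_ofPred_eq, mem_ofPred_eq]
    have : ∑ i, P i * (ρ⁻¹ • u) i ^ 2 = (∑ i, P i * u i ^ 2) / ρ ^ 2 := by
      rw [Finset.sum_div]
      refine Finset.sum_congr rfl fun i _ => ?_
      rw [Pi.smul_apply, smul_eq_mul]
      field_simp
    rw [this, div_le_one (by positivity)]
  rw [this, Measure.real, Measure.addHaar_smul, ENNReal.toReal_mul, Module.finrank_fin_fun,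
    ENNReal.toReal_ofReal (abs_nonneg _), abs_of_pos (by positivity), Measure.real]

theorem volume_shell_lt_top {P : Fin n → ℝ} (hP : ∀ i, 0 < P i) (r R : ℝ) :
    volume (shell P r R) < ⊤ :=
  (measure_mono fun _ hu => hu.2).trans_lt (volume_ellipsoid_lt_top hP R)

/-- The shell lies between the ellipsoids of radii `1 ± 2δ`, whose volumes scale like `n`-th powers
of the radius. -/
theorem exists_volume_shell_le {P : Fin n → ℝ} (hP : ∀ i, 0 < P i) :
    ∃ C, 0 ≤ C ∧ ∀ δ, 0 < δ → δ ≤ 1 / 4 →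
      volume.real (shell P (1 - 2 * δ) (1 + 2 * δ)) ≤ C * δ := by
  set E : ℝ → Set (Fin n → ℝ) := fun R => {u | ∑ i, P i * u i ^ 2 ≤ R} with hE
  refine ⟨4 * n * 2 ^ (n - 1) * volume.real (E 1), by positivity, fun δ hδ hδ' => ?_⟩
  -- The form is compared with squared radii: `(1 - 2δ)² < 1 - 2δ` because `0 < 2δ < 1`, and `1 + 2δ
  -- ≤ (1 + 2δ)²`.
  have hsub : shell P (1 - 2 * δ) (1 + 2 * δ) ⊆ E ((1 + 2 * δ) ^ 2) \ E ((1 - 2 * δ) ^ 2) := by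
    rintro u ⟨h1, h2⟩
    refine ⟨?_, fun h => ?_⟩
    · simp only [hE, mem_ofPred_eq]; nlinarith
    · simp only [hE, mem_ofPred_eq] at h; nlinarith
  have hmeas : ∀ R, MeasurableSet (E R) := fun R => measurable_quadratic P measurableSet_Iic
  have hss : E ((1 - 2 * δ) ^ 2) ⊆ E ((1 + 2 * δ) ^ 2) := fun u hu => by
    simp only [hE, mem_ofPred_eq] at hu ⊢; nlinarith
  have hle : volume.real (shell P (1 - 2 * δ) (1 + 2 * δ)) ≤
      volume.real (E ((1 + 2 * δ) ^ 2) \ E ((1 - 2 * δ) ^ 2)) :=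
    measureReal_mono hsub
      ((measure_mono sdiff_subset).trans_lt (volume_ellipsoid_lt_top hP _)).ne
  rw [measureReal_sdiff hss (hmeas _) (volume_ellipsoid_lt_top hP _).ne,
    volume_real_ellipsoid P (by linarith), volume_real_ellipsoid P (by linarith), ← sub_mul] at hle
  refine hle.trans ?_
  have h := (le_abs_self _).trans (abs_pow_sub_pow_le (1 + 2 * δ) (1 - 2 * δ) n)
  have hmax : max |1 + 2 * δ| |1 - 2 * δ| ≤ 2 :=
    max_le (abs_le.2 ⟨by linarith, by linarith⟩) (abs_le.2 ⟨by linarith, by linarith⟩)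
  have h' : (1 + 2 * δ) ^ n - (1 - 2 * δ) ^ n ≤ 4 * δ * n * 2 ^ (n - 1) := by
    refine h.trans ?_
    rw [show 1 + 2 * δ - (1 - 2 * δ) = 4 * δ by ring, abs_of_pos (by linarith)]
    gcongr
  calc _ ≤ 4 * δ * n * 2 ^ (n - 1) * volume.real (E 1) := by gcongr
    _ = _ := by ring

theorem abs_integral_le_volume_shell {P : Fin n → ℝ} (hP : ∀ i, 0 < P i) {c r R : ℝ}
    {f : (Fin n → ℝ) → ℝ} (h0 : ∀ u, u ∉ shell P r R → f u = 0) (hc : ∀ u, |f u| ≤ c) :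
    |∫ u, f u| ≤ c * volume.real (shell P r R) := by
  have hi : Integrable ((shell P r R).indicator fun _ => c) :=
    (integrable_indicator_iff (measurableSet_shell P r R)).2
      (integrableOn_const (volume_shell_lt_top hP r R).ne)
  rw [← Real.norm_eq_abs]
  refine (norm_integral_le_of_norm_le hi (Eventually.of_forall fun u => ?_)).trans_eq ?_
  · by_cases hu : u ∈ shell P r R
    · rw [indicator_of_mem hu]; exact hc u
    · rw [indicator_of_notMem hu, h0 u hu, norm_zero]
  · rw [integral_indicator_const _ (measurableSet_shell P r R), smul_eq_mul, mul_comm]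

end LatticeEllipsoid

namespace LatticeEllipsoid
open MeasureTheory Set
open scoped Real Topology

/-! ### The sharp cutoff -/

/-- The indicator function of `(-∞, 1]`. -/
noncomputable def leOne (s : ℝ) : ℝ := if s ≤ 1 then 1 else 0

theorem measurable_leOne : Measurable leOne :=
  Measurable.ite measurableSet_Iic measurable_const measurable_const

theorem abs_leOne_le (s : ℝ) : |leOne s| ≤ 1 := by
  unfold leOne; split_ifs <;> simp

/-- A smooth majorant of the indicator function of `[0, 1]`. -/
noncomputable def upperCutoff (δ s : ℝ) : ℝ := smoothStep (-2) 1 s - smoothStep 1 δ s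

/-- A smooth majorant of the indicator function of `[1, 1 + δ]`. -/
noncomputable def edgeCutoff (δ s : ℝ) : ℝ := smoothStep (1 - δ) δ s - smoothStep (1 + δ) δ s

theorem abs_upperCutoff_le (δ s : ℝ) : |upperCutoff δ s| ≤ 1 := by
  have h1 := smoothStep_nonneg (-2) 1 s
  have h2 := smoothStep_le_one (-2) 1 s
  have h3 := smoothStep_nonneg 1 δ s
  have h4 := smoothStep_le_one 1 δ s
  exact abs_le.2 ⟨by rw [upperCutoff]; linarith, by rw [upperCutoff]; linarith⟩

theorem edgeCutoff_nonneg {δ : ℝ} (hδ : 0 < δ) (s : ℝ) : 0 ≤ edgeCutoff δ s := by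
  rcases le_total s (1 + δ) with h | h
  · rw [edgeCutoff, smoothStep_eq_zero hδ h, sub_zero]; exact smoothStep_nonneg _ _ _
  · rw [edgeCutoff, smoothStep_eq_one hδ (by linarith)]
    linarith [smoothStep_le_one (1 + δ) δ s]

theorem edgeCutoff_le_one (δ s : ℝ) : edgeCutoff δ s ≤ 1 := by
  rw [edgeCutoff]
  linarith [smoothStep_le_one (1 - δ) δ s, smoothStep_nonneg (1 + δ) δ s]

theorem edgeCutoff_eq_zero {δ s : ℝ} (hδ : 0 < δ) (hs : s ∉ Icc (1 - 2 * δ) (1 + 2 * δ)) :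
    edgeCutoff δ s = 0 := by
  rw [mem_Icc, not_and_or, not_le, not_le] at hs
  rcases hs with h | h
  · rw [edgeCutoff, smoothStep_eq_zero hδ (by linarith), smoothStep_eq_zero hδ (by linarith),
      sub_self]
  · rw [edgeCutoff, smoothStep_eq_one hδ (by linarith), smoothStep_eq_one hδ (by linarith),
      sub_self]

/-- The rising step of `upperCutoff` ends at `-1` and is invisible to values of a nonnegative form.
The two functions then differ only on `(1, 1 + δ]`, where `edgeCutoff` equals `1`. -/
theorem abs_upperCutoff_sub_leOne_le {δ s : ℝ} (hδ : 0 < δ) (hs : 0 ≤ s) :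
    |upperCutoff δ s - leOne s| ≤ edgeCutoff δ s := by
  have hone : smoothStep (-2) 1 s = 1 := smoothStep_eq_one one_pos (by linarith)
  rw [upperCutoff, hone]
  rcases le_or_gt s 1 with h | h
  · rw [smoothStep_eq_zero hδ h, leOne, if_pos h, sub_zero, sub_self, abs_zero]
    exact edgeCutoff_nonneg hδ s
  rw [leOne, if_neg (not_le.2 h), sub_zero]
  rcases le_or_gt s (1 + δ) with h' | h'
  · rw [edgeCutoff, smoothStep_eq_one hδ (by linarith : 1 - δ + δ ≤ s), smoothStep_eq_zero hδ h',
      sub_zero]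
    have h3 := smoothStep_nonneg 1 δ s
    have h4 := smoothStep_le_one 1 δ s
    exact abs_le.2 ⟨by linarith, by linarith⟩
  · rw [smoothStep_eq_one hδ h'.le, sub_self, abs_zero]
    exact edgeCutoff_nonneg hδ s

variable {n : ℕ} {P : Fin n → ℝ} {M : ℝ}

theorem quadratic_nonneg (hP : ∀ i, 0 < P i) (u : Fin n → ℝ) : 0 ≤ ∑ i, P i * u i ^ 2 :=
  Finset.sum_nonneg fun i _ => mul_nonneg (hP i).le (sq_nonneg _)

theorem abs_le_of_quadratic_le (hP : ∀ i, 0 < P i) {R : ℝ} (hM : 0 ≤ M)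
    (hPM : ∀ i, R ≤ P i * M ^ 2) {u : Fin n → ℝ} (hu : ∑ i, P i * u i ^ 2 ≤ R) (i : Fin n) :
    |u i| ≤ M := by
  have h1 : P i * u i ^ 2 ≤ R :=
    (Finset.single_le_sum (f := fun i => P i * u i ^ 2)
      (fun j _ => mul_nonneg (hP j).le (sq_nonneg _)) (Finset.mem_univ i)).trans hu
  exact abs_le_of_sq_le_sq (le_of_mul_le_mul_left (h1.trans (hPM i)) (hP i)) hM

/-- Where `edgeCutoff` is nonzero the form is at most `2`, so every coordinate lies in the flat part
of the plateau. Inserting the plateaus supplies the product weights needed to apply the smooth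
estimate to the edge itself. -/
theorem prod_plateau_mul_edgeCutoff (hP : ∀ i, 0 < P i) (hM : 0 < M)
    (hPM : ∀ i, 2 ≤ P i * M ^ 2) {δ : ℝ} (hδ : 0 < δ) (hδ' : δ ≤ 1 / 4) (u : Fin n → ℝ) :
    (∏ i, plateau M (u i)) * edgeCutoff δ (∑ i, P i * u i ^ 2) =
      edgeCutoff δ (∑ i, P i * u i ^ 2) := by
  by_cases hs : ∑ i, P i * u i ^ 2 ≤ 2
  · rw [Finset.prod_eq_one, one_mul]
    exact fun i _ => plateau_eq_one hM (abs_le_of_quadratic_le hP hM.le hPM hs i)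
  · rw [edgeCutoff_eq_zero hδ (fun h => hs (by linarith [h.2])), mul_zero]

/-- The main estimate for the sharp cutoff, obtained from the smooth one by a sandwich argument. -/
theorem exists_abs_sum_sub_integral_leOne_le {K : ℝ} (hn : 2 ≤ n) (hP : ∀ i, 0 < P i)
    (hM : 0 < M) (hPM : ∀ i, 2 ≤ P i * M ^ 2) (hK : 0 ≤ K) :
    ∃ C, 0 ≤ C ∧ ∀ (y : Fin n → ℝ) (V V₁ V₂ : Fin n → ℝ → ℝ) (δ Λ : ℝ) (I : Finset ℤ),
      (∀ i, IsAmplitude (2 * M + 1) K (V i) (V₁ i) (V₂ i)) → 0 < δ → δ ≤ 1 / 4 → 1 ≤ Λ →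
      (∀ i, ∀ k : ℤ, k ∉ I → (2 * M + 1) * Λ ≤ |y i + k|) →
      |∑ k ∈ Fintype.piFinset (fun _ : Fin n => I), (∏ i, V i ((y i + k i) / Λ)) *
          leOne (∑ i, P i * ((y i + k i) / Λ) ^ 2) -
        Λ ^ n * ∫ u : Fin n → ℝ, (∏ i, V i (u i)) * leOne (∑ i, P i * u i ^ 2)| ≤
      C * Λ ^ n * (1 / Λ ^ 2 + (1 / √Λ) ^ (n + 1) / √(δ * Λ) ^ (n - 1) + δ) := by
  have hB : 0 < 2 * M + 1 := by positivity
  obtain ⟨Kp, hp⟩ := exists_isAmplitude_plateau hM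
  obtain ⟨Kc, hcut⟩ := exists_isCutoff n
  have hup : ∀ δ, 0 < δ → δ ≤ 1 / 4 → ∃ ψ ψ', IsCutoff n Kc δ (upperCutoff δ) ψ ψ' :=
    fun δ h h' => hcut (-2) 1 1 δ δ h (by linarith) le_rfl le_rfl (by linarith)
      (by norm_num) (by simpa using h.le)
  have hed : ∀ δ, 0 < δ → δ ≤ 1 / 4 → ∃ ψ ψ', IsCutoff n Kc δ (edgeCutoff δ) ψ ψ' :=
    fun δ h h' => hcut (1 - δ) δ (1 + δ) δ δ h le_rfl (by linarith) le_rfl (by linarith)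
      (by rw [abs_le]; constructor <;> linarith) (by rw [abs_le]; constructor <;> linarith)
  have hKc : 0 ≤ Kc := by
    obtain ⟨ψ, ψ', h⟩ := hup (1 / 4) (by norm_num) le_rfl
    exact (norm_nonneg _).trans (h.norm_le 0)
  obtain ⟨C₁, hC1, h1⟩ := exists_abs_sum_sub_integral_le (P := P) hn hB hK hP Kc hKc
  obtain ⟨C₂, hC2, h2⟩ := exists_abs_sum_sub_integral_le (P := P) hn hB (hp.nonneg hB) hP Kc hKc
  obtain ⟨C₃, hC3, h3⟩ := exists_volume_shell_le hP
  set A := (2 * (2 * M + 1) * K) ^ n with hA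
  have hA0 : 0 ≤ A := by positivity
  refine ⟨A * C₂ + C₁ + 2 * A * C₃, by positivity, fun y V V₁ V₂ δ Λ I hV hδ hδ' hΛ hI => ?_⟩
  set err := 1 / Λ ^ 2 + (1 / √Λ) ^ (n + 1) / √(δ * Λ) ^ (n - 1) with herr
  have herr0 : 0 ≤ err := by positivity
  have hΛ0 : 0 < Λ := by linarith
  obtain ⟨ψ, ψ', hψ⟩ := hup δ hδ hδ'
  obtain ⟨φ, φ', hφ⟩ := hed δ hδ hδ'
  have e1 := h1 y V V₁ V₂ δ _ ψ ψ' Λ I hV hψ hδ hΛ hI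
  -- The weights `V i` may change sign, so monotonicity is not available. The sharp and smooth sums
  -- are instead compared in absolute value, and the smooth estimate is applied a second time to
  -- count lattice points near the boundary.
  have e2 := h2 y (fun _ => plateau M) _ _ δ _ φ φ' Λ I (fun _ => hp) hφ hδ hΛ hI
  have hprod : ∀ u : Fin n → ℝ, |∏ i, V i (u i)| ≤ A := fun u => by
    have : A = ∏ _i : Fin n, 2 * (2 * M + 1) * K := by simp [hA]
    rw [Finset.abs_prod, this]
    exact Finset.prod_le_prod (fun _ _ => abs_nonneg _) fun i _ => (hV i).abs_le hB _
  have hpt : ∀ u : Fin n → ℝ,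
      |(∏ i, V i (u i)) * leOne (∑ i, P i * u i ^ 2) -
        (∏ i, V i (u i)) * upperCutoff δ (∑ i, P i * u i ^ 2)| ≤
      A * edgeCutoff δ (∑ i, P i * u i ^ 2) := fun u => by
    rw [← mul_sub, abs_mul, abs_sub_comm]
    exact mul_le_mul (hprod u) (abs_upperCutoff_sub_leOne_le hδ (quadratic_nonneg hP u))
      (abs_nonneg _) hA0
  have hm := measurable_quadratic P
  have hVi : ∀ i, Integrable (V i) := fun i => (hV i).integrable
  have hvol := h3 δ hδ hδ'
  have j1 : |(∫ u : Fin n → ℝ, (∏ i, V i (u i)) * leOne (∑ i, P i * u i ^ 2)) -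
      ∫ u : Fin n → ℝ, (∏ i, V i (u i)) * upperCutoff δ (∑ i, P i * u i ^ 2)| ≤ A * (C₃ * δ) := by
    have i1 : Integrable fun u : Fin n → ℝ => (∏ i, V i (u i)) * leOne (∑ i, P i * u i ^ 2) :=
      integrable_prod_mul hVi (measurable_leOne.comp hm) fun _ => abs_leOne_le _
    have i2 : Integrable fun u : Fin n → ℝ =>
        (∏ i, V i (u i)) * upperCutoff δ (∑ i, P i * u i ^ 2) :=
      integrable_prod_mul hVi (hψ.continuous.measurable.comp hm) fun _ => abs_upperCutoff_le _ _
    rw [← integral_sub i1 i2]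
    refine (abs_integral_le_volume_shell hP (r := 1 - 2 * δ) (R := 1 + 2 * δ) (fun u hu => ?_)
      fun u => (hpt u).trans (mul_le_of_le_one_right hA0 (edgeCutoff_le_one _ _))).trans
      (mul_le_mul_of_nonneg_left hvol hA0)
    have := hpt u
    rw [edgeCutoff_eq_zero hδ hu, mul_zero] at this
    exact abs_nonpos_iff.1 this
  have j2 : |∫ u : Fin n → ℝ, (∏ i, plateau M (u i)) * edgeCutoff δ (∑ i, P i * u i ^ 2)| ≤
      C₃ * δ := by
    simp only [prod_plateau_mul_edgeCutoff hP hM hPM hδ hδ']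
    refine (abs_integral_le_volume_shell hP (r := 1 - 2 * δ) (R := 1 + 2 * δ) (c := 1)
      (fun u hu => edgeCutoff_eq_zero hδ hu) fun u => ?_).trans (by linarith)
    rw [abs_of_nonneg (edgeCutoff_nonneg hδ _)]
    exact edgeCutoff_le_one _ _
  set J := ∫ u : Fin n → ℝ, (∏ i, V i (u i)) * leOne (∑ i, P i * u i ^ 2)
  set J' := ∫ u : Fin n → ℝ, (∏ i, V i (u i)) * upperCutoff δ (∑ i, P i * u i ^ 2)
  have s1 : |∑ k ∈ Fintype.piFinset (fun _ : Fin n => I), (∏ i, V i ((y i + k i) / Λ)) *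
        leOne (∑ i, P i * ((y i + k i) / Λ) ^ 2) -
      ∑ k ∈ Fintype.piFinset (fun _ : Fin n => I), (∏ i, V i ((y i + k i) / Λ)) *
        upperCutoff δ (∑ i, P i * ((y i + k i) / Λ) ^ 2)| ≤
      A * ∑ k ∈ Fintype.piFinset (fun _ : Fin n => I),
        (∏ i, plateau M ((y i + k i) / Λ)) * edgeCutoff δ (∑ i, P i * ((y i + k i) / Λ) ^ 2) := by
    rw [← Finset.sum_sub_distrib, Finset.mul_sum]
    refine (Finset.abs_sum_le_sum_abs _ _).trans (Finset.sum_le_sum fun k _ => ?_)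
    rw [prod_plateau_mul_edgeCutoff hP hM hPM hδ hδ' fun i => (y i + k i) / Λ]
    exact hpt fun i => (y i + k i) / Λ
  set S := ∑ k ∈ Fintype.piFinset (fun _ : Fin n => I), (∏ i, V i ((y i + k i) / Λ)) *
    leOne (∑ i, P i * ((y i + k i) / Λ) ^ 2)
  set S' := ∑ k ∈ Fintype.piFinset (fun _ : Fin n => I), (∏ i, V i ((y i + k i) / Λ)) *
    upperCutoff δ (∑ i, P i * ((y i + k i) / Λ) ^ 2)
  set S'' := ∑ k ∈ Fintype.piFinset (fun _ : Fin n => I),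
    (∏ i, plateau M ((y i + k i) / Λ)) * edgeCutoff δ (∑ i, P i * ((y i + k i) / Λ) ^ 2)
  have hΛn : 0 ≤ Λ ^ n := by positivity
  have b1 : S'' ≤ C₂ * Λ ^ n * err + Λ ^ n * (C₃ * δ) := by
    have := mul_le_mul_of_nonneg_left ((le_abs_self _).trans j2) hΛn
    linarith [(abs_le.1 e2).2]
  have b2 : |Λ ^ n * (J' - J)| ≤ Λ ^ n * (A * (C₃ * δ)) := by
    rw [abs_mul, abs_of_nonneg hΛn, abs_sub_comm]
    exact mul_le_mul_of_nonneg_left j1 hΛn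
  calc |S - Λ ^ n * J| = |(S - S') + (S' - Λ ^ n * J') + Λ ^ n * (J' - J)| := by ring_nf
    _ ≤ A * (C₂ * Λ ^ n * err + Λ ^ n * (C₃ * δ)) + C₁ * Λ ^ n * err +
        Λ ^ n * (A * (C₃ * δ)) := by
      refine (abs_add_le _ _).trans (add_le_add ((abs_add_le _ _).trans (add_le_add ?_ e1)) b2)
      exact s1.trans (mul_le_mul_of_nonneg_left b1 hA0)
    _ = (A * C₂ + C₁) * Λ ^ n * err + 2 * A * C₃ * Λ ^ n * δ := by ring
    _ ≤ (A * C₂ + C₁ + 2 * A * C₃) * Λ ^ n * err + (A * C₂ + C₁ + 2 * A * C₃) * Λ ^ n * δ := by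
      have t1 : 0 ≤ A * C₂ + C₁ := by positivity
      have t2 : 0 ≤ 2 * A * C₃ := by positivity
      exact add_le_add
        (mul_le_mul_of_nonneg_right (mul_le_mul_of_nonneg_right (by linarith) hΛn) herr0)
        (mul_le_mul_of_nonneg_right (mul_le_mul_of_nonneg_right (by linarith) hΛn) hδ.le)
    _ = _ := by ring

/-! ### The weighted lattice sum -/

/-- Vectors with a negative coordinate may be added freely, since `smoothTrunc` vanishes there; the
sum then runs over a full box of integers. -/
theorem weightedLatticeSum_eq_sum (y P : Fin n → ℝ) (Q : Fin n → Polynomial ℝ) (R : ℝ)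
    (I : Finset ℤ)
    (hI : ∀ k : Fin n → ℤ, ∑ i, P i * (y i + k i) ^ 2 ≤ R → ∀ i, k i ∈ I) :
    weightedLatticeSum y P Q R = ∑ k ∈ Fintype.piFinset (fun _ : Fin n => I),
      if ∑ i, P i * (y i + k i) ^ 2 ≤ R then ∏ i, smoothTrunc (Q i) (y i) (y i + k i) else 0 := by
  classical
  set T := (Fintype.piFinset (fun _ : Fin n => I)).filter
    fun k => (∀ i, 0 ≤ k i) ∧ ∑ i, P i * (y i + k i) ^ 2 ≤ R with hT
  set φ : (Fin n → ℤ) → Fin n → ℝ := fun k i => y i + k i with hφ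
  have hinj : Function.Injective φ := fun k l h => funext fun i => by
    have := congrFun h i
    simp only [hφ] at this
    exact_mod_cast add_left_cancel this
  have hset : shiftedEllipsoidPoints y P R = ↑(T.image φ) := by
    ext m
    simp only [Finset.coe_image, mem_image, Finset.mem_coe, hT, Finset.mem_filter,
      Fintype.mem_piFinset]
    constructor
    · rintro ⟨hm, hR⟩
      choose k hk using hm
      have hmk : m = φ fun i => (k i : ℤ) := funext fun i => by
        simp only [hφ, Int.cast_natCast, ← hk i]; ring
      have hR' : ∑ i, P i * (y i + ((k i : ℤ) : ℝ)) ^ 2 ≤ R := by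
        rw [hmk] at hR; exact hR
      exact ⟨fun i => (k i : ℤ), ⟨hI _ hR', fun i => Int.natCast_nonneg _, hR'⟩, hmk.symm⟩
    · rintro ⟨k, ⟨-, h0, hR⟩, rfl⟩
      refine ⟨fun i => ⟨(k i).toNat, ?_⟩, hR⟩
      have : (((k i).toNat : ℤ) : ℝ) = k i := by rw [Int.toNat_of_nonneg (h0 i)]
      simp only [hφ, add_sub_cancel_left, ← this, Int.cast_natCast]
  rw [weightedLatticeSum, hset, finsum_mem_coe_finset, Finset.sum_image hinj.injOn, hT,
    Finset.sum_filter]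
  refine Finset.sum_congr rfl fun k _ => ?_
  by_cases h0 : ∀ i, 0 ≤ k i
  · simp only [h0, implies_true, true_and, hφ, smoothTrunc_add_int, if_true]
  · simp only [h0, false_and, if_false]
    push Not at h0
    obtain ⟨i, hi⟩ := h0
    split_ifs
    · rw [Finset.prod_eq_zero (Finset.mem_univ i)]
      rw [smoothTrunc_add_int, if_neg (not_le.2 hi)]
    · rfl

theorem limitWeight_eq_zero (q : Polynomial ℝ) (hM : 0 < M) (m : ℕ) {u : ℝ}
    (hu : 2 * M + 1 ≤ |u|) : limitWeight q M m u = 0 := by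
  rw [limitWeight, plateau_eq_zero hM (by linarith), mul_zero]

theorem exists_abs_limitWeight_le (q : Polynomial ℝ) (hM : 0 < M) (m : ℕ) :
    ∃ K, ∀ u, |limitWeight q M m u| ≤ K := by
  obtain ⟨K, hK⟩ := isCompact_Icc.exists_bound_of_continuousOn
    (s := Icc (-(2 * M + 1)) (2 * M + 1)) (continuous_limitWeight q M m).continuousOn
  have hK0 : 0 ≤ K := (norm_nonneg _).trans (hK 0 ⟨by linarith, by linarith⟩)
  refine ⟨K, fun u => ?_⟩
  rcases le_total |u| (2 * M + 1) with h | h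
  · exact hK u (abs_le.1 h)
  · rw [limitWeight_eq_zero q hM m h, abs_zero]; exact hK0

theorem integrable_limitWeight (q : Polynomial ℝ) (hM : 0 < M) (m : ℕ) :
    Integrable (limitWeight q M m) :=
  (continuous_limitWeight q M m).integrable_of_hasCompactSupport
    (HasCompactSupport.intro (isCompact_Icc (a := -(2 * M + 1)) (b := 2 * M + 1)) fun u hu =>
      limitWeight_eq_zero q hM m (by
        by_contra h
        exact hu (abs_le.1 (not_le.1 h).le)))

/-- Each coordinate releases `Λ^(m i + 1)`, and the plateaus cost nothing because they equal `1` on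
the ellipsoid. -/
theorem sum_smoothTrunc_eq (hP : ∀ i, 0 < P i) (hM : 0 < M) (hPM : ∀ i, 2 ≤ P i * M ^ 2)
    (Q : Fin n → Polynomial ℝ) (y : Fin n → ℝ) (m : Fin n → ℕ) {Λ : ℝ} (hΛ : 0 < Λ)
    (x : Fin n → ℝ) :
    (if ∑ i, P i * x i ^ 2 ≤ Λ ^ 2 then ∏ i, smoothTrunc (Q i) (y i) (x i) else 0) =
      Λ ^ (∑ i, (m i + 1)) * ((∏ i, scaledWeight (Q i) (y i) M (m i) Λ (x i / Λ)) *
        leOne (∑ i, P i * (x i / Λ) ^ 2)) := by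
  have hs : ∑ i, P i * (x i / Λ) ^ 2 = (∑ i, P i * x i ^ 2) / Λ ^ 2 := by
    rw [Finset.sum_div]
    refine Finset.sum_congr rfl fun i _ => ?_
    rw [div_pow, mul_div_assoc]
  have hiff : ∑ i, P i * (x i / Λ) ^ 2 ≤ 1 ↔ ∑ i, P i * x i ^ 2 ≤ Λ ^ 2 := by
    rw [hs, div_le_one (by positivity)]
  by_cases h : ∑ i, P i * x i ^ 2 ≤ Λ ^ 2
  · rw [if_pos h, leOne, if_pos (hiff.2 h), mul_one, ← Finset.prod_pow_eq_pow_sum,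
      ← Finset.prod_mul_distrib]
    refine Finset.prod_congr rfl fun i _ => ?_
    rw [scaledWeight, plateau_eq_one hM (abs_le_of_quadratic_le (u := fun i => x i / Λ) hP hM.le
      hPM ((hiff.2 h).trans one_le_two) i), mul_div_cancel₀ _ hΛ.ne']
    field_simp
  · rw [if_neg h, leOne, if_neg (fun h' => h (hiff.1 h')), mul_zero, mul_zero]

/-- The asymptotics of the weighted lattice sum, with the smoothing parameter still free. -/
theorem exists_abs_weightedLatticeSum_sub_le (hn : 2 ≤ n) (Q : Fin n → Polynomial ℝ)
    (m : Fin n → ℕ) (hQ : ∀ i, (Q i).natDegree ≤ m i + 1) (hQ' : ∀ i, (Q i).coeff (m i) = 0)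
    (y : Fin n → ℝ) (hP : ∀ i, 0 < P i) :
    ∃ C₀ C, 0 ≤ C ∧ ∀ Λ δ, 1 ≤ Λ → 0 < δ → δ ≤ 1 / 4 →
      |weightedLatticeSum y P Q (Λ ^ 2) - C₀ * Λ ^ (∑ i, (m i + 2))| ≤
        C * Λ ^ (∑ i, (m i + 2)) *
          (1 / Λ ^ 2 + (1 / √Λ) ^ (n + 1) / √(δ * Λ) ^ (n - 1) + δ) := by
  obtain ⟨M, hM, hPM⟩ : ∃ M, 0 < M ∧ ∀ i, 2 ≤ P i * M ^ 2 := by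
    have h0 : ∀ j, 0 ≤ 2 / P j := fun j => by have := (hP j).le; positivity
    have hs : 0 ≤ ∑ i, 2 / P i := Finset.sum_nonneg fun i _ => h0 i
    refine ⟨1 + ∑ i, 2 / P i, by linarith, fun i => ?_⟩
    have h1 : 2 / P i ≤ ∑ i, 2 / P i :=
      Finset.single_le_sum (fun j _ => h0 j) (Finset.mem_univ i)
    have h2 : 2 / P i ≤ (1 + ∑ i, 2 / P i) ^ 2 := by nlinarith [h0 i]
    rw [div_le_iff₀ (hP i)] at h2
    linarith
  have hB : 0 < 2 * M + 1 := by positivity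
  choose K hK using fun i => exists_isAmplitude_scaledWeight (Q i) (y i) hM (hQ i)
  choose K' hK' using fun i => exists_abs_limitWeight_le (Q i) hM (m i)
  choose c hc0 hc using fun i => exists_integral_abs_sub_limitWeight_le (Q i) (y i) hM (hQ i) (hQ' i)
  have hK0 : ∀ i, 0 ≤ K i := fun i => by
    obtain ⟨V₁, V₂, h⟩ := hK i 1 le_rfl
    exact h.nonneg hB
  have hK0' : ∀ i, 0 ≤ K' i := fun i => (abs_nonneg _).trans (hK' i 0)
  have hKs : ∀ i, K i ≤ ∑ i, K i := fun i =>
    Finset.single_le_sum (fun j _ => hK0 j) (Finset.mem_univ i)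
  have hKs' : ∀ i, K' i ≤ ∑ i, K' i := fun i =>
    Finset.single_le_sum (fun j _ => hK0' j) (Finset.mem_univ i)
  have hcs : ∀ i, c i ≤ ∑ i, c i := fun i =>
    Finset.single_le_sum (fun j _ => hc0 j) (Finset.mem_univ i)
  have hKsum : 0 ≤ ∑ i, K i := Finset.sum_nonneg fun i _ => hK0 i
  have hKsum' : 0 ≤ ∑ i, K' i := Finset.sum_nonneg fun i _ => hK0' i
  have hcsum : 0 ≤ ∑ i, c i := Finset.sum_nonneg fun i _ => hc0 i
  obtain ⟨C₁, hC1, h1⟩ := exists_abs_sum_sub_integral_leOne_le hn hP hM hPM hKsum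
  set A := 2 * (2 * M + 1) * (∑ i, K i) + ∑ i, K' i with hA
  have hA0 : 0 ≤ A := by positivity
  set C₂ := n * ((∑ i, c i) * (2 * (2 * M + 1) * A) ^ (n - 1)) with hC₂
  have hC2 : 0 ≤ C₂ := by positivity
  refine ⟨∫ u : Fin n → ℝ, (∏ i, limitWeight (Q i) M (m i) (u i)) * leOne (∑ i, P i * u i ^ 2),
    C₁ + C₂, by positivity, fun Λ δ hΛ hδ hδ' => ?_⟩
  have hΛ0 : 0 < Λ := by linarith
  choose V₁ V₂ hV using fun i => hK i Λ hΛ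
  have hV' : ∀ i, IsAmplitude (2 * M + 1) (∑ i, K i) (scaledWeight (Q i) (y i) M (m i) Λ)
    (V₁ i) (V₂ i) := fun i => (hV i).mono (hKs i)
  -- One box, depending on `Λ`, contains all integers at which any of the scaled weights can be
  -- nonzero.
  obtain ⟨I, hI⟩ : ∃ I : Finset ℤ, ∀ i, ∀ k : ℤ, k ∉ I → (2 * M + 1) * Λ ≤ |y i + k| := by
    set N : ℕ := ⌈(2 * M + 1) * Λ + ∑ i, |y i|⌉₊ with hN
    refine ⟨Finset.Icc (-N) N, fun i k hk => ?_⟩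
    have h3 : (N : ℝ) ≤ |(k : ℝ)| := by
      have : (N : ℤ) ≤ |k| := by
        by_contra hlt
        exact hk (Finset.mem_Icc.2 (abs_le.1 (not_le.1 hlt).le))
      exact_mod_cast this
    have h4 := Nat.le_ceil ((2 * M + 1) * Λ + ∑ i, |y i|)
    have h5 : |y i| ≤ ∑ i, |y i| :=
      Finset.single_le_sum (f := fun i => |y i|) (fun j _ => abs_nonneg _) (Finset.mem_univ i)
    have h6 : |(k : ℝ)| ≤ |y i + k| + |y i| := by
      calc |(k : ℝ)| = |(y i + k) - y i| := by ring_nf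
        _ ≤ _ := abs_sub _ _
    linarith
  have hbox : ∀ k : Fin n → ℤ, ∑ i, P i * (y i + k i) ^ 2 ≤ Λ ^ 2 → ∀ i, k i ∈ I := by
    intro k hk i
    by_contra hki
    have h3 := abs_le_of_quadratic_le (u := fun i => y i + k i) (M := M * Λ) hP (by positivity)
      (fun i => by
        have := hPM i
        calc Λ ^ 2 ≤ 2 * Λ ^ 2 := by nlinarith
          _ ≤ P i * M ^ 2 * Λ ^ 2 := by gcongr
          _ = _ := by ring) hk i
    have h4 := hI i (k i) hki
    nlinarith [mul_pos hM hΛ0]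
  have e1 := h1 y _ V₁ V₂ δ Λ I hV' hδ hδ' hΛ hI
  have hKA : ∀ i u, |scaledWeight (Q i) (y i) M (m i) Λ u| ≤ A := fun i u =>
    ((hV' i).abs_le hB u).trans (by linarith)
  have hKA' : ∀ i u, |limitWeight (Q i) M (m i) u| ≤ A := fun i u =>
    ((hK' i u).trans (hKs' i)).trans (by
      have : 0 ≤ 2 * (2 * M + 1) * ∑ i, K i := by positivity
      linarith)
  -- The integral in `e1` still depends on `Λ` through the weights; passing to the limit weights
  -- costs `O(Λ⁻²)` and leaves a constant.
  have e2 := abs_integral_prod_sub_le (h := fun u : Fin n → ℝ => leOne (∑ i, P i * u i ^ 2))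
    (c := (∑ i, c i) * (1 / Λ ^ 2)) hB.le hA0
    (fun i => (hV' i).integrable) (fun i => integrable_limitWeight (Q i) hM (m i)) hKA hKA'
    (fun i u => (hV' i).eq_zero u) (fun i u hu => limitWeight_eq_zero _ hM _ hu)
    (fun i => (hc i Λ hΛ).trans (mul_le_mul_of_nonneg_right (hcs i) (by positivity)))
    (measurable_leOne.comp (measurable_quadratic P)) fun _ => abs_leOne_le _
  rw [weightedLatticeSum_eq_sum y P Q _ I hbox]
  simp only [sum_smoothTrunc_eq hP hM hPM Q y m hΛ0]
  rw [← Finset.mul_sum]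
  have hexp : ∑ i, (m i + 2) = ∑ i, (m i + 1) + n := by
    have : ∀ i, m i + 2 = (m i + 1) + 1 := fun i => rfl
    simp only [this, Finset.sum_add_distrib, Finset.sum_const, Finset.card_univ, Fintype.card_fin]
    simp
  rw [hexp, pow_add]
  set D := Λ ^ ∑ i, (m i + 1) with hD
  have hD0 : 0 ≤ D := by positivity
  set S := ∑ k ∈ Fintype.piFinset (fun _ : Fin n => I),
    (∏ i, scaledWeight (Q i) (y i) M (m i) Λ ((y i + k i) / Λ)) *
      leOne (∑ i, P i * ((y i + k i) / Λ) ^ 2)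
  set J := ∫ u : Fin n → ℝ, (∏ i, scaledWeight (Q i) (y i) M (m i) Λ (u i)) *
    leOne (∑ i, P i * u i ^ 2)
  set J₀ := ∫ u : Fin n → ℝ, (∏ i, limitWeight (Q i) M (m i) (u i)) *
    leOne (∑ i, P i * u i ^ 2)
  set e := (1 / √Λ) ^ (n + 1) / √(δ * Λ) ^ (n - 1) with he
  have he0 : 0 ≤ e := by positivity
  have hJ : |J - J₀| ≤ C₂ * (1 / Λ ^ 2 + e + δ) := by
    refine e2.trans ?_
    calc _ = C₂ * (1 / Λ ^ 2) := by rw [hC₂]; ring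
      _ ≤ _ := by gcongr; linarith
  calc |D * S - J₀ * (D * Λ ^ n)| = |D * (S - Λ ^ n * J) + D * Λ ^ n * (J - J₀)| := by ring_nf
    _ ≤ D * (C₁ * Λ ^ n * (1 / Λ ^ 2 + e + δ)) + D * Λ ^ n * (C₂ * (1 / Λ ^ 2 + e + δ)) := by
      refine (abs_add_le _ _).trans (add_le_add ?_ ?_)
      · rw [abs_mul, abs_of_nonneg hD0]
        gcongr
      · rw [abs_mul, abs_of_nonneg (by positivity : 0 ≤ D * Λ ^ n)]
        gcongr
    _ = _ := by ring

/-! ### Optimising the smoothing parameter -/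

/-- With `θ = 2n/(n + 1)` and `δ = Λ^(-θ)`, the oscillatory error `Λ⁻ⁿ δ^(-(n-1)/2)` equals `δ`.
That `θ ≥ 1` and `Λ ≥ 4` ensures `δ ≤ 1/4`, and `θ ≤ 2` absorbs `Λ⁻²`. -/
theorem smoothing_balance (hn : 2 ≤ n) {Λ : ℝ} (hΛ : 4 ≤ Λ) :
    ∃ δ, 0 < δ ∧ δ ≤ 1 / 4 ∧
      1 / Λ ^ 2 + (1 / √Λ) ^ (n + 1) / √(δ * Λ) ^ (n - 1) + δ ≤
        3 * Λ ^ (-(2 * n / (n + 1) : ℝ)) := by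
  have hΛ0 : 0 < Λ := by linarith
  have hn' : (2 : ℝ) ≤ n := by exact_mod_cast hn
  have h1 : (1 : ℝ) ≤ 2 * n / (n + 1) := by rw [le_div_iff₀ (by linarith)]; linarith
  have h2 : 2 * n / (n + 1) ≤ (2 : ℝ) := by rw [div_le_iff₀ (by linarith)]; linarith
  set θ : ℝ := 2 * n / (n + 1) with hθ
  refine ⟨Λ ^ (-θ), by positivity, ?_, ?_⟩
  · calc Λ ^ (-θ) ≤ Λ ^ (-1 : ℝ) := Real.rpow_le_rpow_of_exponent_le (by linarith) (by linarith)
      _ = 1 / Λ := by rw [Real.rpow_neg_one, one_div]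
      _ ≤ 1 / 4 := one_div_le_one_div_of_le (by norm_num) hΛ
  · have e1 : 1 / Λ ^ 2 ≤ Λ ^ (-θ) := by
      have : 1 / Λ ^ 2 = Λ ^ (-2 : ℝ) := by
        rw [Real.rpow_neg hΛ0.le, one_div]; norm_num
      rw [this]
      exact Real.rpow_le_rpow_of_exponent_le (by linarith) (by linarith)
    have e2 : (1 / √Λ) ^ (n + 1) / √(Λ ^ (-θ) * Λ) ^ (n - 1) = Λ ^ (-θ) := by
      have a1 : (1 / √Λ) ^ (n + 1) = Λ ^ (-(n + 1 : ℝ) / 2) := by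
        rw [one_div, Real.sqrt_eq_rpow, ← Real.rpow_neg hΛ0.le, ← Real.rpow_mul_natCast hΛ0.le]
        congr 1; push_cast; ring
      have a2 : √(Λ ^ (-θ) * Λ) ^ (n - 1) = Λ ^ ((1 - θ) / 2 * (n - 1)) := by
        have : Λ ^ (-θ) * Λ = Λ ^ (1 - θ) := by
          rw [← Real.rpow_add_one hΛ0.ne']; congr 1; ring
        rw [this, Real.sqrt_eq_rpow, ← Real.rpow_mul hΛ0.le, ← Real.rpow_mul_natCast hΛ0.le,
          Nat.cast_sub (by omega)]
        congr 1; push_cast; ring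
      rw [a1, a2, ← Real.rpow_sub hΛ0]
      congr 1
      rw [hθ]
      field_simp
      ring
    rw [e2]
    linarith

/-- With `λ` for `lam`, `√(aλ² + b) = √a λ + O(1/λ)`, so replacing `Λ^d` by `(√a λ)^d` costs
`O(λ^(d-2))`, which is admissible because `θ ≤ 2`. -/
theorem isBigO_rescale {N : ℝ → ℝ} {a b C₀ C θ : ℝ} {d : ℕ} (ha : 0 < a) (hd : 2 ≤ d)
    (hθ : θ ≤ 2)
    (h : ∀ Λ, 4 ≤ Λ → |N (Λ ^ 2) - C₀ * Λ ^ d| ≤ C * Λ ^ d * Λ ^ (-θ)) (hC : 0 ≤ C) :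
    (fun lam : ℝ => N (a * lam ^ 2 + b) - C₀ * √a ^ d * lam ^ d) =O[atTop]
      fun lam : ℝ => lam ^ ((d : ℝ) - θ) := by
  have hd' : (2 : ℝ) ≤ d := by exact_mod_cast hd
  have hsa : 0 < √a := Real.sqrt_pos.2 ha
  have hsq : √a ^ 2 = a := Real.sq_sqrt ha.le
  refine IsBigO.of_bound (C * (2 * √a) ^ ((d : ℝ) - θ) +
    |C₀| * (|b| / √a * d * (2 * √a) ^ (d - 1))) ?_
  have t1 : Tendsto (fun lam : ℝ => a * lam ^ 2) atTop atTop :=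
    (tendsto_pow_atTop two_ne_zero).const_mul_atTop ha
  -- The threshold `16 + |b|` gives both `Λ ≥ 4` and `Λ ≤ 2√a λ`.
  filter_upwards [eventually_ge_atTop 1, t1.eventually_ge_atTop (16 + |b|)] with lam hl hl2
  have hl0 : 0 < lam := by linarith
  have hb := abs_le.1 (le_refl |b|)
  have hR : 16 ≤ a * lam ^ 2 + b := by linarith
  set Λ := √(a * lam ^ 2 + b) with hΛ
  have hΛ2 : Λ ^ 2 = a * lam ^ 2 + b := Real.sq_sqrt (by linarith)
  have hΛ4 : 4 ≤ Λ := Real.le_sqrt_of_sq_le (by linarith)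
  have hΛ0 : 0 < Λ := by linarith
  have hX : 0 < √a * lam := by positivity
  have hΛle : Λ ≤ 2 * √a * lam := by
    refine abs_le_of_sq_le_sq' ?_ (by positivity) |>.2
    rw [hΛ2, mul_pow, mul_pow, hsq]
    linarith
  have e1 := h Λ hΛ4
  rw [hΛ2] at e1
  have e2 : Λ ^ d * Λ ^ (-θ) ≤ (2 * √a) ^ ((d : ℝ) - θ) * lam ^ ((d : ℝ) - θ) := by
    rw [← Real.rpow_natCast, ← Real.rpow_add hΛ0, ← sub_eq_add_neg,
      ← Real.mul_rpow (by positivity) hl0.le]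
    exact Real.rpow_le_rpow hΛ0.le hΛle (by linarith)
  have e3 : |Λ ^ d - (√a * lam) ^ d| ≤
      |b| / √a * d * (2 * √a) ^ (d - 1) * lam ^ ((d : ℝ) - θ) := by
    have f1 : |Λ - √a * lam| ≤ |b| / (√a * lam) := by
      rw [le_div_iff₀ hX]
      have : (Λ - √a * lam) * (Λ + √a * lam) = b := by
        have : (Λ - √a * lam) * (Λ + √a * lam) = Λ ^ 2 - √a ^ 2 * lam ^ 2 := by ring
        rw [this, hΛ2, hsq]; ring
      rw [← this, abs_mul, abs_of_pos (by positivity : 0 < Λ + √a * lam)]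
      gcongr
      linarith
    have f2 : max |Λ| |√a * lam| ≤ 2 * √a * lam :=
      max_le (by rwa [abs_of_pos hΛ0]) (by rw [abs_of_pos hX]; linarith)
    have f3 : lam ^ (d - 1) / lam ≤ lam ^ ((d : ℝ) - θ) := by
      have : lam ^ (d - 1) / lam = lam ^ ((d : ℝ) - 2) := by
        rw [Real.rpow_sub hl0, Real.rpow_natCast, Real.rpow_two]
        obtain ⟨k, rfl⟩ : ∃ k, d = k + 1 := ⟨d - 1, by omega⟩
        rw [Nat.add_sub_cancel]
        field_simp
        ring
      rw [this]
      exact Real.rpow_le_rpow_of_exponent_le hl (by linarith)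
    calc _ ≤ |Λ - √a * lam| * d * max |Λ| |√a * lam| ^ (d - 1) := abs_pow_sub_pow_le _ _ _
      _ ≤ |b| / (√a * lam) * d * (2 * √a * lam) ^ (d - 1) := by gcongr
      _ = |b| / √a * d * (2 * √a) ^ (d - 1) * (lam ^ (d - 1) / lam) := by
          rw [mul_pow _ lam]; field_simp
      _ ≤ _ := by gcongr
  have hpos : 0 ≤ lam ^ ((d : ℝ) - θ) := by positivity
  rw [Real.norm_eq_abs, Real.norm_eq_abs, abs_of_nonneg hpos]
  calc |N (a * lam ^ 2 + b) - C₀ * √a ^ d * lam ^ d|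
      = |(N (a * lam ^ 2 + b) - C₀ * Λ ^ d) + C₀ * (Λ ^ d - (√a * lam) ^ d)| := by
        rw [mul_pow]; ring_nf
    _ ≤ C * ((2 * √a) ^ ((d : ℝ) - θ) * lam ^ ((d : ℝ) - θ)) +
        |C₀| * (|b| / √a * d * (2 * √a) ^ (d - 1) * lam ^ ((d : ℝ) - θ)) := by
      refine (abs_add_le _ _).trans (add_le_add ?_ ?_)
      · refine e1.trans ?_
        rw [mul_assoc]
        gcongr
      · rw [abs_mul]
        gcongr
    _ = _ := by ring

end LatticeEllipsoid

/-! ### The asymptotic formula -/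

open LatticeEllipsoid in
theorem theorem5p1 (n : ℕ) (hn : 2 ≤ n)
    (d : Fin n → ℕ) (hd : ∀ i, 2 ≤ d i)
    (Q : Fin n → Polynomial ℝ)
    (hQdeg : ∀ i, (Q i).natDegree = d i - 1)
    (hQcoeff : ∀ i, (Q i).coeff (d i - 2) = 0)
    (y : Fin n → ℝ) (P : Fin n → ℝ) (hP : ∀ i, 0 < P i)
    (a b : ℝ) (ha : 0 < a) :
    ∃ C : ℝ,
      (fun lam : ℝ => weightedLatticeSum y P Q (a * lam ^ 2 + b) - C * lam ^ (∑ i, d i))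
        =O[atTop]
      (fun lam : ℝ => lam ^ (((∑ i, d i : ℕ) : ℝ) - 1 - ((n : ℝ) - 1) / ((n : ℝ) + 1))) := by
  obtain ⟨C₀, C, hC, h⟩ := exists_abs_weightedLatticeSum_sub_le hn Q (fun i => d i - 2)
    (fun i => by rw [hQdeg]; have := hd i; omega) hQcoeff y hP
  have hsum : ∑ i, (d i - 2 + 2) = ∑ i, d i :=
    Finset.sum_congr rfl fun i _ => Nat.sub_add_cancel (hd i)
  simp only [hsum] at h
  have hn' : (0 : ℝ) < n + 1 := by positivity
  -- The saving `1 + (n - 1)/(n + 1)` is the exponent `2n/(n + 1)` found by balancing.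
  have hexp : ((∑ i, d i : ℕ) : ℝ) - 1 - ((n : ℝ) - 1) / ((n : ℝ) + 1) =
      ((∑ i, d i : ℕ) : ℝ) - 2 * n / (n + 1) := by
    field_simp
    ring
  have hd2 : 2 ≤ ∑ i, d i :=
    (hd ⟨0, by omega⟩).trans (Finset.single_le_sum (fun _ _ => Nat.zero_le _) (Finset.mem_univ _))
  rw [hexp]
  refine ⟨C₀ * √a ^ (∑ i, d i), isBigO_rescale (C := C * 3) ha hd2 ?_ (fun Λ hΛ => ?_)
    (by positivity)⟩
  · rw [div_le_iff₀ hn']; linarith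
  · obtain ⟨δ, hδ, hδ', hb⟩ := smoothing_balance hn hΛ
    refine (h Λ δ (by linarith) hδ hδ').trans ?_
    have : 0 ≤ Λ := by linarith
    calc _ ≤ C * Λ ^ (∑ i, d i) * (3 * Λ ^ (-(2 * n / (n + 1) : ℝ))) := by gcongr
      _ = _ := by ring
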